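/- **Setting.** Let $n,k\in\mathbb N$ (both $\ge 1$) and $0<T<\infty$. For a measurable function $f$ let $f^*(t)=\inf\{s\ge 0: |\{|f|>s\}|\le t\}$, $t>0$, be its decreasing rearrangement. *Spaces.* A Banach function space (BFS) is a linear space $X$ of measurable functions with a norm such that (P1) $\|f\|_X=0$ iff $f=0$ a.e.; (P2) $|f|\le g$, $g\in X$ implies $f\in X$ and $\|f\|_X\le\|g\|_X$; (P3) $0\le f_j\uparrow f$, $f_j\in X$ implies $\|f_j\|_X\to\|f\|_X$ (where $\|f\|_X=\infty$ if and only if $f\notin X$); (P4) for every measurable $B$ of finite measure there is $c_B$ with $\int_B|f|\le c_B\|f\|_X$ for all $f\in X$; (P5) $\|\chi_B\|_X<\infty$ for every measurable $B$ of finite measure. A rearrangement-invariant space (RIS) is a BFS $E$ such that $f^*\le g^*$, $g\in E$ implies $f\in E$ and $\|f\|_E\le\|g\|_E$. A generalized Banach function space (GBFS) $X=X(0,T)$ satisfies (P1)–(P3) on $(0,T)$ and, for every measurable $B\subset(0,T)$ with $|B|>0$: (P4') there are $h_B>0$ a.e. in $B$ and $c_B>0$ with $\int_B h_B|f|\le c_B\|f\|_X$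 for all $f\in X$; (P5') there is $f_B\in X$ with $f_B>0$ a.e. in $B$. Let $E=E(\mathbb R^n)$ be an RIS of complex-valued functions, and let $\widetilde E(0,\infty)$ be its Luxemburg representation, i.e. the RIS with $\|f\|_E=\|f^*\|_{\widetilde E}$. Put $\|h\|_{\widetilde E'}=\sup\{\int_0^\infty h^*f^*\,dt:\|f\|_{\widetilde E}\le1\}$. $\widetilde E(0,T)$ and $\widetilde E'(0,T)$ denote the restrictions to $(0,T)$ (functions are extended by zero), and $\widetilde E_0(0,T)$ is the set of non-negative non-increasing $\sigma\in\widetilde E(0,T)$. *Potentials.* Let $\Phi:(0,\infty)\to[0,\infty)$ be continuous and non-increasing with $0<\int_0^\infty\Phi(z)z^{n-1}dz<\infty$, let $G(x)=\Phi(|x|)$ and $\varphi(\tau)=\Phi((\tau/V_n)^{1/n})$, where $V_n$ is the volume of the unit ball of $\mathbb R^n$. Assume that $\varphi\in\widetilde E'(0,T)$, that $\Phi\in C^k(0,\infty)$, and that for some $a_1,a_2,z_1,\delta_1>0$, with $\Phi_j(z)=\left(\frac1z\frac{d}{dz}\right)^j\Phi(z)$, $$\max_{1\le j\le k}z^{2j}|\Phi_j(z)|\le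 a_1\Phi(z)\ \ (0<z\le z_1),\qquad \max_{1\le j\le k}z^{2j}|\Phi_j(z)|\le a_2z^k\Phi(z)\ \ (z>z_1),$$ $$(-1)^kz^k\Phi^{(k)}(z)\ge\delta_1\Phi(z)\ \ (0<z\le z_1).$$ Let $H^G_E=\{G*f:f\in E\}$ with $\|u\|_{H^G_E}=\inf\{\|f\|_E:f\in E,\ G*f=u\}$. *Calderón spaces.* Let $C=C(\mathbb R^n)$ be the space of bounded uniformly continuous complex-valued functions with the sup-norm, and $\omega_k(u;t)=\sup_{|h|\le t}\|\Delta_h^ku\|_C$. For a GBFS $X=X(0,T)$ let $$\Lambda^k(C;X)=\{u\in C:\ \omega_k(u;t^{1/n})\in X\},\qquad \|u\|_{\Lambda^k(C;X)}=\|u\|_C+\|\omega_k(u;t^{1/n})\|_X .$$ *The cone and optimality.* Let $\Omega_\varphi(t,\tau)=\varphi(\tau)/(1+(\tau/t)^{k/n})$. Let $K$ be the cone of all functions $h(t)=\int_0^T\Omega_\varphi(t,\tau)\sigma(\tau)\,d\tau$, $t\in(0,T)$, with $\sigma\in\widetilde E_0(0,T)$, and let $\varrho_K(h)$ be the infimum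 of $\|\sigma\|_{\widetilde E(0,T)}$ over all such $\sigma$ representing $h$. For a GBFS $X=X(0,T)$, $K\mapsto X$ means that $K\subset X$ and $\|h\|_X\le c\,\varrho_K(h)$ for all $h\in K$, with some constant $c>0$. A GBFS $X_0=X_0(0,T)$ is optimal for the embedding $K\mapsto X$ if $K\mapsto X_0$, and $X_0\subset Y$ for every GBFS $Y=Y(0,T)$ with $K\mapsto Y$. **Corollary.** Let $X_0=X_0(0,T)$ be an optimal GBFS for the embedding $K\mapsto X$. Then $\Lambda^k(C;X_0)$ is the optimal Calderón space for the embedding $H^G_E\hookrightarrow\Lambda^k(C;X)$, that is, $$H^G_E\hookrightarrow\Lambda^k(C;X_0),$$ and for every GBFS $X=X(0,T)$, $$H^G_E\hookrightarrow\Lambda^k(C;X)\quad\text{implies}\quad\Lambda^k(C;X_0)\hookrightarrow\Lambda^k(C;X),$$ where $\hookrightarrow$ denotes a continuous embedding (inclusion with a norm bound). -/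

import Mathlib

open MeasureTheory Set
open scoped ENNReal NNReal

namespace CalderonEmb

noncomputable section

/-! ### Function norms, Banach function spaces, rearrangement-invariant spaces -/

/-- The decreasing rearrangement `f*(t) = inf {s ≥ 0 : μ {x : f x > s} ≤ t}`, `t > 0`, of a
non-negative function `f` (for a scalar function apply it to `|f|`). -/
def rearr {α : Type} [MeasurableSpace α] (μ : Measure α) (f : α → ℝ≥0∞) (t : ℝ) : ℝ≥0∞ :=
  sInf {s : ℝ≥0∞ | μ {x | s < f x} ≤ ENNReal.ofReal t}

/-- A function norm on a measure space: the part of the axioms shared by Banach function spaces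
and generalized Banach function spaces. The space itself consists of the measurable functions `f`
with `toFun |f| < ∞`, and its norm is `‖f‖ = toFun |f|`. The values of `toFun` at functions which
are not a.e. measurable are irrelevant. -/
structure FunctionNorm {α : Type} [MeasurableSpace α] (μ : Measure α) where
  toFun : (α → ℝ≥0∞) → ℝ≥0∞
  /-- the triangle inequality -/
  add_le' : ∀ f g : α → ℝ≥0∞, AEMeasurable f μ → AEMeasurable g μ →
    toFun (fun x => f x + g x) ≤ toFun f + toFun g
  /-- homogeneity -/
  smul' : ∀ (c : ℝ≥0) (f : α → ℝ≥0∞), AEMeasurable f μ →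
    toFun (fun x => c * f x) = c * toFun f
  /-- (P1) -/
  eq_zero_iff' : ∀ f : α → ℝ≥0∞, AEMeasurable f μ → (toFun f = 0 ↔ f =ᵐ[μ] 0)
  /-- (P2) -/
  mono' : ∀ f g : α → ℝ≥0∞, AEMeasurable f μ → AEMeasurable g μ →
    f ≤ᵐ[μ] g → toFun f ≤ toFun g
  /-- (P3), the Fatou property -/
  fatou' : ∀ f : ℕ → α → ℝ≥0∞, (∀ j, AEMeasurable (f j) μ) → Monotone f →
    toFun (fun x => ⨆ j, f j x) = ⨆ j, toFun (f j)

/-- The non-negative function `f` belongs to the space generated by the function norm. -/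
def FunctionNorm.Mem {α : Type} [MeasurableSpace α] {μ : Measure α} (ρ : FunctionNorm μ)
    (f : α → ℝ≥0∞) : Prop :=
  AEMeasurable f μ ∧ ρ.toFun f < ∞

/-- Banach function spaces (BFS). -/
structure BFS {α : Type} [MeasurableSpace α] (μ : Measure α) extends FunctionNorm μ where
  /-- (P4) -/
  lintegral_le' : ∀ B : Set α, MeasurableSet B → μ B < ∞ →
    ∃ c : ℝ≥0, ∀ f : α → ℝ≥0∞, AEMeasurable f μ → ∫⁻ x in B, f x ∂μ ≤ c * toFun f
  /-- (P5) -/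
  indicator_lt' : ∀ B : Set α, MeasurableSet B → μ B < ∞ → toFun (B.indicator 1) < ∞

/-- Rearrangement-invariant spaces (RIS) on `ℝⁿ`. -/
structure RIS (n : ℕ) extends BFS (volume : Measure (EuclideanSpace ℝ (Fin n))) where
  /-- `f* ≤ g*` implies `‖f‖ ≤ ‖g‖` -/
  rearr_mono' : ∀ f g : EuclideanSpace ℝ (Fin n) → ℝ≥0∞, AEMeasurable f → AEMeasurable g →
    (∀ t : ℝ, 0 < t → rearr volume f t ≤ rearr volume g t) → toFun f ≤ toFun g

/-- Generalized Banach function spaces (GBFS) on `(0,T)`. -/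
structure GBFS (T : ℝ) extends FunctionNorm ((volume : Measure ℝ).restrict (Ioo 0 T)) where
  /-- (P4) -/
  lintegral_le' : ∀ B : Set ℝ, MeasurableSet B → B ⊆ Ioo 0 T → 0 < volume B →
    ∃ (w : ℝ → ℝ≥0) (c : ℝ≥0), Measurable w ∧ (∀ᵐ t ∂volume.restrict B, 0 < w t) ∧
      ∀ f : ℝ → ℝ≥0∞, AEMeasurable f (volume.restrict (Ioo 0 T)) →
        ∫⁻ t in B, w t * f t ≤ c * toFun f
  /-- (P5) -/
  exists_pos' : ∀ B : Set ℝ, MeasurableSet B → B ⊆ Ioo 0 T → 0 < volume B →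
    ∃ f : ℝ → ℝ≥0∞, toFunctionNorm.Mem f ∧ ∀ᵐ t ∂volume.restrict B, 0 < f t

/-! ### The Luxemburg representation and the associate space -/

/-- The volume `V_n` of the unit ball of `ℝⁿ`. -/
def ballVol (n : ℕ) : ℝ := (volume (Metric.ball (0 : EuclideanSpace ℝ (Fin n)) 1)).toReal

/-- The norm of the Luxemburg representation `Ẽ(0,∞)` of `E(ℝⁿ)`. The function
`x ↦ g*(V_n |x|ⁿ)` on `ℝⁿ` has the same decreasing rearrangement as `g`, so this is the unique
rearrangement-invariant norm on `(0,∞)` with `‖f‖_E = ‖f*‖_Ẽ`. -/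
def luxNorm {n : ℕ} (E : RIS n) (g : ℝ → ℝ≥0∞) : ℝ≥0∞ :=
  E.toFun (fun x => rearr (volume.restrict (Ioi 0)) g (ballVol n * ‖x‖ ^ n))

/-- The norm of `Ẽ(0,T)`: extension by zero from `(0,T)` to `(0,∞)`. -/
def luxNormOn {n : ℕ} (E : RIS n) (T : ℝ) (g : ℝ → ℝ≥0∞) : ℝ≥0∞ :=
  luxNorm E ((Ioo 0 T).indicator g)

/-- The norm of the associate space `Ẽ'(0,∞)`:
`‖h‖ = sup {∫₀^∞ h* f* : ‖f‖_Ẽ ≤ 1}`. -/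
def assocNorm {n : ℕ} (E : RIS n) (h : ℝ → ℝ≥0∞) : ℝ≥0∞ :=
  ⨆ (f : ℝ → ℝ≥0∞) (_ : AEMeasurable f (volume.restrict (Ioi 0)) ∧ luxNorm E f ≤ 1),
    ∫⁻ t in Ioi (0 : ℝ),
      rearr (volume.restrict (Ioi 0)) h t * rearr (volume.restrict (Ioi 0)) f t

/-- The norm of `Ẽ'(0,T)`, the restriction of `Ẽ'(0,∞)` to `(0,T)`. -/
def assocNormOn {n : ℕ} (E : RIS n) (T : ℝ) (h : ℝ → ℝ≥0∞) : ℝ≥0∞ :=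
  assocNorm E ((Ioo 0 T).indicator h)

/-! ### Generalized Bessel potentials -/

/-- The standing assumptions on `Φ : (0,∞) → [0,∞)`; the kernel is `G(x) = Φ(|x|)`. -/
structure IsStandard (n : ℕ) (Φ : ℝ → ℝ) : Prop where
  nonneg : ∀ z, 0 < z → 0 ≤ Φ z
  continuousOn : ContinuousOn Φ (Ioi 0)
  antitoneOn : AntitoneOn Φ (Ioi 0)
  integrableOn : IntegrableOn (fun z => Φ z * z ^ (n - 1)) (Ioi 0)
  integral_pos : 0 < ∫ z in Ioi (0 : ℝ), Φ z * z ^ (n - 1)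

/-- `φ(τ) = Φ((τ / V_n)^{1/n})`. -/
def phi (n : ℕ) (Φ : ℝ → ℝ) (τ : ℝ) : ℝ := Φ ((τ / ballVol n) ^ (1 / (n : ℝ)))

/-- The functions `Φ_j = ((1/z) d/dz)^j Φ`. -/
def radialDeriv (j : ℕ) (Φ : ℝ → ℝ) : ℝ → ℝ :=
  (fun (g : ℝ → ℝ) (z : ℝ) => z⁻¹ * deriv g z)^[j] Φ

/-- `f : ℝⁿ → ℂ` belongs to `E(ℝⁿ)`. -/
def RIS.MemComplex {n : ℕ} (E : RIS n) (f : EuclideanSpace ℝ (Fin n) → ℂ) : Prop :=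
  AEMeasurable f ∧ E.toFun (fun x => ‖f x‖ₑ) < ∞

/-- `(G ∗ f)(x) = ∫ G(x - y) f(y) dy` with `G(x) = Φ(|x|)`. -/
def potential {n : ℕ} (Φ : ℝ → ℝ) (f : EuclideanSpace ℝ (Fin n) → ℂ)
    (x : EuclideanSpace ℝ (Fin n)) : ℂ :=
  ∫ y, (Φ ‖x - y‖ : ℂ) * f y

/-- The space of potentials `H^G_E(ℝⁿ) = {G ∗ f : f ∈ E(ℝⁿ)}`. -/
def potentialSpace {n : ℕ} (E : RIS n) (Φ : ℝ → ℝ) : Set (EuclideanSpace ℝ (Fin n) → ℂ) :=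
  {u | ∃ f, E.MemComplex f ∧ potential Φ f = u}

/-- `‖u‖_{H^G_E} = inf {‖f‖_E : f ∈ E(ℝⁿ), G ∗ f = u}`. -/
def potentialNorm {n : ℕ} (E : RIS n) (Φ : ℝ → ℝ) (u : EuclideanSpace ℝ (Fin n) → ℂ) : ℝ≥0∞ :=
  ⨅ (f : EuclideanSpace ℝ (Fin n) → ℂ) (_ : E.MemComplex f ∧ potential Φ f = u),
    E.toFun (fun x => ‖f x‖ₑ)

/-! ### Moduli of smoothness and Calderón spaces -/

/-- The supremum norm `‖u‖_C`. -/
def supNorm {n : ℕ} (u : EuclideanSpace ℝ (Fin n) → ℂ) : ℝ≥0∞ := ⨆ x, ‖u x‖ₑ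

/-- The space `C(ℝⁿ)` of bounded uniformly continuous complex-valued functions. -/
def boundedUC (n : ℕ) : Set (EuclideanSpace ℝ (Fin n) → ℂ) :=
  {u | UniformContinuous u ∧ supNorm u < ∞}

/-- The modulus of smoothness `ω_k(u;t) = sup_{|h| ≤ t} ‖Δ_h^k u‖_C`. -/
def modulus {n : ℕ} (k : ℕ) (u : EuclideanSpace ℝ (Fin n) → ℂ) (t : ℝ) : ℝ≥0∞ :=
  ⨆ (h : EuclideanSpace ℝ (Fin n)) (_ : ‖h‖ ≤ t), supNorm ((fwdDiff h)^[k] u)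

/-- The function `t ↦ ω_k(u; t^{1/n})`. -/
def scaledModulus {n : ℕ} (k : ℕ) (u : EuclideanSpace ℝ (Fin n) → ℂ) (t : ℝ) : ℝ≥0∞ :=
  modulus k u (t ^ (1 / (n : ℝ)))

/-- The Calderón space `Λ^k(C;X) = {u ∈ C(ℝⁿ) : ω_k(u; t^{1/n}) ∈ X(0,T)}`. -/
def calderonSpace (n k : ℕ) {T : ℝ} (X : GBFS T) : Set (EuclideanSpace ℝ (Fin n) → ℂ) :=
  {u | u ∈ boundedUC n ∧ X.Mem (scaledModulus k u)}

/-- `‖u‖_{Λ^k(C;X)} = ‖u‖_C + ‖ω_k(u; t^{1/n})‖_X`. -/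
def calderonNorm (n k : ℕ) {T : ℝ} (X : GBFS T) (u : EuclideanSpace ℝ (Fin n) → ℂ) : ℝ≥0∞ :=
  supNorm u + X.toFun (scaledModulus k u)

/-- The continuous embedding `A ↪ B` of two normed function spaces, given by their underlying
sets and their norms: `A ⊆ B`, and the inclusion is bounded. -/
def Embeds {F : Type} (A : Set F) (normA : F → ℝ≥0∞) (B : Set F) (normB : F → ℝ≥0∞) : Prop :=
  A ⊆ B ∧ ∃ c : ℝ≥0, ∀ u ∈ A, normB u ≤ c * normA u

/-! ### Cones and optimal spaces -/

/-- The embedding `K ↦ X` of a cone `K` with functional `ρ` into a GBFS `X`. -/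
def ConeEmbeds {T : ℝ} (K : Set (ℝ → ℝ≥0∞)) (ρ : (ℝ → ℝ≥0∞) → ℝ≥0∞) (X : GBFS T) : Prop :=
  (∀ h ∈ K, X.Mem h) ∧ ∃ c : ℝ≥0, ∀ h ∈ K, X.toFun h ≤ c * ρ h

/-- `X₀` is an optimal GBFS for the embedding `K ↦ X`. -/
def IsOptimal {T : ℝ} (K : Set (ℝ → ℝ≥0∞)) (ρ : (ℝ → ℝ≥0∞) → ℝ≥0∞) (X₀ : GBFS T) : Prop :=
  ConeEmbeds K ρ X₀ ∧ ∀ Y : GBFS T, ConeEmbeds K ρ Y → ∀ f : ℝ → ℝ≥0∞, X₀.Mem f → Y.Mem f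

/-- `Ω_φ(t,τ) = φ(τ) / (1 + (τ/t)^{k/n})`. -/
def bigOmega (n k : ℕ) (Φ : ℝ → ℝ) (t τ : ℝ) : ℝ :=
  phi n Φ τ / (1 + (τ / t) ^ ((k : ℝ) / (n : ℝ)))

/-- `σ ∈ Ẽ₀(0,T)` and `h(t) = ∫₀^T Ω_φ(t,τ) σ(τ) dτ` for `t ∈ (0,T)`. -/
def Represents {n : ℕ} (k : ℕ) (E : RIS n) (Φ : ℝ → ℝ) (T : ℝ) (σ h : ℝ → ℝ≥0∞) : Prop :=
  AntitoneOn σ (Ioo 0 T) ∧ luxNormOn E T σ < ∞ ∧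
    ∀ t ∈ Ioo 0 T, h t = ∫⁻ τ in Ioo 0 T, ENNReal.ofReal (bigOmega n k Φ t τ) * σ τ

/-- The cone `K = K(E, φ, T)`. -/
def coneK {n : ℕ} (k : ℕ) (E : RIS n) (Φ : ℝ → ℝ) (T : ℝ) : Set (ℝ → ℝ≥0∞) :=
  {h | ∃ σ, Represents k E Φ T σ h}

/-- The functional `ρ_K(h) = inf {‖σ‖_{Ẽ(0,T)} : σ ∈ Ẽ₀(0,T) represents h}`. -/
def rhoK {n : ℕ} (k : ℕ) (E : RIS n) (Φ : ℝ → ℝ) (T : ℝ) (h : ℝ → ℝ≥0∞) : ℝ≥0∞ :=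
  ⨅ (σ : ℝ → ℝ≥0∞) (_ : Represents k E Φ T σ h), luxNormOn E T σ

end

end CalderonEmb

open CalderonEmb

open MeasureTheory Set
open scoped ENNReal NNReal Pointwise

namespace CalderonEmb

/-! ### Decreasing rearrangements -/

section Rearrangement

variable {α : Type} [MeasurableSpace α] {μ : Measure α}

/-! The theorem reduces to an equivalence valid for every GBFS $X$:
$H^G_E\hookrightarrow\Lambda^k(C;X)$ holds if and only if $K\mapsto X$
(`IsRegularKernel.embeds_of_coneEmbeds`, `IsRegularKernel.coneEmbeds_of_embeds`). Applied to $X_0$,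
it gives the first embedding. If the potentials embed into $\Lambda^k(C;X)$, it gives $K\mapsto X$,
so $X_0\subset X$ by optimality. The Fatou property makes such an inclusion bounded
(`FunctionNorm.exists_toFun_le_of_subset`), and boundedness passes to the Calderón spaces.

Upper half: $\omega_k(G*f;t^{1/n})\le C\int_0^T\Omega_\varphi(t,\tau)f^*(\tau)\,d\tau$
(`IsRegularKernel.exists_scaledModulus_le`). With $r=t^{1/n}$ the $k$-th difference of $G$ is
bounded without cancellation for $|w|<2kr$. At intermediate distances it is bounded by
$(r/|w|)^k\Phi(|w|)$, which is comparable to $\Omega_\varphi$ there, and far away by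
$r^k\Phi(|w|/2)$. All three majorants are radially nonincreasing, so the Hardy-Littlewood inequality
replaces $f$ by $f^*$, and the far term is absorbed into the others. Since $f^*$ itself is an
admissible $\sigma$, the right-hand side is an element of $K$ with $\varrho_K\le\|f\|_E$.
Boundedness and uniform continuity of $G*f$ follow from $\varphi\in\widetilde E'(0,T)$ and the
integrability of $\varphi$.

Lower half: every $h\in K$ is dominated by the modulus of a potential
(`IsRegularKernel.exists_lintegral_le_scaledModulus`). Given $\sigma$, take $f(y)=\sigma(V_n|y|^n)$
on a small ball intersected with a narrow cone about a direction $-e$. There the $k$-th derivative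
of $G(-y)$ along $e$ has the sign $(-1)^k$ and size at least a multiple of $\Phi(|y|)/|y|^k$, being
a small perturbation of the radial derivative. Hence nothing cancels in $\Delta^k_{\delta
e}(G*f)(0)$, and polar coordinates in the cone recover $\int\Omega_\varphi\sigma$. -/

theorem rearr_le_iff (f : α → ℝ≥0∞) (t : ℝ) (s : ℝ≥0∞) :
    rearr μ f t ≤ s ↔ μ {x | s < f x} ≤ ENNReal.ofReal t := by
  constructor
  · intro h
    -- The infimum is attained: along a decreasing minimizing sequence the superlevel sets increase,
    -- and the measure is continuous from below.
    obtain ⟨v, hv, hvlim, hvmem⟩ := exists_seq_tendsto_sInf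
      (S := {s : ℝ≥0∞ | μ {x | s < f x} ≤ ENNReal.ofReal t}) ⟨⊤, by simp⟩ (OrderBot.bddBelow _)
    have hsub : {x | s < f x} ⊆ ⋃ m, {x | v m < f x} := by
      intro x hx
      have : ∀ᶠ m in Filter.atTop, v m < f x :=
        hvlim.eventually_lt_const (lt_of_le_of_lt h hx)
      obtain ⟨m, hm⟩ := this.exists
      exact mem_iUnion.2 ⟨m, hm⟩
    have hmono : Monotone fun m => {x | v m < f x} :=
      fun a b hab x hx => lt_of_le_of_lt (hv hab) hx
    calc μ {x | s < f x} ≤ μ (⋃ m, {x | v m < f x}) := measure_mono hsub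
      _ = ⨆ m, μ {x | v m < f x} := hmono.directed_le.measure_iUnion
      _ ≤ ENNReal.ofReal t := iSup_le hvmem
  · intro h
    exact sInf_le h

theorem lt_rearr_iff (f : α → ℝ≥0∞) (t : ℝ) (s : ℝ≥0∞) :
    s < rearr μ f t ↔ ENNReal.ofReal t < μ {x | s < f x} := by
  rw [← not_le, rearr_le_iff, not_le]

theorem rearr_antitone (f : α → ℝ≥0∞) : Antitone (rearr μ f) := by
  intro t t' h
  rw [rearr_le_iff]
  exact ((rearr_le_iff f t _).1 le_rfl).trans (ENNReal.ofReal_le_ofReal h)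

theorem measurable_rearr (f : α → ℝ≥0∞) : Measurable (rearr μ f) :=
  (rearr_antitone f).measurable

theorem rearr_le_rearr {β : Type} [MeasurableSpace β] {ν : Measure β} {f : α → ℝ≥0∞}
    {g : β → ℝ≥0∞} (h : ∀ s, μ {x | s < f x} ≤ ν {x | s < g x}) (t : ℝ) :
    rearr μ f t ≤ rearr ν g t := by
  rw [rearr_le_iff]
  exact (h _).trans ((rearr_le_iff g t _).1 le_rfl)

theorem rearr_mono {f g : α → ℝ≥0∞} (h : f ≤ᵐ[μ] g) (t : ℝ) : rearr μ f t ≤ rearr μ g t := by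
  refine rearr_le_rearr (fun s => measure_mono_ae ?_) t
  filter_upwards [h] with x hx hs
  exact lt_of_lt_of_le hs hx

theorem rearr_congr {f g : α → ℝ≥0∞} (h : f =ᵐ[μ] g) : rearr μ f = rearr μ g :=
  funext fun t => le_antisymm (rearr_mono h.le t) (rearr_mono h.symm.le t)

/-- The case $c=\infty$ is included, so this yields both equimeasurability of $f$ and $f^*$ and the
layer-cake formula without finiteness assumptions. -/
theorem measure_ofReal_lt (c : ℝ≥0∞) :
    (volume.restrict (Ioi (0 : ℝ))) {r | ENNReal.ofReal r < c} = c := by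
  rw [Measure.restrict_apply (measurableSet_lt ENNReal.measurable_ofReal measurable_const)]
  induction c with
  | top => simp
  | coe x =>
    have : {r | ENNReal.ofReal r < (x : ℝ≥0∞)} ∩ Ioi (0 : ℝ) = Ioo 0 (x : ℝ) := by
      ext r
      simp only [mem_inter_iff, mem_ofPred_eq, mem_Ioi, mem_Ioo]
      rw [and_comm]
      refine and_congr_right fun hr => ?_
      rw [← ENNReal.ofReal_coe_nnreal, ENNReal.ofReal_lt_ofReal_iff_of_nonneg hr.le]
    rw [this]
    simp

/-- Functions and their rearrangements are equimeasurable. -/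
theorem measure_lt_rearr (f : α → ℝ≥0∞) (s : ℝ≥0∞) :
    (volume.restrict (Ioi (0 : ℝ))) {t | s < rearr μ f t} = μ {x | s < f x} := by
  simp only [lt_rearr_iff]
  exact measure_ofReal_lt _

theorem rearr_rearr (f : α → ℝ≥0∞) (t : ℝ) :
    rearr (volume.restrict (Ioi 0)) (rearr μ f) t = rearr μ f t :=
  le_antisymm (rearr_le_rearr (fun s => (measure_lt_rearr f s).le) t)
    (rearr_le_rearr (fun s => (measure_lt_rearr f s).ge) t)

theorem rearr_const_mul (f : α → ℝ≥0∞) {c : ℝ≥0} (hc : c ≠ 0) (t : ℝ) :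
    rearr μ (fun x => c * f x) t = c * rearr μ f t := by
  have hc0 : (c : ℝ≥0∞) ≠ 0 := by simpa using hc
  refine eq_of_forall_lt_iff fun s => ?_
  have key : ∀ y : ℝ≥0∞, s < c * y ↔ s / c < y := fun y => by
    rw [ENNReal.div_lt_iff (Or.inl hc0) (Or.inl ENNReal.coe_ne_top), mul_comm]
  rw [lt_rearr_iff, key, lt_rearr_iff]
  simp only [key]

theorem eq_lintegral_indicator_ofReal_lt (c : ℝ≥0∞) :
    c = ∫⁻ r in Ioi (0 : ℝ), {r : ℝ | ENNReal.ofReal r < c}.indicator 1 r := by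
  rw [lintegral_indicator_one (measurableSet_lt ENNReal.measurable_ofReal measurable_const),
    measure_ofReal_lt]

/-- Each factor is the integral of the indicators of its superlevel sets; two applications of
Tonelli leave only measures of intersections of such sets. -/
theorem lintegral_mul_eq_layercake [SFinite μ] {a g : α → ℝ≥0∞} (ha : Measurable a)
    (hg : Measurable g) :
    ∫⁻ x, a x * g x ∂μ = ∫⁻ s in Ioi (0 : ℝ), ∫⁻ r in Ioi (0 : ℝ),
      μ {x | ENNReal.ofReal s < a x ∧ ENNReal.ofReal r < g x} := by
  have hSa : MeasurableSet {p : α × ℝ | ENNReal.ofReal p.2 < a p.1} :=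
    measurableSet_lt (ENNReal.measurable_ofReal.comp measurable_snd) (ha.comp measurable_fst)
  have hSg : MeasurableSet {p : α × ℝ | ENNReal.ofReal p.2 < g p.1} :=
    measurableSet_lt (ENNReal.measurable_ofReal.comp measurable_snd) (hg.comp measurable_fst)
  have hIa : Measurable fun p : α × ℝ =>
      {p : α × ℝ | ENNReal.ofReal p.2 < a p.1}.indicator (1 : α × ℝ → ℝ≥0∞) p :=
    measurable_one.indicator hSa
  have hIg : Measurable fun p : α × ℝ =>
      {p : α × ℝ | ENNReal.ofReal p.2 < g p.1}.indicator (1 : α × ℝ → ℝ≥0∞) p :=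
    measurable_one.indicator hSg
  have h1 : ∀ x, a x * g x = ∫⁻ s in Ioi (0 : ℝ), ∫⁻ r in Ioi (0 : ℝ),
      {p : α × ℝ | ENNReal.ofReal p.2 < a p.1}.indicator 1 (x, s) *
      {p : α × ℝ | ENNReal.ofReal p.2 < g p.1}.indicator 1 (x, r) := by
    intro x
    have e1 : ∀ s : ℝ, ∫⁻ r in Ioi (0 : ℝ),
        {p : α × ℝ | ENNReal.ofReal p.2 < a p.1}.indicator 1 (x, s) *
        {p : α × ℝ | ENNReal.ofReal p.2 < g p.1}.indicator 1 (x, r) =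
        {p : α × ℝ | ENNReal.ofReal p.2 < a p.1}.indicator 1 (x, s) * g x := by
      intro s
      rw [lintegral_const_mul _ (f := fun r => {p : α × ℝ | ENNReal.ofReal p.2 < g p.1}.indicator 1 (x, r))
        (hIg.comp (measurable_const.prodMk measurable_id))]
      congr 1
      exact (eq_lintegral_indicator_ofReal_lt (g x)).symm
    simp_rw [e1]
    rw [lintegral_mul_const _ (f := fun s => {p : α × ℝ | ENNReal.ofReal p.2 < a p.1}.indicator 1 (x, s))
      (hIa.comp (measurable_const.prodMk measurable_id))]
    congr 1
    exact eq_lintegral_indicator_ofReal_lt (a x)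
  simp_rw [h1]
  have hm3 : Measurable fun q : (α × ℝ) × ℝ =>
      {p : α × ℝ | ENNReal.ofReal p.2 < a p.1}.indicator (1 : α × ℝ → ℝ≥0∞) (q.1.1, q.1.2) *
      {p : α × ℝ | ENNReal.ofReal p.2 < g p.1}.indicator (1 : α × ℝ → ℝ≥0∞) (q.1.1, q.2) :=
    (hIa.comp (by fun_prop)).mul (hIg.comp (by fun_prop))
  rw [lintegral_lintegral_swap (hm3.lintegral_prod_right').aemeasurable]
  refine lintegral_congr fun s => ?_
  rw [lintegral_lintegral_swap]
  · refine lintegral_congr fun r => ?_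
    have hms : MeasurableSet {x | ENNReal.ofReal s < a x ∧ ENNReal.ofReal r < g x} :=
      (measurableSet_lt measurable_const ha).inter (measurableSet_lt measurable_const hg)
    rw [← lintegral_indicator_one hms]
    refine lintegral_congr fun x => ?_
    by_cases h1 : ENNReal.ofReal s < a x <;> by_cases h2 : ENNReal.ofReal r < g x <;>
      simp [indicator, h1, h2]
  · have hg' : Measurable fun p : α × ℝ => ((p.1, s), p.2) := by fun_prop
    exact (hm3.comp hg').aemeasurable

/-- The Hardy-Littlewood inequality. -/
theorem lintegral_mul_le_rearr [SFinite μ] {a g : α → ℝ≥0∞} (ha : AEMeasurable a μ)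
    (hg : AEMeasurable g μ) :
    ∫⁻ x, a x * g x ∂μ ≤ ∫⁻ t in Ioi (0 : ℝ), rearr μ a t * rearr μ g t := by
  rw [rearr_congr ha.ae_eq_mk, rearr_congr hg.ae_eq_mk]
  refine (lintegral_congr_ae (ha.ae_eq_mk.mul hg.ae_eq_mk)).trans_le ?_
  refine (lintegral_mul_eq_layercake ha.measurable_mk hg.measurable_mk).trans_le ?_
  rw [lintegral_mul_eq_layercake (measurable_rearr _) (measurable_rearr _)]
  refine lintegral_mono fun s => lintegral_mono fun r => ?_
  -- Superlevel sets of rearrangements are nested intervals starting at $0$, so their intersection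
  -- has the smaller of the two measures, the largest value any two sets of these measures allow.
  have h : ∀ t, (ENNReal.ofReal s < rearr μ (ha.mk a) t ∧ ENNReal.ofReal r < rearr μ (hg.mk g) t) ↔
      ENNReal.ofReal t < min (μ {x | ENNReal.ofReal s < ha.mk a x})
        (μ {x | ENNReal.ofReal r < hg.mk g x}) := fun t => by
    rw [lt_rearr_iff, lt_rearr_iff, lt_min_iff]
  simp only [h]
  rw [measure_ofReal_lt]
  exact le_min (measure_mono fun x hx => hx.1) (measure_mono fun x hx => hx.2)

end Rearrangement

/-! ### Integrals of monotone functions -/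

/-- If `g` is nonincreasing, then `∫₀ᴸ g ≤ max(1, L/l) ∫₀ˡ g`. -/
theorem lintegral_Ioo_le_of_antitoneOn {g : ℝ → ℝ≥0∞} {l L : ℝ} (hl : 0 < l)
    (hg : AntitoneOn g (Ioo 0 (max l L))) :
    ∫⁻ t in Ioo 0 L, g t ≤ ENNReal.ofReal (max 1 (L / l)) * ∫⁻ t in Ioo 0 l, g t := by
  rcases le_or_gt L l with h | h
  · calc ∫⁻ t in Ioo 0 L, g t ≤ ∫⁻ t in Ioo 0 l, g t :=
          lintegral_mono_set (Ioo_subset_Ioo_right h)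
      _ = 1 * ∫⁻ t in Ioo 0 l, g t := (one_mul _).symm
      _ ≤ _ := by
        gcongr
        rw [← ENNReal.ofReal_one]
        exact ENNReal.ofReal_le_ofReal (le_max_left _ _)
  · rw [max_eq_right h.le] at hg
    have hlL : (1 : ℝ) ≤ L / l := by rw [le_div_iff₀ hl]; linarith
    rw [max_eq_right hlL]
    have hsplit : Ioo 0 L = Ioo 0 l ∪ Ico l L := (Ioo_union_Ico_eq_Ioo hl h.le).symm
    -- The value $g(l)$ separates the two pieces: it bounds $g$ below on $(0,l)$ and above on
    -- $[l,L)$.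
    have hbase : g l * ENNReal.ofReal l ≤ ∫⁻ t in Ioo 0 l, g t := by
      have : ∫⁻ _ in Ioo 0 l, g l = g l * ENNReal.ofReal l := by simp
      rw [← this]
      refine setLIntegral_mono' measurableSet_Ioo fun t ht => ?_
      exact hg ⟨ht.1, ht.2.trans h⟩ ⟨hl, h⟩ ht.2.le
    have htail : ∫⁻ t in Ico l L, g t ≤ g l * ENNReal.ofReal (L - l) := by
      have : ∫⁻ _ in Ico l L, g l = g l * ENNReal.ofReal (L - l) := by simp
      rw [← this]
      refine setLIntegral_mono' measurableSet_Ico fun t ht => ?_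
      exact hg ⟨hl, h⟩ ⟨hl.trans_le ht.1, ht.2⟩ ht.1
    have heq : ENNReal.ofReal (L - l) = ENNReal.ofReal (L / l - 1) * ENNReal.ofReal l := by
      rw [← ENNReal.ofReal_mul (by linarith)]
      congr 1
      field_simp
    rw [hsplit]
    calc ∫⁻ t in Ioo 0 l ∪ Ico l L, g t
        ≤ (∫⁻ t in Ioo 0 l, g t) + ∫⁻ t in Ico l L, g t := lintegral_union_le _ _ _
      _ ≤ (∫⁻ t in Ioo 0 l, g t) + ENNReal.ofReal (L / l - 1) * ∫⁻ t in Ioo 0 l, g t := by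
        gcongr
        calc _ ≤ g l * ENNReal.ofReal (L - l) := htail
          _ = ENNReal.ofReal (L / l - 1) * (g l * ENNReal.ofReal l) := by rw [heq]; ring
          _ ≤ _ := by gcongr
      _ = ENNReal.ofReal (L / l) * ∫⁻ t in Ioo 0 l, g t := by
        have : L / l = 1 + (L / l - 1) := by ring
        conv_rhs => rw [this, ENNReal.ofReal_add zero_le_one (by linarith), ENNReal.ofReal_one,
          add_mul, one_mul]

/-! ### The volume variable on `ℝⁿ` -/

section VolumeVariable

variable {n : ℕ}

theorem ballVol_pos (n : ℕ) : 0 < ballVol n :=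
  ENNReal.toReal_pos (Metric.measure_ball_pos _ _ one_pos).ne' measure_ball_lt_top.ne

theorem ofReal_ballVol (n : ℕ) :
    ENNReal.ofReal (ballVol n) = volume (Metric.ball (0 : EuclideanSpace ℝ (Fin n)) 1) :=
  ENNReal.ofReal_toReal measure_ball_lt_top.ne

/-- The radius of the ball of volume `τ` in `ℝⁿ`. -/
noncomputable def volRadius (n : ℕ) (τ : ℝ) : ℝ := (τ / ballVol n) ^ (1 / (n : ℝ))

theorem phi_eq (n : ℕ) (Φ : ℝ → ℝ) (τ : ℝ) : phi n Φ τ = Φ (volRadius n τ) := rfl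

theorem volRadius_nonneg {τ : ℝ} (hτ : 0 ≤ τ) : 0 ≤ volRadius n τ :=
  Real.rpow_nonneg (div_nonneg hτ (ballVol_pos n).le) _

theorem volRadius_pos {τ : ℝ} (hτ : 0 < τ) : 0 < volRadius n τ :=
  Real.rpow_pos_of_pos (div_pos hτ (ballVol_pos n)) _

theorem volRadius_pow (hn : 1 ≤ n) {τ : ℝ} (hτ : 0 ≤ τ) : ballVol n * volRadius n τ ^ n = τ := by
  have hV := ballVol_pos n
  rw [volRadius, one_div, Real.rpow_inv_natCast_pow (div_nonneg hτ hV.le) (by omega)]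
  field_simp

theorem volRadius_ballVol (hn : 1 ≤ n) {r : ℝ} (hr : 0 ≤ r) :
    volRadius n (ballVol n * r ^ n) = r := by
  have hV := ballVol_pos n
  rw [volRadius, mul_div_cancel_left₀ _ hV.ne', one_div, Real.pow_rpow_inv_natCast hr (by omega)]

theorem volRadius_mono {a b : ℝ} (ha : 0 ≤ a) (hab : a ≤ b) : volRadius n a ≤ volRadius n b := by
  have hV := ballVol_pos n
  unfold volRadius
  gcongr

theorem ballVol_mul_pow_lt_iff (hn : 1 ≤ n) {r τ : ℝ} (hr : 0 ≤ r) (hτ : 0 ≤ τ) :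
    ballVol n * r ^ n < τ ↔ r < volRadius n τ := by
  conv_lhs => rw [← volRadius_pow hn hτ]
  rw [mul_lt_mul_iff_right₀ (ballVol_pos n), pow_lt_pow_iff_left₀ hr (volRadius_nonneg hτ) (by omega)]

theorem volume_ball_volRadius (hn : 1 ≤ n) (x : EuclideanSpace ℝ (Fin n)) {τ : ℝ} (hτ : 0 ≤ τ) :
    volume (Metric.ball x (volRadius n τ)) = ENNReal.ofReal τ := by
  have : Nonempty (Fin n) := ⟨⟨0, by omega⟩⟩
  rw [Measure.addHaar_ball _ _ (volRadius_nonneg hτ), ← ofReal_ballVol,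
    ← ENNReal.ofReal_mul (pow_nonneg (volRadius_nonneg hτ) _), finrank_euclideanSpace,
    Fintype.card_fin, mul_comm, volRadius_pow hn hτ]

/-- A function which agrees with `α` on `(0,∞)` and is nonincreasing if `α` is so there. -/
noncomputable def topExtend (α : ℝ → ℝ≥0∞) (τ : ℝ) : ℝ≥0∞ := if τ ≤ 0 then ⊤ else α τ

theorem topExtend_antitone {α : ℝ → ℝ≥0∞} (hα : AntitoneOn α (Ioi 0)) : Antitone (topExtend α) := by
  intro a b hab
  unfold topExtend
  split_ifs with h1 h2 h2
  · exact le_rfl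
  · exact absurd (hab.trans h1) h2
  · exact le_top
  · exact hα (not_le.1 h2) (not_le.1 h1) hab

theorem le_topExtend (α : ℝ → ℝ≥0∞) (τ : ℝ) : α τ ≤ topExtend α τ := by
  unfold topExtend
  split_ifs <;> simp

/-- The Hardy-Littlewood inequality against radially nonincreasing weights. -/
theorem lintegral_radial_mul_le (hn : 1 ≤ n) {α : ℝ → ℝ≥0∞} (hα : AntitoneOn α (Ioi 0))
    (x : EuclideanSpace ℝ (Fin n)) {g : EuclideanSpace ℝ (Fin n) → ℝ≥0∞} (hg : AEMeasurable g) :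
    ∫⁻ y, α (ballVol n * ‖x - y‖ ^ n) * g y ≤ ∫⁻ τ in Ioi (0 : ℝ), α τ * rearr volume g τ := by
  have hmeas : Measurable fun y => topExtend α (ballVol n * ‖x - y‖ ^ n) :=
    (topExtend_antitone hα).measurable.comp (by fun_prop)
  calc ∫⁻ y, α (ballVol n * ‖x - y‖ ^ n) * g y
      ≤ ∫⁻ y, topExtend α (ballVol n * ‖x - y‖ ^ n) * g y := by
        refine lintegral_mono fun y => ?_
        gcongr
        exact le_topExtend _ _
    _ ≤ _ := lintegral_mul_le_rearr hmeas.aemeasurable hg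
    _ ≤ _ := by
        refine setLIntegral_mono' measurableSet_Ioi fun τ (hτ : 0 < τ) => ?_
        gcongr
        have h1 : α τ = topExtend α τ := by simp [topExtend, not_le.2 hτ]
        -- By monotonicity the weight exceeds its value at $\tau$ only inside the ball about $x$ of
        -- volume $\tau$.
        rw [rearr_le_iff, h1, ← volume_ball_volRadius hn x hτ.le]
        refine measure_mono fun y (hy : topExtend α τ < _) => ?_
        rw [Metric.mem_ball, dist_comm, dist_eq_norm,
          ← ballVol_mul_pow_lt_iff hn (norm_nonneg _) hτ.le]
        exact lt_of_not_ge fun hle => absurd (topExtend_antitone hα hle) (not_le.2 hy)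

/-- Polar coordinates for functions of the volume variable on a cone. -/
theorem map_volume_restrict_cone (hn : 1 ≤ n) {S : Set (EuclideanSpace ℝ (Fin n))}
    (hcone : ∀ r : ℝ, 0 < r → ∀ x, r • x ∈ S ↔ x ∈ S) :
    Measure.map (fun x => ballVol n * ‖x‖ ^ n) (volume.restrict S) =
      (volume (Metric.ball 0 1 ∩ S) / volume (Metric.ball (0 : EuclideanSpace ℝ (Fin n)) 1)) •
        volume.restrict (Ioi (0 : ℝ)) := by
  have : Nonempty (Fin n) := ⟨⟨0, by omega⟩⟩
  have hmv : Measurable fun x : EuclideanSpace ℝ (Fin n) => ballVol n * ‖x‖ ^ n := by fun_prop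
  set κ := volume (Metric.ball 0 1 ∩ S) / volume (Metric.ball (0 : EuclideanSpace ℝ (Fin n)) 1)
    with hκ
  have hb0 : volume (Metric.ball (0 : EuclideanSpace ℝ (Fin n)) 1) ≠ 0 :=
    (Metric.measure_ball_pos _ _ one_pos).ne'
  have hbt : volume (Metric.ball (0 : EuclideanSpace ℝ (Fin n)) 1) ≠ ⊤ := measure_ball_lt_top.ne
  have hκt : κ ≠ ⊤ := (ENNReal.div_lt_top (measure_inter_lt_top_of_left_ne_top hbt).ne hb0).ne
  have hIio : ∀ τ : ℝ, (Measure.map (fun x => ballVol n * ‖x‖ ^ n) (volume.restrict S)) (Iio τ) =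
      κ * ENNReal.ofReal τ := by
    intro τ
    rw [Measure.map_apply hmv measurableSet_Iio, Measure.restrict_apply (hmv measurableSet_Iio)]
    rcases le_or_gt τ 0 with h | h
    · rw [ENNReal.ofReal_of_nonpos h, mul_zero]
      convert measure_empty (μ := volume)
      ext x
      simp only [mem_inter_iff, mem_preimage, mem_Iio, mem_empty_iff_false, iff_false, not_and_or,
        not_lt]
      left
      exact h.trans (mul_nonneg (ballVol_pos n).le (by positivity))
    · have hr := volRadius_pos (n := n) h
      -- The sublevel set is a dilate of the part of the cone in the unit ball, so its volume is
      -- proportional to $\tau$; this determines the image measure.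
      have hset : (fun x => ballVol n * ‖x‖ ^ n) ⁻¹' Iio τ ∩ S =
          volRadius n τ • (Metric.ball 0 1 ∩ S) := by
        ext x
        rw [mem_smul_set_iff_inv_smul_mem₀ hr.ne']
        simp only [mem_inter_iff, mem_preimage, mem_Iio]
        rw [ballVol_mul_pow_lt_iff hn (norm_nonneg _) h.le, mem_ball_zero_iff, norm_smul, norm_inv,
          Real.norm_of_nonneg hr.le, inv_mul_lt_one₀ hr, hcone _ (inv_pos.2 hr)]
      rw [hset, Measure.addHaar_smul, abs_of_nonneg (pow_nonneg hr.le _), finrank_euclideanSpace,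
        Fintype.card_fin]
      conv_rhs => rw [← volRadius_pow hn h.le, ENNReal.ofReal_mul (ballVol_pos n).le,
        ofReal_ballVol]
      rw [hκ, ← mul_assoc, ENNReal.div_mul_cancel hb0 hbt, mul_comm]
  refine Measure.ext_of_Ico' _ _ (fun a b _ => ?_) fun a b hab => ?_
  · refine ne_top_of_le_ne_top ?_ (measure_mono (Ico_subset_Iio_self))
    rw [hIio]
    exact ENNReal.mul_ne_top hκt ENNReal.ofReal_ne_top
  · have hIio' : ∀ τ : ℝ, (κ • volume.restrict (Ioi (0 : ℝ))) (Iio τ) = κ * ENNReal.ofReal τ := by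
      intro τ
      rw [Measure.smul_apply, Measure.restrict_apply measurableSet_Iio, inter_comm, Ioi_inter_Iio,
        Real.volume_Ioo, sub_zero, smul_eq_mul]
    have h1 : Ico a b = Iio b \ Iio a := by ext; simp
    have hfin : ∀ τ : ℝ, κ * ENNReal.ofReal τ ≠ ⊤ := fun τ =>
      ENNReal.mul_ne_top hκt ENNReal.ofReal_ne_top
    rw [h1, measure_sdiff (Iio_subset_Iio hab.le) measurableSet_Iio.nullMeasurableSet,
      measure_sdiff (Iio_subset_Iio hab.le) measurableSet_Iio.nullMeasurableSet]
    · simp only [hIio, hIio']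
    · rw [hIio']; exact hfin a
    · rw [hIio]; exact hfin a

end VolumeVariable

/-! ### Rearrangements and rearrangement-invariant norms -/

section RearrangementInvariant

variable {n : ℕ}

theorem measure_volVar_preimage (hn : 1 ≤ n) {A : Set ℝ} (hA : MeasurableSet A) :
    volume {x : EuclideanSpace ℝ (Fin n) | ballVol n * ‖x‖ ^ n ∈ A} =
      (volume.restrict (Ioi (0 : ℝ))) A := by
  have h := map_volume_restrict_cone hn (S := (univ : Set (EuclideanSpace ℝ (Fin n))))
    (by simp)
  rw [inter_univ, ENNReal.div_self (Metric.measure_ball_pos _ _ one_pos).ne'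
    measure_ball_lt_top.ne, one_smul, Measure.restrict_univ] at h
  rw [← h, Measure.map_apply (by fun_prop) hA]
  rfl

/-- The map $x\mapsto V_n|x|^n$ carries Lebesgue measure on $\mathbb R^n$ to Lebesgue measure on
$(0,\infty)$. This is what identifies `luxNorm` with the norm of the Luxemburg representation. -/
theorem rearr_rearr_volVar (hn : 1 ≤ n) {α : Type} [MeasurableSpace α] {μ : Measure α}
    (f : α → ℝ≥0∞) :
    rearr volume (fun x : EuclideanSpace ℝ (Fin n) => rearr μ f (ballVol n * ‖x‖ ^ n)) =
      rearr μ f := by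
  have h : ∀ s, volume {x : EuclideanSpace ℝ (Fin n) | s < rearr μ f (ballVol n * ‖x‖ ^ n)} =
      μ {x | s < f x} := fun s => by
    rw [← measure_lt_rearr f s]
    exact measure_volVar_preimage hn (measurableSet_lt measurable_const (measurable_rearr f))
  exact funext fun t => le_antisymm (rearr_le_rearr (fun s => (h s).le) t)
    (rearr_le_rearr (fun s => (h s).ge) t)

theorem aemeasurable_rearr_volVar {α : Type} [MeasurableSpace α] {μ : Measure α}
    (f : α → ℝ≥0∞) :
    AEMeasurable fun x : EuclideanSpace ℝ (Fin n) => rearr μ f (ballVol n * ‖x‖ ^ n) :=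
  ((measurable_rearr f).comp (by fun_prop)).aemeasurable

theorem RIS.toFun_rearr_le (hn : 1 ≤ n) (E : RIS n) {f : EuclideanSpace ℝ (Fin n) → ℝ≥0∞}
    (hf : AEMeasurable f) :
    E.toFun (fun x => rearr volume f (ballVol n * ‖x‖ ^ n)) ≤ E.toFun f :=
  E.rearr_mono' _ _ (aemeasurable_rearr_volVar f) hf fun t _ => by rw [rearr_rearr_volVar hn]

theorem luxNorm_rearr_le (hn : 1 ≤ n) (E : RIS n) {f : EuclideanSpace ℝ (Fin n) → ℝ≥0∞}
    (hf : AEMeasurable f) : luxNorm E (rearr volume f) ≤ E.toFun f := by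
  have h : luxNorm E (rearr volume f) =
      E.toFun (fun x => rearr volume f (ballVol n * ‖x‖ ^ n)) := by
    unfold luxNorm
    simp_rw [rearr_rearr]
  rw [h]
  exact E.toFun_rearr_le hn hf

theorem luxNorm_mono (E : RIS n) {f g : ℝ → ℝ≥0∞} (h : ∀ t, f t ≤ g t) :
    luxNorm E f ≤ luxNorm E g :=
  E.mono' _ _ (aemeasurable_rearr_volVar f) (aemeasurable_rearr_volVar g)
    (Filter.Eventually.of_forall fun _ => rearr_mono (Filter.Eventually.of_forall h) _)

theorem luxNormOn_rearr_le (hn : 1 ≤ n) (E : RIS n) (T : ℝ)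
    {f : EuclideanSpace ℝ (Fin n) → ℝ≥0∞} (hf : AEMeasurable f) :
    luxNormOn E T (rearr volume f) ≤ E.toFun f :=
  (luxNorm_mono E fun t => indicator_le_self _ _ t).trans (luxNorm_rearr_le hn E hf)

/-- A function dominated by a nonincreasing function of the volume variable. -/
theorem RIS.toFun_le_luxNorm (hn : 1 ≤ n) (E : RIS n) {β : ℝ → ℝ≥0∞}
    (hβ : AntitoneOn β (Ioi 0)) {f : EuclideanSpace ℝ (Fin n) → ℝ≥0∞} (hf : AEMeasurable f)
    (hle : ∀ᵐ x, f x ≤ β (ballVol n * ‖x‖ ^ n)) : E.toFun f ≤ luxNorm E β := by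
  refine E.rearr_mono' _ _ hf (aemeasurable_rearr_volVar β) fun t _ => ?_
  rw [rearr_rearr_volVar hn]
  refine rearr_le_rearr (fun s => ?_) t
  have hae : topExtend β =ᵐ[volume.restrict (Ioi 0)] β := by
    filter_upwards [ae_restrict_mem measurableSet_Ioi] with τ (hτ : 0 < τ)
    simp [topExtend, not_le.2 hτ]
  have h1 : (volume.restrict (Ioi 0)) {τ | s < topExtend β τ} ≤
      (volume.restrict (Ioi 0)) {τ | s < β τ} := by
    refine measure_mono_ae ?_
    filter_upwards [hae] with τ hτ hs
    exact lt_of_lt_of_eq hs hτ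
  refine le_trans ?_ h1
  rw [← measure_volVar_preimage hn
    (measurableSet_lt measurable_const (topExtend_antitone hβ).measurable)]
  refine measure_mono_ae ?_
  filter_upwards [hle] with x hx hs
  exact (lt_of_lt_of_le hs hx).trans_le (le_topExtend _ _)

theorem lintegral_comp_volVar (hn : 1 ≤ n) {g : ℝ → ℝ≥0∞} (hg : Measurable g) {T : ℝ}
    (hT : 0 ≤ T) :
    ∫⁻ x in Metric.ball (0 : EuclideanSpace ℝ (Fin n)) (volRadius n T),
      g (ballVol n * ‖x‖ ^ n) = ∫⁻ τ in Ioo 0 T, g τ := by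
  have hmv : Measurable fun x : EuclideanSpace ℝ (Fin n) => ballVol n * ‖x‖ ^ n := by fun_prop
  have h := map_volume_restrict_cone hn (S := (univ : Set (EuclideanSpace ℝ (Fin n))))
    (by simp)
  rw [inter_univ, ENNReal.div_self (Metric.measure_ball_pos _ _ one_pos).ne'
    measure_ball_lt_top.ne, one_smul, Measure.restrict_univ] at h
  have h2 : ∫⁻ τ in Ioo 0 T, g τ = ∫⁻ τ in Ioi 0, (Iio T).indicator g τ := by
    rw [lintegral_indicator measurableSet_Iio, Measure.restrict_restrict measurableSet_Iio,
      inter_comm, Ioi_inter_Iio]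
  rw [h2, ← h, lintegral_map (hg.indicator measurableSet_Iio) hmv,
    ← lintegral_indicator measurableSet_ball]
  refine lintegral_congr fun x => ?_
  simp only [indicator, mem_ball_zero_iff, mem_Iio, ballVol_mul_pow_lt_iff hn (norm_nonneg x) hT]

/-- `∫₀ᵀ f* ≤ C ‖f‖_E`. -/
theorem RIS.exists_lintegral_rearr_le (hn : 1 ≤ n) (E : RIS n) {T : ℝ} (hT : 0 ≤ T) :
    ∃ C : ℝ≥0, ∀ f : EuclideanSpace ℝ (Fin n) → ℝ≥0∞, AEMeasurable f →
      ∫⁻ τ in Ioo 0 T, rearr volume f τ ≤ C * E.toFun f := by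
  obtain ⟨C, hC⟩ := E.lintegral_le' (Metric.ball 0 (volRadius n T)) measurableSet_ball
    measure_ball_lt_top
  refine ⟨C, fun f hf => ?_⟩
  rw [← lintegral_comp_volVar hn (measurable_rearr f) hT]
  exact (hC _ (aemeasurable_rearr_volVar f)).trans (by gcongr; exact E.toFun_rearr_le hn hf)

/-- If $\alpha(t)>s$, continuity gives $t'>t$ with $\alpha(t')>s$, and then $(0,t')$ lies in the
superlevel set. Without continuity the inequality can fail at jumps, since the rearrangement is
right-continuous. -/
theorem le_rearr_indicator {α : ℝ → ℝ≥0∞} {T : ℝ} (hα : AntitoneOn α (Ioo 0 T))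
    (hc : ContinuousOn α (Ioo 0 T)) {t : ℝ} (ht : t ∈ Ioo 0 T) :
    α t ≤ rearr (volume.restrict (Ioi 0)) ((Ioo 0 T).indicator α) t := by
  refine le_of_forall_lt fun s hs => ?_
  rw [lt_rearr_iff]
  have hev : ∀ᶠ t' in nhds t, s < α t' ∧ t' ∈ Ioo 0 T :=
    ((hc.continuousAt (Ioo_mem_nhds ht.1 ht.2)).eventually_const_lt hs).and
      (Ioo_mem_nhds ht.1 ht.2)
  have hev' : ∀ᶠ t' in nhdsWithin t (Ioi t), s < α t' ∧ t' ∈ Ioo 0 T :=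
    hev.filter_mono nhdsWithin_le_nhds
  obtain ⟨t', ⟨h1, h2⟩, h3⟩ := (hev'.and self_mem_nhdsWithin).exists
  calc ENNReal.ofReal t < ENNReal.ofReal t' :=
        (ENNReal.ofReal_lt_ofReal_iff_of_nonneg ht.1.le).2 h3
    _ = (volume.restrict (Ioi 0)) (Ioo 0 t') := by
        rw [Measure.restrict_apply measurableSet_Ioo, inter_eq_left.2 Ioo_subset_Ioi_self]
        simp
    _ ≤ _ := by
        refine measure_mono fun τ hτ => ?_
        have hτT : τ ∈ Ioo 0 T := ⟨hτ.1, hτ.2.trans h2.2⟩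
        change s < (Ioo 0 T).indicator α τ
        rw [indicator_of_mem hτT]
        exact h1.trans_le (hα hτT h2 hτ.2.le)

/-- The Hölder inequality `∫₀ᵀ α f* ≤ ‖α‖_{Ẽ'(0,T)} ‖f‖_E` for nonincreasing `α`. -/
theorem lintegral_mul_rearr_le_assocNormOn (hn : 1 ≤ n) (E : RIS n) {α : ℝ → ℝ≥0∞} {T : ℝ}
    (hα : AntitoneOn α (Ioo 0 T)) (hc : ContinuousOn α (Ioo 0 T))
    {f : EuclideanSpace ℝ (Fin n) → ℝ≥0∞} (hf : AEMeasurable f) (hfE : E.toFun f < ∞) :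
    ∫⁻ τ in Ioo 0 T, α τ * rearr volume f τ ≤ assocNormOn E T α * E.toFun f := by
  have hunit : ∀ g : EuclideanSpace ℝ (Fin n) → ℝ≥0∞, AEMeasurable g → E.toFun g ≤ 1 →
      ∫⁻ τ in Ioo 0 T, α τ * rearr volume g τ ≤ assocNormOn E T α := by
    intro g hg hgE
    have h1 := le_iSup₂ (f := fun (f : ℝ → ℝ≥0∞)
      (_ : AEMeasurable f (volume.restrict (Ioi 0)) ∧ luxNorm E f ≤ 1) =>
      ∫⁻ t in Ioi (0 : ℝ), rearr (volume.restrict (Ioi 0)) ((Ioo 0 T).indicator α) t *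
        rearr (volume.restrict (Ioi 0)) f t) (rearr volume g)
      ⟨(measurable_rearr g).aemeasurable, (luxNorm_rearr_le hn E hg).trans hgE⟩
    refine le_trans ?_ h1
    refine le_trans ?_ (lintegral_mono_set (Ioo_subset_Ioi_self : Ioo 0 T ⊆ Ioi 0))
    refine setLIntegral_mono' measurableSet_Ioo fun t ht => ?_
    rw [rearr_rearr]
    gcongr
    exact le_rearr_indicator hα hc ht
  -- The supremum in `assocNorm` runs over the unit ball, so $f$ is normalised; the null function is
  -- treated apart.
  rcases eq_or_ne (E.toFun f) 0 with h0 | h0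
  · have hf0 := (E.eq_zero_iff' f hf).1 h0
    have hz : ∀ t, rearr volume f t = 0 := fun t => by
      rw [rearr_congr hf0, ← nonpos_iff_eq_zero, rearr_le_iff]
      simp
    simp [hz]
  · have hlift : ((E.toFun f).toNNReal : ℝ≥0∞) = E.toFun f := ENNReal.coe_toNNReal hfE.ne
    have hr0 : (E.toFun f).toNNReal ≠ 0 := fun h => h0 (by rw [← hlift, h]; rfl)
    set r := (E.toFun f).toNNReal
    have hri : r⁻¹ ≠ 0 := inv_ne_zero hr0
    have h1 := hunit (fun x => (r⁻¹ : ℝ≥0) * f x) (hf.const_mul _) (by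
      rw [E.smul' _ _ hf, ← hlift, ← ENNReal.coe_mul, inv_mul_cancel₀ hr0]; rfl)
    simp_rw [rearr_const_mul f hri] at h1
    have h2 : ∀ τ, α τ * rearr volume f τ =
        r * (α τ * ((r⁻¹ : ℝ≥0) * rearr volume f τ)) := fun τ => by
      calc α τ * rearr volume f τ = ((r * r⁻¹ : ℝ≥0) : ℝ≥0∞) * (α τ * rearr volume f τ) := by
            rw [mul_inv_cancel₀ hr0, ENNReal.coe_one, one_mul]
        _ = _ := by rw [ENNReal.coe_mul]; ring
    simp_rw [h2]
    rw [lintegral_const_mul' _ _ ENNReal.coe_ne_top, ← hlift, mul_comm]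
    gcongr

end RearrangementInvariant

/-! ### Finite differences and derivatives -/

section FiniteDifferences

/-- Differences commute with differentiation, and only the $k+1$ nodes of the difference are
involved. Thus no regularity is needed elsewhere, in particular not at the origin. -/
theorem hasDerivAt_fwdDiff_iter {g g' : ℝ → ℝ} {δ : ℝ} (k : ℕ) {s : ℝ}
    (h : ∀ j : ℕ, j ≤ k → HasDerivAt g (g' (s + j * δ)) (s + j * δ)) :
    HasDerivAt ((fwdDiff δ)^[k] g) ((fwdDiff δ)^[k] g' s) s := by
  induction k generalizing s with
  | zero => simpa using h 0 le_rfl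
  | succ k ih =>
    simp only [Function.iterate_succ_apply', fwdDiff]
    have h1 : HasDerivAt ((fwdDiff δ)^[k] g) ((fwdDiff δ)^[k] g' (s + δ)) (s + δ) := by
      refine ih fun j hj => ?_
      have := h (j + 1) (by omega)
      push_cast at this
      rwa [show s + (j + 1) * δ = s + δ + j * δ by ring] at this
    exact (h1.comp_add_const s δ).sub (ih fun j hj => h j (by omega))

/-- Induction by the mean value inequality: each step trades one difference for a factor $\delta$
and one derivative, `g i` playing the role of the $i$-th derivative. -/
theorem abs_fwdDiff_iter_le {δ B : ℝ} (hδ : 0 ≤ δ) (k : ℕ) (g : ℕ → ℝ → ℝ) (a : ℝ)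
    (hg : ∀ i < k, ∀ s ∈ Icc a (a + k * δ), HasDerivAt (g i) (g (i + 1) s) s)
    (hB : ∀ s ∈ Icc a (a + k * δ), |g k s| ≤ B) :
    |(fwdDiff δ)^[k] (g 0) a| ≤ δ ^ k * B := by
  induction k generalizing g a with
  | zero => simpa using hB a (by simp)
  | succ k ih =>
    push_cast at hg hB
    have hk : 0 ≤ k * δ := by positivity
    have hd : ∀ s ∈ Icc a (a + δ), HasDerivWithinAt ((fwdDiff δ)^[k] (g 0))
        ((fwdDiff δ)^[k] (g 1) s) (Icc a (a + δ)) s := by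
      intro s hs
      refine (hasDerivAt_fwdDiff_iter k fun j hj => ?_).hasDerivWithinAt
      have hj' : (j : ℝ) * δ ≤ k * δ := by gcongr
      have hj0 : 0 ≤ (j : ℝ) * δ := by positivity
      exact hg 0 (by omega) _ ⟨by linarith [hs.1], by linarith [hs.2]⟩
    have hb : ∀ s ∈ Ico a (a + δ), ‖(fwdDiff δ)^[k] (g 1) s‖ ≤ δ ^ k * B := by
      intro s hs
      refine ih (fun i => g (i + 1)) s (fun i hi x hx => ?_) fun x hx => ?_
      · exact hg (i + 1) (by omega) x ⟨by linarith [hs.1, hx.1], by linarith [hs.2, hx.2]⟩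
      · exact hB x ⟨by linarith [hs.1, hx.1], by linarith [hs.2, hx.2]⟩
    have := norm_image_sub_le_of_norm_deriv_le_segment' hd hb (a + δ) ⟨by linarith, le_rfl⟩
    rw [Function.iterate_succ_apply', fwdDiff, pow_succ, ← Real.norm_eq_abs]
    calc _ ≤ _ := this
      _ = _ := by ring

/-- A lower bound for the `k`-th difference of a function with non-negative `k`-th derivative. -/
theorem le_fwdDiff_iter {δ δ' m : ℝ} (hδ' : 0 ≤ δ') (hδ : δ' ≤ δ) (hm : 0 ≤ m) (k : ℕ)
    (g : ℕ → ℝ → ℝ) (a : ℝ)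
    (hg : ∀ i < k, ∀ s ∈ Icc a (a + k * δ), HasDerivAt (g i) (g (i + 1) s) s)
    (h0 : ∀ s ∈ Icc a (a + k * δ), 0 ≤ g k s)
    (hB : ∀ s ∈ Icc a (a + k * δ'), m ≤ g k s) :
    δ' ^ k * m ≤ (fwdDiff δ)^[k] (g 0) a := by
  have hδ0 : 0 ≤ δ := hδ'.trans hδ
  induction k generalizing g a m with
  | zero => simpa using hB a (by simp)
  | succ k ih =>
    push_cast at hg hB h0
    have hk : 0 ≤ k * δ := by positivity
    have hd : ∀ s ∈ Icc a (a + δ), HasDerivAt ((fwdDiff δ)^[k] (g 0))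
        ((fwdDiff δ)^[k] (g 1) s) s := by
      intro s hs
      refine hasDerivAt_fwdDiff_iter k fun j hj => ?_
      have hj' : (j : ℝ) * δ ≤ k * δ := by gcongr
      have hj0 : 0 ≤ (j : ℝ) * δ := by positivity
      exact hg 0 (by omega) _ ⟨by linarith [hs.1], by linarith [hs.2]⟩
    have hshift : ∀ s ∈ Icc a (a + δ), ∀ i < k, ∀ x ∈ Icc s (s + k * δ),
        HasDerivAt (g (i + 1)) (g (i + 1 + 1) x) x := fun s hs i hi x hx =>
      hg (i + 1) (by omega) x ⟨by linarith [hs.1, hx.1], by linarith [hs.2, hx.2]⟩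
    have hnn : ∀ s ∈ Icc a (a + δ), ∀ x ∈ Icc s (s + k * δ), 0 ≤ g (k + 1) x :=
      fun s hs x hx => h0 x ⟨by linarith [hs.1, hx.1], by linarith [hs.2, hx.2]⟩
    have hpos : ∀ s ∈ Icc a (a + δ), 0 ≤ (fwdDiff δ)^[k] (g 1) s := by
      intro s hs
      have hkk : (k : ℝ) * δ' ≤ k * δ := by gcongr
      simpa using ih le_rfl (fun i => g (i + 1)) s (hshift s hs) (hnn s hs)
        fun x hx => hnn s hs x ⟨hx.1, by linarith [hx.2]⟩
    have hlow : ∀ s ∈ Icc a (a + δ'), δ' ^ k * m ≤ (fwdDiff δ)^[k] (g 1) s := by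
      intro s hs
      have hs' : s ∈ Icc a (a + δ) := ⟨hs.1, by linarith [hs.2]⟩
      exact ih hm (fun i => g (i + 1)) s (hshift s hs') (hnn s hs')
        fun x hx => hB x ⟨by linarith [hs.1, hx.1], by linarith [hs.2, hx.2]⟩
    -- The bound `m` is known only on the shorter interval. Non-negativity on the long one gives
    -- monotonicity, so the step $\delta$ may be shortened to $\delta'$, and the mean value theorem
    -- is applied there.
    have hmono : MonotoneOn ((fwdDiff δ)^[k] (g 0)) (Icc a (a + δ)) := by
      refine monotoneOn_of_deriv_nonneg (convex_Icc _ _)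
        (fun s hs => (hd s hs).continuousAt.continuousWithinAt)
        (fun s hs => (hd s (interior_subset hs)).differentiableAt.differentiableWithinAt)
        fun s hs => ?_
      rw [(hd s (interior_subset hs)).deriv]
      exact hpos s (interior_subset hs)
    have hsub : Icc a (a + δ') ⊆ Icc a (a + δ) := Icc_subset_Icc_right (by linarith)
    have hmv := (convex_Icc a (a + δ')).mul_sub_le_image_sub_of_le_deriv (C := δ' ^ k * m)
      (fun s hs => (hd s (hsub hs)).continuousAt.continuousWithinAt)
      (fun s hs => (hd s (hsub (interior_subset hs))).differentiableAt.differentiableWithinAt)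
      (fun s hs => by
        rw [(hd s (hsub (interior_subset hs))).deriv]
        exact hlow s (interior_subset hs)) a (by simp [hδ']) (a + δ') (by simp [hδ'])
      (by linarith)
    have hmono' := hmono (a := a + δ') (b := a + δ) ⟨by linarith, by linarith⟩
      ⟨by linarith, le_rfl⟩ (by linarith)
    rw [Function.iterate_succ_apply', fwdDiff, pow_succ]
    have : δ' ^ k * m * (a + δ' - a) = δ' ^ k * δ' * m := by ring
    linarith

theorem fwdDiff_iter_eq_line {V : Type*} [AddCommGroup V] [Module ℝ V] (G : V → ℝ) (k : ℕ)
    (δ : ℝ) (e w : V) :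
    (fwdDiff (δ • e))^[k] G w = (fwdDiff δ)^[k] (fun s : ℝ => G (w + s • e)) 0 := by
  rw [fwdDiff_iter_eq_sum_shift, fwdDiff_iter_eq_sum_shift]
  refine Finset.sum_congr rfl fun j _ => ?_
  simp only [zero_add, nsmul_eq_mul, mul_smul, Nat.cast_smul_eq_nsmul]

end FiniteDifferences

/-! ### Derivatives of radial functions along lines -/

section RadialDerivatives

/-- The `m`-th derivative of `A_{i+l} b^i H^l` if `A_j' = b A_{j+1}`, `b' = H` and `H' = 0`. -/
def chainTerm (A : ℕ → ℝ) (b H : ℝ) : ℕ → ℕ → ℕ → ℝ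
  | 0, i, l => A (i + l) * b ^ i * H ^ l
  | m + 1, i, l => chainTerm A b H m (i + 1) l + i * chainTerm A b H m (i - 1) (l + 1)

/-- This is the product rule, matched to the recursion of `chainTerm`. The truncated `i - 1` is
harmless at `i = 0` because its coefficient is `i`. -/
theorem hasDerivAt_chainTerm {A : ℕ → ℝ → ℝ} {b : ℝ → ℝ} {H s : ℝ} (hb : HasDerivAt b H s)
    (m i l : ℕ) (hA : ∀ j < i + l + m + 1, HasDerivAt (A j) (b s * A (j + 1) s) s) :
    HasDerivAt (fun s => chainTerm (fun j => A j s) (b s) H m i l)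
      (chainTerm (fun j => A j s) (b s) H (m + 1) i l) s := by
  induction m generalizing i l with
  | zero =>
    simp only [chainTerm]
    have h := ((hA (i + l) (by omega)).mul (hb.pow i)).mul_const (H ^ l)
    refine h.congr_deriv ?_
    rcases i with - | i
    · simp [add_comm, mul_comm]
    · simp only [Nat.add_sub_cancel, Pi.pow_apply]
      rw [show i + 1 + 1 + l = i + 1 + l + 1 by ring, show i + (l + 1) = i + 1 + l by ring]
      push_cast
      ring
  | succ m ih =>
    have h1 := ih (i + 1) l fun j hj => hA j (by omega)
    rcases i with - | i
    · have h2 : (fun s => chainTerm (fun j => A j s) (b s) H (m + 1) 0 l) =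
          fun s => chainTerm (fun j => A j s) (b s) H m (0 + 1) l := by
        funext s
        simp [chainTerm]
      rw [h2]
      refine h1.congr_deriv ?_
      conv_rhs => rw [chainTerm]
      simp
    · have h2 := ih i (l + 1) fun j hj => hA j (by omega)
      exact h1.add (h2.const_mul (((i + 1 : ℕ) : ℝ)))

/-- Both branches of the recursion preserve the weight: every monomial $A_{i'+l'}b^{i'}H^{l'}$ in
the expansion satisfies $i'+2l'=i+2l+m$. The constant only counts terms with their coefficients. -/
theorem exists_abs_chainTerm_le (m i l : ℕ) : ∃ C : ℝ, 0 ≤ C ∧ ∀ (A : ℕ → ℝ) (b H B : ℝ),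
    (∀ i' l', i' + 2 * l' = i + 2 * l + m → |A (i' + l') * b ^ i' * H ^ l'| ≤ B) →
      |chainTerm A b H m i l| ≤ C * B := by
  induction m generalizing i l with
  | zero => exact ⟨1, zero_le_one, fun A b H B h => by
    simpa only [chainTerm, one_mul] using h i l (by omega)⟩
  | succ m ih =>
    obtain ⟨C₁, hC₁, h₁⟩ := ih (i + 1) l
    rcases i with - | i
    · refine ⟨C₁, hC₁, fun A b H B h => ?_⟩
      simp only [chainTerm, Nat.cast_zero, zero_mul, add_zero]
      exact h₁ A b H B fun i' l' h' => h i' l' (by omega)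
    · obtain ⟨C₂, hC₂, h₂⟩ := ih i (l + 1)
      refine ⟨C₁ + (i + 1) * C₂, by positivity, fun A b H B h => ?_⟩
      have e1 := h₁ A b H B fun i' l' h' => h i' l' (by omega)
      have e2 := h₂ A b H B fun i' l' h' => h i' l' (by omega)
      simp only [chainTerm, Nat.add_sub_cancel]
      refine (abs_add_le _ _).trans ?_
      rw [abs_mul, Nat.abs_cast, add_mul, mul_assoc]
      push_cast
      gcongr

/-- With $c$ the cosine of the angle to the radial direction, this compares a directional derivative
with the radial one. A monomial changes by the factor $c^i$, and Bernoulli's inequality gives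
$1-c^i\le i(1-c)$. -/
theorem exists_abs_chainTerm_sub_le (m i l : ℕ) : ∃ C : ℝ, 0 ≤ C ∧
    ∀ (A : ℕ → ℝ) (ρ c B : ℝ), 0 ≤ c → c ≤ 1 →
    (∀ i' l', i' + 2 * l' = i + 2 * l + m → |A (i' + l') * ρ ^ i'| ≤ B) →
      |chainTerm A (ρ * c) 1 m i l - chainTerm A ρ 1 m i l| ≤ C * ((1 - c) * B) := by
  induction m generalizing i l with
  | zero =>
    refine ⟨i, by positivity, fun A ρ c B h0 h1 h => ?_⟩
    have hb := h i l (by omega)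
    have h2 : 1 - c ^ i ≤ i * (1 - c) := by
      have := one_add_mul_le_pow (a := c - 1) (by linarith) i
      rw [add_sub_cancel] at this
      linarith
    have h3 : 0 ≤ 1 - c ^ i := sub_nonneg.2 (pow_le_one₀ h0 h1)
    simp only [chainTerm, one_pow, mul_one]
    have h4 : A (i + l) * (ρ * c) ^ i - A (i + l) * ρ ^ i =
        -((A (i + l) * ρ ^ i) * (1 - c ^ i)) := by
      rw [mul_pow]; ring
    rw [h4, abs_neg, abs_mul, abs_of_nonneg h3]
    calc |A (i + l) * ρ ^ i| * (1 - c ^ i) ≤ B * (i * (1 - c)) := by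
          gcongr
          exact (abs_nonneg _).trans hb
      _ = _ := by ring
  | succ m ih =>
    obtain ⟨C₁, hC₁, h₁⟩ := ih (i + 1) l
    rcases i with - | i
    · refine ⟨C₁, hC₁, fun A ρ c B h0 h1 h => ?_⟩
      simp only [chainTerm, Nat.cast_zero, zero_mul, add_zero]
      exact h₁ A ρ c B h0 h1 fun i' l' h' => h i' l' (by omega)
    · obtain ⟨C₂, hC₂, h₂⟩ := ih i (l + 1)
      refine ⟨C₁ + (i + 1) * C₂, by positivity, fun A ρ c B h0 h1 h => ?_⟩
      have e1 := h₁ A ρ c B h0 h1 fun i' l' h' => h i' l' (by omega)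
      have e2 := h₂ A ρ c B h0 h1 fun i' l' h' => h i' l' (by omega)
      simp only [chainTerm, Nat.add_sub_cancel]
      rw [add_sub_add_comm, ← mul_sub]
      refine (abs_add_le _ _).trans ?_
      rw [abs_mul, Nat.abs_cast, add_mul, mul_assoc]
      push_cast
      gcongr

theorem contDiffOn_radialDeriv {Φ : ℝ → ℝ} {k : ℕ} (hΦ : ContDiffOn ℝ (k : ℕ∞) Φ (Ioi 0))
    (j : ℕ) (hj : j ≤ k) : ContDiffOn ℝ ((k - j : ℕ) : ℕ∞) (radialDeriv j Φ) (Ioi 0) := by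
  induction j with
  | zero => simpa [radialDeriv] using hΦ
  | succ j ih =>
    have h := ih (by omega)
    have e : radialDeriv (j + 1) Φ = fun z => z⁻¹ * deriv (radialDeriv j Φ) z := by
      unfold radialDeriv
      rw [Function.iterate_succ_apply']
    rw [e]
    refine ContDiffOn.mul (contDiffOn_id.inv fun z hz => (ne_of_gt hz)) ?_
    refine h.deriv_of_isOpen isOpen_Ioi ?_
    have : k - (j + 1) + 1 = k - j := by omega
    rw [← this]
    push_cast
    exact le_rfl

theorem hasDerivAt_radialDeriv {Φ : ℝ → ℝ} {k : ℕ} (hΦ : ContDiffOn ℝ (k : ℕ∞) Φ (Ioi 0))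
    {j : ℕ} (hj : j < k) {z : ℝ} (hz : 0 < z) :
    HasDerivAt (radialDeriv j Φ) (z * radialDeriv (j + 1) Φ z) z := by
  have h := (contDiffOn_radialDeriv hΦ j hj.le).contDiffAt (Ioi_mem_nhds hz)
  have hd : DifferentiableAt ℝ (radialDeriv j Φ) z := by
    refine h.differentiableAt ?_
    have : k - j ≠ 0 := by omega
    exact_mod_cast this
  have e : radialDeriv (j + 1) Φ z = z⁻¹ * deriv (radialDeriv j Φ) z := by
    unfold radialDeriv
    rw [Function.iterate_succ_apply']
  rw [e, mul_inv_cancel_left₀ hz.ne']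
  exact hd.hasDerivAt

/-- On the half-line one has $b(z)=z$ and $H=1$. This puts the lower bound on $\Phi^{(k)}$ into the
same form as the directional derivatives in $\mathbb R^n$. -/
theorem iteratedDeriv_eq_chainTerm {Φ : ℝ → ℝ} {k : ℕ}
    (hΦ : ContDiffOn ℝ (k : ℕ∞) Φ (Ioi 0)) (m : ℕ) (hm : m ≤ k) {z : ℝ} (hz : 0 < z) :
    iteratedDeriv m Φ z = chainTerm (fun j => radialDeriv j Φ z) z 1 m 0 0 := by
  induction m generalizing z with
  | zero => simp [chainTerm, radialDeriv]
  | succ m ih =>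
    rw [iteratedDeriv_succ]
    have hev : iteratedDeriv m Φ =ᶠ[nhds z]
        fun z => chainTerm (fun j => radialDeriv j Φ z) z 1 m 0 0 := by
      filter_upwards [Ioi_mem_nhds hz] with y hy
      exact ih (by omega) hy
    rw [hev.deriv_eq]
    refine (hasDerivAt_chainTerm (A := fun j => radialDeriv j Φ) (b := id) (hasDerivAt_id z)
      m 0 0 fun j hj => ?_).deriv
    exact hasDerivAt_radialDeriv hΦ (by omega) hz

variable {V : Type*} [NormedAddCommGroup V] [InnerProductSpace ℝ V]

open scoped RealInnerProductSpace

theorem hasDerivAt_inner_line (w h : V) (s : ℝ) :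
    HasDerivAt (fun s : ℝ => ⟪w + s • h, h⟫) (‖h‖ ^ 2) s := by
  have h1 : (fun s : ℝ => ⟪w + s • h, h⟫) = fun s => ⟪w, h⟫ + s * ‖h‖ ^ 2 := by
    funext s
    rw [inner_add_left, real_inner_smul_left, real_inner_self_eq_norm_sq]
  rw [h1]
  simpa using ((hasDerivAt_id s).mul_const (‖h‖ ^ 2)).const_add ⟪w, h⟫

theorem hasDerivAt_norm_line (w h : V) (s : ℝ) (hne : w + s • h ≠ 0) :
    HasDerivAt (fun s : ℝ => ‖w + s • h‖) (⟪w + s • h, h⟫ / ‖w + s • h‖) s := by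
  have h1 : HasDerivAt (fun s : ℝ => w + s • h) h s := by
    simpa using ((hasDerivAt_id s).smul_const h).const_add w
  have h2 := h1.norm_sq.sqrt (by positivity)
  simp only [Real.sqrt_sq (norm_nonneg _)] at h2
  refine h2.congr_deriv ?_
  field_simp

/-- The factor $z$ in $\Phi_j'=z\Phi_{j+1}$ cancels the denominator in the derivative of the norm.
This is why the functions $\Phi_j$, rather than the derivatives of $\Phi$, are the natural
quantities. -/
theorem hasDerivAt_radialDeriv_line {Φ : ℝ → ℝ} {k : ℕ}
    (hΦ : ContDiffOn ℝ (k : ℕ∞) Φ (Ioi 0)) {j : ℕ} (hj : j < k) (w h : V) (s : ℝ)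
    (hne : w + s • h ≠ 0) :
    HasDerivAt (fun s : ℝ => radialDeriv j Φ ‖w + s • h‖)
      (⟪w + s • h, h⟫ * radialDeriv (j + 1) Φ ‖w + s • h‖) s := by
  have hpos : 0 < ‖w + s • h‖ := norm_pos_iff.2 hne
  refine ((hasDerivAt_radialDeriv hΦ hj hpos).comp s
    (hasDerivAt_norm_line w h s hne)).congr_deriv ?_
  field_simp

theorem hasDerivAt_chainTerm_line {Φ : ℝ → ℝ} {k : ℕ}
    (hΦ : ContDiffOn ℝ (k : ℕ∞) Φ (Ioi 0)) {m : ℕ} (hm : m < k) (w h : V) (s : ℝ)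
    (hne : w + s • h ≠ 0) :
    HasDerivAt (fun s : ℝ => chainTerm (fun j => radialDeriv j Φ ‖w + s • h‖)
        ⟪w + s • h, h⟫ (‖h‖ ^ 2) m 0 0)
      (chainTerm (fun j => radialDeriv j Φ ‖w + s • h‖) ⟪w + s • h, h⟫ (‖h‖ ^ 2) (m + 1) 0 0) s :=
  hasDerivAt_chainTerm (A := fun j s => radialDeriv j Φ ‖w + s • h‖)
    (hasDerivAt_inner_line w h s) m 0 0 fun j hj =>
      hasDerivAt_radialDeriv_line hΦ (by omega) w h s hne

/-- The `k`-th difference of a radial function is controlled by the functions `Φ_j`. -/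
theorem exists_abs_fwdDiff_radial_le {Φ : ℝ → ℝ} {k : ℕ} (hk : 1 ≤ k)
    (hΦ : ContDiffOn ℝ (k : ℕ∞) Φ (Ioi 0)) : ∃ C : ℝ, 0 ≤ C ∧ ∀ (w h : V) (B : ℝ),
      (∀ s ∈ Icc (0 : ℝ) k, w + s • h ≠ 0) →
      (∀ s ∈ Icc (0 : ℝ) k, ∀ j, 1 ≤ j → j ≤ k →
        ‖w + s • h‖ ^ (2 * j) * |radialDeriv j Φ ‖w + s • h‖| ≤ ‖w + s • h‖ ^ k * B) →
      |(fwdDiff h)^[k] (fun x => Φ ‖x‖) w| ≤ C * (‖h‖ ^ k * B) := by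
  obtain ⟨C, hC, hbound⟩ := exists_abs_chainTerm_le k 0 0
  refine ⟨C, hC, fun w h B hne hB => ?_⟩
  have h1 := fwdDiff_iter_eq_line (fun x : V => Φ ‖x‖) k 1 h w
  rw [one_smul] at h1
  rw [h1]
  have h2 := abs_fwdDiff_iter_le zero_le_one k
    (fun m s => chainTerm (fun j => radialDeriv j Φ ‖w + s • h‖) ⟪w + s • h, h⟫ (‖h‖ ^ 2) m 0 0) 0
    (B := C * (‖h‖ ^ k * B))
    (fun i hi s hs => hasDerivAt_chainTerm_line hΦ hi w h s (hne s (by simpa using hs)))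
    (fun s hs => ?_)
  · simpa [chainTerm, radialDeriv] using h2
  have hs' : s ∈ Icc (0 : ℝ) k := by simpa using hs
  refine hbound _ _ _ _ fun i l hil => ?_
  have hpos : 0 < ‖w + s • h‖ := norm_pos_iff.2 (hne s hs')
  have hj := hB s hs' (i + l) (by omega) (by omega)
  -- Since $i+2l=k$, dividing the hypothesis by $|w+sh|^k$ leaves exactly the power $i$ needed for
  -- $\langle w+sh,h\rangle^i$.
  rw [show 2 * (i + l) = k + i by omega, pow_add, mul_assoc,
    mul_le_mul_iff_right₀ (by positivity)] at hj
  rw [abs_mul, abs_mul, abs_pow, abs_pow, abs_of_nonneg (sq_nonneg ‖h‖), ← pow_mul]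
  have hin : |⟪w + s • h, h⟫| ≤ ‖w + s • h‖ * ‖h‖ := abs_real_inner_le_norm _ _
  calc |radialDeriv (i + l) Φ ‖w + s • h‖| * |⟪w + s • h, h⟫| ^ i * ‖h‖ ^ (2 * l)
      ≤ |radialDeriv (i + l) Φ ‖w + s • h‖| * (‖w + s • h‖ * ‖h‖) ^ i * ‖h‖ ^ (2 * l) := by gcongr
    _ = ‖h‖ ^ (i + 2 * l) * (‖w + s • h‖ ^ i * |radialDeriv (i + l) Φ ‖w + s • h‖|) := by
        rw [mul_pow, pow_add]; ring
    _ ≤ ‖h‖ ^ (i + 2 * l) * B := by gcongr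
    _ = ‖h‖ ^ k * B := by rw [hil]; simp

end RadialDerivatives

/-! ### Kernels of generalized Bessel type -/

/-- The assumptions on the kernel of a generalized Bessel potential. -/
structure IsRegularKernel (n k : ℕ) (Φ : ℝ → ℝ) (a₁ a₂ z₁ δ₁ : ℝ) : Prop
    extends IsStandard n Φ where
  one_le_n : 1 ≤ n
  one_le_k : 1 ≤ k
  contDiffOn : ContDiffOn ℝ (k : ℕ∞) Φ (Ioi 0)
  a₁_pos : 0 < a₁
  a₂_pos : 0 < a₂
  z₁_pos : 0 < z₁
  δ₁_pos : 0 < δ₁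
  near : ∀ j : ℕ, 1 ≤ j → j ≤ k → ∀ z : ℝ, 0 < z → z ≤ z₁ →
    z ^ (2 * j) * |radialDeriv j Φ z| ≤ a₁ * Φ z
  far : ∀ j : ℕ, 1 ≤ j → j ≤ k → ∀ z : ℝ, z₁ < z →
    z ^ (2 * j) * |radialDeriv j Φ z| ≤ a₂ * z ^ k * Φ z
  lower : ∀ z : ℝ, 0 < z → z ≤ z₁ → δ₁ * Φ z ≤ (-1) ^ k * z ^ k * iteratedDeriv k Φ z

section Kernel

variable {n k : ℕ} {Φ : ℝ → ℝ} {a₁ a₂ z₁ δ₁ : ℝ}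

theorem IsStandard.phi_antitoneOn (hΦ : IsStandard n Φ) : AntitoneOn (phi n Φ) (Ioi 0) :=
  fun _ ha _ hb hab => hΦ.antitoneOn (volRadius_pos ha) (volRadius_pos hb)
    (volRadius_mono (le_of_lt ha) hab)

theorem IsStandard.phi_nonneg (hΦ : IsStandard n Φ) {τ : ℝ} (hτ : 0 < τ) : 0 ≤ phi n Φ τ :=
  hΦ.nonneg _ (volRadius_pos hτ)

theorem IsStandard.phi_continuousOn (hΦ : IsStandard n Φ) : ContinuousOn (phi n Φ) (Ioi 0) := by
  refine hΦ.continuousOn.comp (ContinuousOn.rpow_const (by fun_prop) fun τ hτ => Or.inl ?_)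
    fun τ hτ => volRadius_pos hτ
  exact (div_pos hτ (ballVol_pos n)).ne'

theorem phi_ballVol (hn : 1 ≤ n) (Φ : ℝ → ℝ) {z : ℝ} (hz : 0 ≤ z) :
    phi n Φ (ballVol n * z ^ n) = Φ z := by
  rw [phi_eq, volRadius_ballVol hn hz]

/-- Substitution $\tau=V_nz^n$ in $\int_0^\infty\Phi(z)z^{n-1}\,dz$. -/
theorem IsStandard.integrableOn_phi (hΦ : IsStandard n Φ) (hn : 1 ≤ n) :
    IntegrableOn (phi n Φ) (Ioi 0) := by
  have hn' : (n : ℝ) ≠ 0 := by positivity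
  have h1 : IntegrableOn (fun z : ℝ => phi n Φ (ballVol n * z)) (Ioi 0) := by
    rw [← integrableOn_Ioi_comp_rpow_iff _ hn']
    refine IntegrableOn.congr_fun (f := fun z => (n : ℝ) * (Φ z * z ^ (n - 1)))
      (hΦ.integrableOn.const_mul _) (fun z (hz : 0 < z) => ?_)
      measurableSet_Ioi
    simp only [smul_eq_mul]
    rw [Real.rpow_natCast, phi_ballVol hn Φ hz.le, abs_of_nonneg (Nat.cast_nonneg n),
      show (n : ℝ) - 1 = ((n - 1 : ℕ) : ℝ) by push_cast [hn]; ring, Real.rpow_natCast]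
    ring
  simpa using (integrableOn_Ioi_comp_mul_left_iff (phi n Φ) 0 (ballVol_pos n)).1 h1

theorem IsStandard.exists_phi_pos (hΦ : IsStandard n Φ) (hn : 1 ≤ n) {T : ℝ} (hT : 0 < T) :
    ∃ τ, 0 < τ ∧ τ < T ∧ 0 < phi n Φ τ := by
  have h1 : ∃ z, 0 < z ∧ 0 < Φ z := by
    by_contra! hcon
    refine absurd hΦ.integral_pos (not_lt.2 ?_)
    refine setIntegral_nonpos measurableSet_Ioi fun z (hz : 0 < z) => ?_
    exact mul_nonpos_of_nonpos_of_nonneg (hcon z hz) (by positivity)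
  obtain ⟨z, hz, hΦz⟩ := h1
  have hv : 0 < ballVol n * z ^ n := mul_pos (ballVol_pos n) (pow_pos hz n)
  have hmin : 0 < min (ballVol n * z ^ n) (T / 2) := lt_min hv (by linarith)
  refine ⟨min (ballVol n * z ^ n) (T / 2), hmin,
    (min_le_right _ _).trans_lt (by linarith), ?_⟩
  refine lt_of_lt_of_le hΦz ?_
  rw [← phi_ballVol hn Φ hz.le]
  exact hΦ.phi_antitoneOn hmin hv (min_le_left _ _)

/-! #### The kernel `Ω_φ` -/

theorem IsStandard.bigOmega_nonneg (hΦ : IsStandard n Φ) {t τ : ℝ} (ht : 0 < t) (hτ : 0 < τ) :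
    0 ≤ bigOmega n k Φ t τ :=
  div_nonneg (hΦ.phi_nonneg hτ) (by positivity)

theorem IsStandard.bigOmega_antitoneOn (hΦ : IsStandard n Φ) {t : ℝ} (ht : 0 < t) :
    AntitoneOn (bigOmega n k Φ t) (Ioi 0) := by
  intro a ha b hb hab
  have ha' : 0 < a := ha
  exact div_le_div₀ (hΦ.phi_nonneg ha) (hΦ.phi_antitoneOn ha hb hab) (by positivity) (by gcongr)

theorem IsStandard.bigOmega_mono (hΦ : IsStandard n Φ) {t t' τ : ℝ} (ht : 0 < t) (h : t ≤ t')
    (hτ : 0 < τ) : bigOmega n k Φ t τ ≤ bigOmega n k Φ t' τ := by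
  have := hΦ.phi_nonneg hτ
  have ht' : 0 < t' := ht.trans_le h
  unfold bigOmega
  gcongr

/-- Passing from $t$ to $t'$ rescales $(\tau/t)^{k/n}$ by a fixed power. Hence estimates known only
for small $t$ extend to all of $(0,T)$ at the cost of a constant. -/
theorem IsStandard.bigOmega_le (hΦ : IsStandard n Φ) {t t' τ : ℝ} (ht : 0 < t) (h : t ≤ t')
    (hτ : 0 < τ) :
    bigOmega n k Φ t' τ ≤ (t' / t) ^ ((k : ℝ) / n) * bigOmega n k Φ t τ := by
  have h0 := hΦ.phi_nonneg hτ
  have ht' : 0 < t' := ht.trans_le h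
  have h1 : 1 ≤ (t' / t) ^ ((k : ℝ) / n) :=
    Real.one_le_rpow (by rwa [one_le_div ht]) (by positivity)
  have h2 : (τ / t) ^ ((k : ℝ) / n) = (t' / t) ^ ((k : ℝ) / n) * (τ / t') ^ ((k : ℝ) / n) := by
    rw [← Real.mul_rpow (by positivity) (by positivity)]
    congr 1
    field_simp
  unfold bigOmega
  rw [← mul_div_assoc, div_le_div_iff₀ (by positivity) (by positivity), h2]
  have h3 : 0 ≤ (τ / t') ^ ((k : ℝ) / n) := by positivity
  nlinarith [mul_le_mul_of_nonneg_left h1 h0]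

theorem IsStandard.phi_le_bigOmega (hΦ : IsStandard n Φ) {t τ : ℝ} (hτ : 0 < τ) (h : τ ≤ t) :
    phi n Φ τ ≤ 2 * bigOmega n k Φ t τ := by
  have h0 := hΦ.phi_nonneg hτ
  have ht : 0 < t := hτ.trans_le h
  have h1 : (τ / t) ^ ((k : ℝ) / n) ≤ 1 :=
    Real.rpow_le_one (by positivity) (by rwa [div_le_one ht]) (by positivity)
  unfold bigOmega
  rw [← mul_div_assoc, le_div_iff₀ (by positivity)]
  nlinarith

theorem IsStandard.phi_mul_rpow_le_bigOmega (hΦ : IsStandard n Φ) {t T τ : ℝ} (ht : 0 < t)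
    (htT : t ≤ T) (hτ : 0 < τ) (hτT : τ ≤ T) :
    t ^ ((k : ℝ) / n) * phi n Φ τ ≤ 2 * T ^ ((k : ℝ) / n) * bigOmega n k Φ t τ := by
  have hT : 0 < T := ht.trans_le htT
  have h1 := hΦ.phi_le_bigOmega (k := k) hτ hτT
  have h2 := hΦ.bigOmega_le (k := k) ht htT hτ
  rw [Real.div_rpow hT.le ht.le] at h2
  calc t ^ ((k : ℝ) / n) * phi n Φ τ
      ≤ t ^ ((k : ℝ) / n) * (2 * (T ^ ((k : ℝ) / n) / t ^ ((k : ℝ) / n) * bigOmega n k Φ t τ)) := by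
        gcongr; exact h1.trans (by gcongr)
    _ = _ := by field_simp

theorem bigOmega_ballVol (hn : 1 ≤ n) (Φ : ℝ → ℝ) {r z : ℝ} (hr : 0 < r) (hz : 0 < z) :
    bigOmega n k Φ (r ^ n) (ballVol n * z ^ n) =
      Φ z / (1 + ballVol n ^ ((k : ℝ) / n) * (z / r) ^ k) := by
  have hV := ballVol_pos n
  have hn' : (n : ℝ) ≠ 0 := by positivity
  unfold bigOmega
  rw [phi_ballVol hn Φ hz.le, mul_div_assoc, ← div_pow,
    Real.mul_rpow hV.le (by positivity), ← Real.rpow_natCast (z / r) n,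
    ← Real.rpow_mul (by positivity), mul_div_cancel₀ _ hn', Real.rpow_natCast]

/-! #### Pointwise estimates of differences of the kernel -/

/-- The case $j=1$ of `near` says $z|\Phi'(z)|\le a_1\Phi(z)$, which makes the derivative of
$z^{a_1}\Phi(z)$ non-negative. -/
theorem IsRegularKernel.monotoneOn_rpow_mul (h : IsRegularKernel n k Φ a₁ a₂ z₁ δ₁) :
    MonotoneOn (fun z => z ^ a₁ * Φ z) (Ioc 0 z₁) := by
  have hd : ∀ z : ℝ, 0 < z → HasDerivAt (fun z => z ^ a₁ * Φ z)
      (a₁ * z ^ (a₁ - 1) * Φ z + z ^ a₁ * (z * radialDeriv 1 Φ z)) z := by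
    intro z hz
    exact (Real.hasDerivAt_rpow_const (Or.inl hz.ne')).mul
      (hasDerivAt_radialDeriv h.contDiffOn (j := 0) h.one_le_k hz)
  refine monotoneOn_of_deriv_nonneg (convex_Ioc _ _)
    (fun z hz => (hd z hz.1).continuousAt.continuousWithinAt)
    (fun z hz => (hd z (interior_subset hz).1).differentiableAt.differentiableWithinAt)
    fun z hz => ?_
  have hz' := interior_subset hz
  have hz0 : 0 < z := hz'.1
  rw [(hd z hz0).deriv]
  have h1 := h.near 1 le_rfl h.one_le_k z hz0 hz'.2
  rw [mul_one] at h1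
  have h2 : -(a₁ * Φ z) ≤ z ^ 2 * radialDeriv 1 Φ z := by
    have := neg_abs_le (z ^ 2 * radialDeriv 1 Φ z)
    rw [abs_mul, abs_of_nonneg (sq_nonneg z)] at this
    linarith
  have h3 : z ^ a₁ = z ^ (a₁ - 1) * z := by
    rw [Real.rpow_sub_one hz0.ne']; field_simp
  rw [h3]
  have h4 : 0 < z ^ (a₁ - 1) := Real.rpow_pos_of_pos hz0 _
  have h5 : a₁ * z ^ (a₁ - 1) * Φ z + z ^ (a₁ - 1) * z * (z * radialDeriv 1 Φ z) =
      z ^ (a₁ - 1) * (a₁ * Φ z + z ^ 2 * radialDeriv 1 Φ z) := by ring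
  rw [h5]
  exact mul_nonneg h4.le (by linarith)

/-- The doubling property of the kernel near the origin. -/
theorem IsRegularKernel.le_rpow_mul (h : IsRegularKernel n k Φ a₁ a₂ z₁ δ₁) {z L : ℝ}
    (hz : 0 < z) (hL : 1 ≤ L) (hzL : L * z ≤ z₁) : Φ z ≤ L ^ a₁ * Φ (L * z) := by
  have hle : z ≤ L * z := by nlinarith
  have h1 := h.monotoneOn_rpow_mul ⟨hz, hle.trans hzL⟩ ⟨hz.trans_le hle, hzL⟩ hle
  simp only at h1
  rw [Real.mul_rpow (by linarith) hz.le] at h1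
  have h2 : 0 < z ^ a₁ := Real.rpow_pos_of_pos hz _
  refine le_of_mul_le_mul_left ?_ h2
  linarith

variable {V : Type*} [NormedAddCommGroup V] [InnerProductSpace ℝ V]

theorem half_norm_le_norm_add_smul {w h : V} {r : ℝ} (hh : ‖h‖ ≤ r) (hw : 2 * k * r ≤ ‖w‖) {s : ℝ}
    (hs : s ∈ Icc (0 : ℝ) k) : ‖w‖ / 2 ≤ ‖w + s • h‖ ∧ ‖w + s • h‖ ≤ 3 / 2 * ‖w‖ := by
  have h1 : ‖s • h‖ ≤ k * r := by
    rw [norm_smul, Real.norm_of_nonneg hs.1]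
    exact mul_le_mul hs.2 hh (norm_nonneg _) (Nat.cast_nonneg k)
  have h2 := norm_sub_norm_le w (-(s • h))
  rw [sub_neg_eq_add, norm_neg] at h2
  exact ⟨by linarith, (norm_add_le _ _).trans (by linarith)⟩

/-- Estimates of the `k`-th differences of the kernel off the origin. -/
theorem IsRegularKernel.exists_abs_fwdDiff_le (h : IsRegularKernel n k Φ a₁ a₂ z₁ δ₁)
    {r₁ : ℝ} (hr₁ : 0 < r₁) (hrz : 3 / 2 * r₁ ≤ z₁) :
    ∃ C : ℝ, 0 ≤ C ∧ ∀ (w v : V) (r : ℝ), 0 < r → ‖v‖ ≤ r → 2 * k * r ≤ ‖w‖ →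
      (‖w‖ ≤ r₁ → |(fwdDiff v)^[k] (fun x => Φ ‖x‖) w| ≤
        C * bigOmega n k Φ (r ^ n) (ballVol n * ‖w‖ ^ n)) ∧
      (r₁ < ‖w‖ → |(fwdDiff v)^[k] (fun x => Φ ‖x‖) w| ≤ C * (r ^ k * Φ (‖w‖ / 2))) := by
  obtain ⟨C, hC, hmain⟩ := exists_abs_fwdDiff_radial_le (V := V) h.one_le_k h.contDiffOn
  have ha₁ := h.a₁_pos
  have ha₂ := h.a₂_pos
  have hκ : 0 < ballVol n ^ ((k : ℝ) / n) := Real.rpow_pos_of_pos (ballVol_pos n) _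
  set κ := ballVol n ^ ((k : ℝ) / n) with hκdef
  set C₂ := C * (a₁ * 2 ^ k * 2 ^ a₁ * (1 + κ))
  set C₃ := C * (a₁ * (2 / r₁) ^ k + a₂)
  have hC₂ : 0 ≤ C₂ := by positivity
  have hC₃ : 0 ≤ C₃ := by positivity
  have hk1 : (1 : ℝ) ≤ k := by exact_mod_cast h.one_le_k
  refine ⟨C₂ + C₃, by positivity, fun w v r hr hv hw => ?_⟩
  have hw0 : 0 < ‖w‖ := lt_of_lt_of_le (by positivity) hw
  have hseg := fun s hs => half_norm_le_norm_add_smul (k := k) hv hw (s := s) hs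
  have hne : ∀ s ∈ Icc (0 : ℝ) k, w + s • v ≠ 0 := fun s hs h0 => by
    have := (hseg s hs).1
    rw [h0, norm_zero] at this
    linarith
  have hvk : ‖v‖ ^ k ≤ r ^ k := by gcongr
  have hΦ2 : 0 ≤ Φ (‖w‖ / 2) := h.nonneg _ (by positivity)
  have hΦle : ∀ s ∈ Icc (0 : ℝ) k, Φ ‖w + s • v‖ ≤ Φ (‖w‖ / 2) := fun s hs =>
    h.antitoneOn (mem_Ioi.2 (by positivity)) (norm_pos_iff.2 (hne s hs)) (hseg s hs).1
  constructor
  -- The whole segment has norm at most $\tfrac32|w|\le z_1$, so `near` applies throughout. The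
  -- factor $(2/|w|)^k$ compensates $|w+sv|^k\ge(|w|/2)^k$.
  · intro hwr
    have hb := hmain w v (a₁ * (2 / ‖w‖) ^ k * Φ (‖w‖ / 2)) hne (fun s hs j hj1 hjk => by
      obtain ⟨hl, hu⟩ := hseg s hs
      have hpos : 0 < ‖w + s • v‖ := norm_pos_iff.2 (hne s hs)
      have h1 : 1 ≤ ‖w + s • v‖ ^ k * (2 / ‖w‖) ^ k := by
        rw [← mul_pow]
        refine one_le_pow₀ ?_
        rw [← mul_div_assoc, le_div_iff₀ hw0]
        linarith
      calc _ ≤ a₁ * Φ ‖w + s • v‖ := h.near j hj1 hjk _ hpos (by linarith)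
        _ ≤ a₁ * Φ (‖w‖ / 2) := by gcongr; exact hΦle s hs
        _ = 1 * (a₁ * Φ (‖w‖ / 2)) := (one_mul _).symm
        _ ≤ (‖w + s • v‖ ^ k * (2 / ‖w‖) ^ k) * (a₁ * Φ (‖w‖ / 2)) := by gcongr
        _ = _ := by ring)
    have hdbl := h.le_rpow_mul (z := ‖w‖ / 2) (L := 2) (by positivity) (by norm_num) (by linarith)
    rw [mul_div_cancel₀ _ (two_ne_zero)] at hdbl
    have hΦw : 0 ≤ Φ ‖w‖ := h.nonneg _ hw0
    -- For $|w|\ge r$ the power $(r/|w|)^k$ is comparable to the denominator of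
    -- $\Omega_\varphi(r^n,V_n|w|^n)$.
    have hx : (r / ‖w‖) ^ k ≤ (1 + κ) / (1 + κ * (‖w‖ / r) ^ k) := by
      rw [le_div_iff₀ (by positivity), mul_add, mul_one]
      have e1 : (r / ‖w‖) ^ k * (κ * (‖w‖ / r) ^ k) = κ := by
        rw [mul_left_comm, ← mul_pow, div_mul_div_cancel₀ hw0.ne', div_self hr.ne', one_pow, mul_one]
      have e2 : (r / ‖w‖) ^ k ≤ 1 := by
        refine pow_le_one₀ (by positivity) ?_
        rw [div_le_one hw0]
        nlinarith
      linarith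
    have hΩ := bigOmega_ballVol (k := k) h.one_le_n Φ hr hw0
    have hΩ0 : 0 ≤ bigOmega n k Φ (r ^ n) (ballVol n * ‖w‖ ^ n) :=
      h.bigOmega_nonneg (by positivity) (mul_pos (ballVol_pos n) (by positivity))
    calc _ ≤ C * (‖v‖ ^ k * (a₁ * (2 / ‖w‖) ^ k * Φ (‖w‖ / 2))) := hb
      _ ≤ C * (r ^ k * (a₁ * (2 / ‖w‖) ^ k * (2 ^ a₁ * Φ ‖w‖))) := by gcongr
      _ = C * (a₁ * 2 ^ k * 2 ^ a₁ * ((r / ‖w‖) ^ k * Φ ‖w‖)) := by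
        rw [div_pow, div_pow]; ring
      _ ≤ C * (a₁ * 2 ^ k * 2 ^ a₁ * ((1 + κ) / (1 + κ * (‖w‖ / r) ^ k) * Φ ‖w‖)) := by gcongr
      _ = C₂ * bigOmega n k Φ (r ^ n) (ballVol n * ‖w‖ ^ n) := by rw [hΩ]; ring
      _ ≤ _ := by gcongr; linarith
  -- The segment may meet both ranges of the hypotheses. Where `near` is used, $|w+sv|\ge r_1/2$
  -- supplies the missing power $|w+sv|^k$.
  · intro hwr
    have hb := hmain w v ((a₁ * (2 / r₁) ^ k + a₂) * Φ (‖w‖ / 2)) hne (fun s hs j hj1 hjk => by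
      obtain ⟨hl, hu⟩ := hseg s hs
      have hpos : 0 < ‖w + s • v‖ := norm_pos_iff.2 (hne s hs)
      rcases le_or_gt ‖w + s • v‖ z₁ with hz | hz
      · have h1 : 1 ≤ ‖w + s • v‖ ^ k * (2 / r₁) ^ k := by
          rw [← mul_pow]
          refine one_le_pow₀ ?_
          rw [← mul_div_assoc, le_div_iff₀ hr₁]
          linarith
        calc _ ≤ a₁ * Φ ‖w + s • v‖ := h.near j hj1 hjk _ hpos hz
          _ ≤ a₁ * Φ (‖w‖ / 2) := by gcongr; exact hΦle s hs
          _ = 1 * (a₁ * Φ (‖w‖ / 2)) := (one_mul _).symm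
          _ ≤ (‖w + s • v‖ ^ k * (2 / r₁) ^ k) * (a₁ * Φ (‖w‖ / 2)) := by gcongr
          _ = ‖w + s • v‖ ^ k * ((a₁ * (2 / r₁) ^ k + 0) * Φ (‖w‖ / 2)) := by ring
          _ ≤ _ := by gcongr
      · calc _ ≤ a₂ * ‖w + s • v‖ ^ k * Φ ‖w + s • v‖ := h.far j hj1 hjk _ hz
          _ ≤ a₂ * ‖w + s • v‖ ^ k * Φ (‖w‖ / 2) := by gcongr; exact hΦle s hs
          _ = ‖w + s • v‖ ^ k * ((0 + a₂) * Φ (‖w‖ / 2)) := by ring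
          _ ≤ _ := by gcongr; positivity)
    calc _ ≤ C * (‖v‖ ^ k * ((a₁ * (2 / r₁) ^ k + a₂) * Φ (‖w‖ / 2))) := hb
      _ ≤ C * (r ^ k * ((a₁ * (2 / r₁) ^ k + a₂) * Φ (‖w‖ / 2))) := by gcongr
      _ = C₃ * (r ^ k * Φ (‖w‖ / 2)) := by ring
      _ ≤ _ := by gcongr; linarith

open scoped RealInnerProductSpace

/-- In a narrow cone around `e` the `k`-th derivative of the kernel in the direction `e` is
comparable to the radial one. -/
theorem IsRegularKernel.exists_le_chainTerm (h : IsRegularKernel n k Φ a₁ a₂ z₁ δ₁) :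
    ∃ c : ℝ, 0 ≤ c ∧ c < 1 ∧ ∀ (e w : V), ‖e‖ = 1 → c * ‖w‖ < ⟪w, e⟫ → ‖w‖ ≤ z₁ →
      δ₁ / 2 * Φ ‖w‖ / ‖w‖ ^ k ≤
        (-1) ^ k * chainTerm (fun j => radialDeriv j Φ ‖w‖) ⟪w, e⟫ 1 k 0 0 := by
  obtain ⟨C, hC, hpert⟩ := exists_abs_chainTerm_sub_le k 0 0
  have ha₁ := h.a₁_pos
  have hδ₁ := h.δ₁_pos
  have hq : 0 < δ₁ / (2 * (C + 1) * a₁) := by positivity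
  -- The aperture is chosen so that $C(1-c)a_1\le\delta_1/2$: the deviation from the radial
  -- derivative costs at most half of its lower bound. Using $C+1$ avoids division by zero.
  refine ⟨max 0 (1 - δ₁ / (2 * (C + 1) * a₁)), le_max_left _ _,
    max_lt one_pos (by linarith), fun e w he hw hwz => ?_⟩
  have hw0 : 0 < ‖w‖ := by
    refine norm_pos_iff.2 fun h0 => ?_
    simp [h0] at hw
  have hcs : ⟪w, e⟫ ≤ ‖w‖ := by simpa [he] using real_inner_le_norm w e
  set c := ⟪w, e⟫ / ‖w‖ with hcdef
  have hinner : ⟪w, e⟫ = ‖w‖ * c := by rw [hcdef]; field_simp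
  have hc1 : c ≤ 1 := (div_le_one hw0).2 hcs
  have hclt : max 0 (1 - δ₁ / (2 * (C + 1) * a₁)) < c := by rwa [hcdef, lt_div_iff₀ hw0]
  have hc0 : 0 ≤ c := (le_max_left _ _).trans hclt.le
  have hc2 : 1 - c ≤ δ₁ / (2 * (C + 1) * a₁) := by
    have := (le_max_right 0 (1 - δ₁ / (2 * (C + 1) * a₁))).trans hclt.le
    linarith
  have hΦw : 0 ≤ Φ ‖w‖ := h.nonneg _ hw0
  have hp := hpert (fun j => radialDeriv j Φ ‖w‖) ‖w‖ c (a₁ * Φ ‖w‖ / ‖w‖ ^ k) hc0 hc1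
    (fun i l hil => by
      have hk := h.one_le_k
      have hj := h.near (i + l) (by omega) (by omega) ‖w‖ hw0 hwz
      rw [show 2 * (i + l) = k + i by omega, pow_add, mul_assoc] at hj
      rw [le_div_iff₀ (by positivity), abs_mul, abs_pow, abs_norm]
      linarith)
  have hlow := h.lower ‖w‖ hw0 hwz
  rw [iteratedDeriv_eq_chainTerm h.contDiffOn k le_rfl hw0] at hlow
  rw [hinner]
  set X := chainTerm (fun j => radialDeriv j Φ ‖w‖) (‖w‖ * c) 1 k 0 0
  set Y := chainTerm (fun j => radialDeriv j Φ ‖w‖) ‖w‖ 1 k 0 0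
  have h1 : δ₁ * Φ ‖w‖ / ‖w‖ ^ k ≤ (-1) ^ k * Y := by
    rw [div_le_iff₀ (by positivity)]
    linarith
  have h2 : C * ((1 - c) * (a₁ * Φ ‖w‖ / ‖w‖ ^ k)) ≤ δ₁ / 2 * Φ ‖w‖ / ‖w‖ ^ k := by
    have hm : C * ((1 - c) * a₁) ≤ δ₁ / 2 := by
      calc C * ((1 - c) * a₁) ≤ (C + 1) * (δ₁ / (2 * (C + 1) * a₁) * a₁) := by
            gcongr
            · linarith
        _ = δ₁ / 2 := by field_simp
    calc _ = C * ((1 - c) * a₁) * (Φ ‖w‖ / ‖w‖ ^ k) := by ring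
      _ ≤ δ₁ / 2 * (Φ ‖w‖ / ‖w‖ ^ k) := by gcongr
      _ = _ := by ring
  have h3 : |(-1) ^ k * X - (-1) ^ k * Y| ≤ δ₁ / 2 * Φ ‖w‖ / ‖w‖ ^ k := by
    rw [← mul_sub, abs_mul, abs_pow, abs_neg, abs_one, one_pow, one_mul]
    exact hp.trans h2
  have h4 := (abs_le.1 h3).1
  have h5 : δ₁ * Φ ‖w‖ / ‖w‖ ^ k = 2 * (δ₁ / 2 * Φ ‖w‖ / ‖w‖ ^ k) := by ring
  linarith

/-- Lower estimates of the `k`-th differences of the kernel in a cone. -/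
theorem IsRegularKernel.exists_le_fwdDiff (h : IsRegularKernel n k Φ a₁ a₂ z₁ δ₁) :
    ∃ c c' : ℝ, 0 ≤ c ∧ c < 1 ∧ 0 < c' ∧ ∀ (e w : V) (δ : ℝ), ‖e‖ = 1 → c * ‖w‖ < ⟪w, e⟫ →
      (k + 1) * ‖w‖ ≤ z₁ → ‖w‖ + k * δ ≤ z₁ → 0 < δ →
      c' * bigOmega n k Φ (δ ^ n) (ballVol n * ‖w‖ ^ n) ≤
        (-1) ^ k * (fwdDiff (δ • e))^[k] (fun x => Φ ‖x‖) w := by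
  obtain ⟨c, hc0, hc1, hchain⟩ := h.exists_le_chainTerm (V := V)
  have hδ₁ := h.δ₁_pos
  have hκ : 0 < ballVol n ^ ((k : ℝ) / n) := Real.rpow_pos_of_pos (ballVol_pos n) _
  set κ := ballVol n ^ ((k : ℝ) / n) with hκdef
  have hk1 : (1 : ℝ) ≤ (k : ℝ) + 1 := by linarith [(Nat.cast_nonneg k : (0 : ℝ) ≤ k)]
  have hk0 : (0 : ℝ) < (k : ℝ) + 1 := by linarith
  -- The factors come, in order, from comparing $(\delta'/|w|)^k$ with the denominator of
  -- $\Omega_\varphi$, from the derivative bound, from doubling, and from $|w+se|\le(k+1)|w|$.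
  refine ⟨c, min 1 κ * (δ₁ / 2) / ((k + 1) ^ a₁ * (k + 1) ^ k), hc0, hc1, by positivity,
    fun e w δ he hw hwz hwδ hδ => ?_⟩
  have hw0 : 0 < ‖w‖ := by
    refine norm_pos_iff.2 fun h0 => ?_
    simp [h0] at hw
  have hnorm : ∀ s : ℝ, 0 ≤ s → ‖w + s • e‖ ≤ ‖w‖ + s := fun s hs => by
    refine (norm_add_le _ _).trans ?_
    rw [norm_smul, he, mul_one, Real.norm_of_nonneg hs]
  -- Moving from $w$ in the direction $e$ does not leave the cone, because $c<1$.
  have hcone : ∀ s : ℝ, 0 ≤ s → c * ‖w + s • e‖ < ⟪w + s • e, e⟫ := fun s hs => by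
    rw [inner_add_left, real_inner_smul_left, real_inner_self_eq_norm_sq, he]
    have h1 : c * ‖w + s • e‖ ≤ c * (‖w‖ + s) := by gcongr; exact hnorm s hs
    nlinarith
  have hne : ∀ s : ℝ, 0 ≤ s → w + s • e ≠ 0 := fun s hs h0 => by
    have := hcone s hs
    simp [h0] at this
  -- With steps at most $|w|$ the nodes stay within $(k+1)|w|$, where doubling compares the kernel
  -- with $\Phi(|w|)$. Further out only the sign of the derivative is used.
  set δ' := min δ ‖w‖ with hδ'
  have hδ'0 : 0 < δ' := lt_min hδ hw0
  have hδ'δ : δ' ≤ δ := min_le_left _ _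
  have hδ'w : δ' ≤ ‖w‖ := min_le_right _ _
  have hΦk : 0 ≤ Φ ((k + 1) * ‖w‖) := h.nonneg _ (by positivity)
  have hfd := le_fwdDiff_iter (δ := δ) (δ' := δ')
    (m := δ₁ / 2 * Φ ((k + 1) * ‖w‖) / ((k + 1) * ‖w‖) ^ k) hδ'0.le hδ'δ (by positivity) k
    (fun m s => (-1) ^ k * chainTerm (fun j => radialDeriv j Φ ‖w + s • e‖)
      ⟪w + s • e, e⟫ (‖e‖ ^ 2) m 0 0) 0
    (fun i hi s hs => (hasDerivAt_chainTerm_line h.contDiffOn hi w e s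
      (hne s hs.1)).const_mul _)
    (fun s hs => by
      have hs0 : 0 ≤ s := hs.1
      have hp : 0 < ‖w + s • e‖ := norm_pos_iff.2 (hne s hs0)
      have := hchain e (w + s • e) he (hcone s hs0) ((hnorm s hs0).trans (by linarith [hs.2]))
      rw [he, one_pow]
      refine le_trans ?_ this
      have := h.nonneg _ hp
      positivity)
    (fun s hs => by
      have hs0 : 0 ≤ s := hs.1
      have hp : 0 < ‖w + s • e‖ := norm_pos_iff.2 (hne s hs0)
      have hkδ : (k : ℝ) * δ' ≤ k * ‖w‖ := by gcongr
      have hkδ' : (k : ℝ) * δ' ≤ k * δ := by gcongr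
      have hle : ‖w + s • e‖ ≤ (k + 1) * ‖w‖ := (hnorm s hs0).trans (by linarith [hs.2])
      have := hchain e (w + s • e) he (hcone s hs0) (hle.trans hwz)
      rw [he, one_pow]
      refine le_trans ?_ this
      have hΦs := h.nonneg _ hp
      gcongr
      exact h.antitoneOn hp (mem_Ioi.2 (by positivity)) hle)
  have hlhs : (fwdDiff δ)^[k] (fun s => (-1) ^ k * chainTerm (fun j => radialDeriv j Φ ‖w + s • e‖)
      ⟪w + s • e, e⟫ (‖e‖ ^ 2) 0 0 0) 0 = (-1) ^ k * (fwdDiff (δ • e))^[k] (fun x => Φ ‖x‖) w := by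
    rw [fwdDiff_iter_eq_line]
    have := congrFun (fwdDiff_iter_const_smul (h := δ) ((-1 : ℝ) ^ k)
      (fun s : ℝ => Φ ‖w + s • e‖) k) 0
    simpa [chainTerm, radialDeriv, Pi.smul_def] using this
  rw [← hlhs]
  refine le_trans ?_ hfd
  have hdbl := h.le_rpow_mul (z := ‖w‖) (L := k + 1) hw0 hk1 hwz
  have hΦw := h.nonneg _ hw0
  rw [bigOmega_ballVol h.one_le_n Φ hδ hw0, ← hκdef]
  have hfrac : min 1 κ / (1 + κ * (‖w‖ / δ) ^ k) ≤ (δ' / ‖w‖) ^ k := by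
    rw [div_le_iff₀ (by positivity)]
    rcases le_total δ ‖w‖ with hle | hle
    · rw [hδ', min_eq_left hle]
      have e1 : (δ / ‖w‖) ^ k * (κ * (‖w‖ / δ) ^ k) = κ := by
        rw [mul_left_comm, ← mul_pow, div_mul_div_cancel₀ hw0.ne', div_self hδ.ne', one_pow, mul_one]
      rw [mul_add, e1, mul_one]
      have : 0 ≤ (δ / ‖w‖) ^ k := by positivity
      linarith [min_le_right 1 κ]
    · rw [hδ', min_eq_right hle, div_self hw0.ne', one_pow, one_mul]
      have : 0 ≤ κ * (‖w‖ / δ) ^ k := by positivity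
      linarith [min_le_left 1 κ]
  have hΦle : Φ ‖w‖ / (k + 1) ^ a₁ ≤ Φ ((k + 1) * ‖w‖) := by
    rw [div_le_iff₀ (by positivity)]
    linarith
  calc min 1 κ * (δ₁ / 2) / ((k + 1) ^ a₁ * (k + 1) ^ k) * (Φ ‖w‖ / (1 + κ * (‖w‖ / δ) ^ k))
      = min 1 κ / (1 + κ * (‖w‖ / δ) ^ k) * (δ₁ / 2 * (Φ ‖w‖ / (k + 1) ^ a₁) / (k + 1) ^ k) := by
        field_simp
    _ ≤ (δ' / ‖w‖) ^ k * (δ₁ / 2 * Φ ((k + 1) * ‖w‖) / (k + 1) ^ k) := by gcongr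
    _ = _ := by rw [div_pow, mul_pow]; field_simp

end Kernel

/-! ### Convolutions with radially nonincreasing kernels -/

section Potentials

variable {n k : ℕ} {Φ : ℝ → ℝ} {a₁ a₂ z₁ δ₁ : ℝ}

theorem lintegral_Ioi_mul_le {α g : ℝ → ℝ≥0∞} (hα : AEMeasurable α (volume.restrict (Ioi 0)))
    (hg : Antitone g) (T : ℝ) :
    ∫⁻ τ in Ioi 0, α τ * g τ ≤
      (∫⁻ τ in Ioo 0 T, α τ * g τ) + (∫⁻ τ in Ioi 0, α τ) * g T := by
  rw [← lintegral_mul_const'' _ hα]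
  calc ∫⁻ τ in Ioi 0, α τ * g τ
      ≤ ∫⁻ τ in Ioi 0, ((Ioo 0 T).indicator (fun τ => α τ * g τ) τ + α τ * g T) := by
        refine setLIntegral_mono' measurableSet_Ioi fun τ (hτ : 0 < τ) => ?_
        rcases lt_or_ge τ T with h | h
        · rw [indicator_of_mem (show τ ∈ Ioo 0 T from ⟨hτ, h⟩)]
          exact le_self_add
        · refine le_add_left ?_
          gcongr
          exact hg h
    _ = (∫⁻ τ in Ioi 0, (Ioo 0 T).indicator (fun τ => α τ * g τ) τ) +
          ∫⁻ τ in Ioi 0, α τ * g T := lintegral_add_right' _ (hα.mul_const _)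
    _ ≤ _ := by
        refine add_le_add (le_of_eq ?_) le_rfl
        rw [lintegral_indicator measurableSet_Ioo, Measure.restrict_restrict measurableSet_Ioo,
          inter_eq_left.2 Ioo_subset_Ioi_self]

theorem le_inv_mul_lintegral {g : ℝ → ℝ≥0∞} (hg : Antitone g) {T : ℝ} (hT : 0 < T) :
    g T ≤ (ENNReal.ofReal T)⁻¹ * ∫⁻ τ in Ioo 0 T, g τ := by
  have hT0 : ENNReal.ofReal T ≠ 0 := by simpa using hT
  rw [← ENNReal.div_eq_inv_mul, ENNReal.le_div_iff_mul_le (Or.inl hT0) (Or.inl ENNReal.ofReal_ne_top)]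
  calc g T * ENNReal.ofReal T = ∫⁻ _ in Ioo 0 T, g T := by simp
    _ ≤ _ := setLIntegral_mono' measurableSet_Ioo fun τ hτ => hg hτ.2.le

theorem lt_top_of_lintegral_lt_top {g : ℝ → ℝ≥0∞} (hg : Antitone g) {T : ℝ} (hT : 0 < T)
    (h : ∫⁻ τ in Ioo 0 T, g τ < ∞) {τ : ℝ} (hτ : 0 < τ) : g τ < ∞ := by
  have hm : 0 < min τ T := lt_min hτ hT
  refine (hg (min_le_left τ T)).trans_lt ((le_inv_mul_lintegral hg hm).trans_lt ?_)
  refine ENNReal.mul_lt_top (ENNReal.inv_lt_top.2 (by simpa using hm)) ?_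
  exact (lintegral_mono_set (Ioo_subset_Ioo_right (min_le_right _ _))).trans_lt h

theorem ae_sub_ne_zero (hn : 1 ≤ n) (x : EuclideanSpace ℝ (Fin n)) : ∀ᵐ y, x - y ≠ 0 := by
  have : Nonempty (Fin n) := ⟨⟨0, by omega⟩⟩
  filter_upwards [compl_mem_ae_iff.2 (measure_singleton x)] with y hy h0
  exact hy (sub_eq_zero.1 h0).symm

theorem volVar_pos {w : EuclideanSpace ℝ (Fin n)} (hw : w ≠ 0) : 0 < ballVol n * ‖w‖ ^ n :=
  mul_pos (ballVol_pos n) (pow_pos (norm_pos_iff.2 hw) n)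

theorem aemeasurable_radial (hn : 1 ≤ n) {α : ℝ → ℝ≥0∞} (hα : AntitoneOn α (Ioi 0))
    (x : EuclideanSpace ℝ (Fin n)) : AEMeasurable fun y => α (ballVol n * ‖x - y‖ ^ n) := by
  refine ⟨fun y => topExtend α (ballVol n * ‖x - y‖ ^ n),
    (topExtend_antitone hα).measurable.comp (by fun_prop), ?_⟩
  filter_upwards [ae_sub_ne_zero hn x] with y hy
  simp [topExtend, not_le.2 (volVar_pos hy)]

/-- The function `φ` with values in `[0,∞]`. -/
noncomputable def ephi (n : ℕ) (Φ : ℝ → ℝ) (τ : ℝ) : ℝ≥0∞ := ENNReal.ofReal (phi n Φ τ)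

theorem IsStandard.ephi_antitoneOn (hΦ : IsStandard n Φ) : AntitoneOn (ephi n Φ) (Ioi 0) :=
  fun _ ha _ hb hab => ENNReal.ofReal_le_ofReal (hΦ.phi_antitoneOn ha hb hab)

theorem IsStandard.lintegral_ephi_lt_top (hΦ : IsStandard n Φ) (hn : 1 ≤ n) :
    ∫⁻ τ in Ioi 0, ephi n Φ τ < ∞ :=
  (hΦ.integrableOn_phi hn).lintegral_lt_top

theorem IsStandard.enorm_kernel (hΦ : IsStandard n Φ) (hn : 1 ≤ n)
    {w : EuclideanSpace ℝ (Fin n)} (hw : w ≠ 0) :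
    ‖((Φ ‖w‖ : ℝ) : ℂ)‖ₑ = ephi n Φ (ballVol n * ‖w‖ ^ n) := by
  rw [ephi, phi_ballVol hn Φ (norm_nonneg w), ← ofReal_norm, Complex.norm_real,
    Real.norm_of_nonneg (hΦ.nonneg _ (norm_pos_iff.2 hw))]

variable {f : EuclideanSpace ℝ (Fin n) → ℂ}

theorem lintegral_kernel_mul_le (hn : 1 ≤ n) {α : ℝ → ℝ≥0∞} (hα : AntitoneOn α (Ioi 0))
    {b : EuclideanSpace ℝ (Fin n) → ℂ}
    (hb : ∀ v, v ≠ 0 → ‖b v‖ₑ ≤ α (ballVol n * ‖v‖ ^ n)) (hf : AEMeasurable f)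
    (x : EuclideanSpace ℝ (Fin n)) :
    ∫⁻ y, ‖b (x - y) * f y‖ₑ ≤ ∫⁻ τ in Ioi 0, α τ * rearr volume (fun y => ‖f y‖ₑ) τ := by
  refine le_trans ?_ (lintegral_radial_mul_le hn hα x hf.enorm)
  refine lintegral_mono_ae ?_
  filter_upwards [ae_sub_ne_zero hn x] with y hy
  rw [enorm_mul]
  gcongr
  exact hb _ hy

theorem IsStandard.integrable_kernel_mul (hΦ : IsStandard n Φ) (hn : 1 ≤ n) (hf : AEMeasurable f)
    (hfin : ∫⁻ τ in Ioi 0, ephi n Φ τ * rearr volume (fun y => ‖f y‖ₑ) τ < ∞)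
    (x : EuclideanSpace ℝ (Fin n)) : Integrable fun y => (Φ ‖x - y‖ : ℂ) * f y := by
  refine ⟨AEMeasurable.aestronglyMeasurable (AEMeasurable.mul ?_ hf), ?_⟩
  · have h1 := (aemeasurable_radial hn hΦ.ephi_antitoneOn x).ennreal_toReal
    refine (Complex.measurable_ofReal.comp_aemeasurable h1).congr ?_
    filter_upwards [ae_sub_ne_zero hn x] with y hy
    simp only [Function.comp_apply, ephi]
    rw [ENNReal.toReal_ofReal (hΦ.phi_nonneg (volVar_pos hy)), phi_ballVol hn Φ (norm_nonneg _)]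
  · exact (lintegral_kernel_mul_le hn hΦ.ephi_antitoneOn (b := fun w => (Φ ‖w‖ : ℂ))
      (fun _ hw => (hΦ.enorm_kernel hn hw).le) hf x).trans_lt hfin

theorem IsStandard.enorm_potential_le (hΦ : IsStandard n Φ) (hn : 1 ≤ n) (hf : AEMeasurable f)
    (x : EuclideanSpace ℝ (Fin n)) : ‖potential Φ f x‖ₑ ≤
      ∫⁻ τ in Ioi 0, ephi n Φ τ * rearr volume (fun y => ‖f y‖ₑ) τ :=
  (enorm_integral_le_lintegral_enorm _).trans
    (lintegral_kernel_mul_le hn hΦ.ephi_antitoneOn (b := fun w => (Φ ‖w‖ : ℂ))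
      (fun _ hw => (hΦ.enorm_kernel hn hw).le) hf x)

theorem fwdDiff_kernel_mul_eq_sum (Φ : ℝ → ℝ) (f : EuclideanSpace ℝ (Fin n) → ℂ) (k : ℕ)
    (h x y : EuclideanSpace ℝ (Fin n)) :
    (((fwdDiff h)^[k] (fun z => Φ ‖z‖) (x - y) : ℝ) : ℂ) * f y =
      ∑ j ∈ Finset.range (k + 1), (((-1 : ℤ) ^ (k - j) * (k.choose j : ℤ) : ℤ) : ℂ) *
        ((Φ ‖x + j • h - y‖ : ℂ) * f y) := by
  rw [fwdDiff_iter_eq_sum_shift, Complex.ofReal_sum, Finset.sum_mul]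
  refine Finset.sum_congr rfl fun j _ => ?_
  rw [sub_add_eq_add_sub]
  simp only [zsmul_eq_mul, Complex.ofReal_mul, Complex.ofReal_intCast]
  ring

theorem IsStandard.integrable_fwdDiff_kernel_mul (hΦ : IsStandard n Φ) (hn : 1 ≤ n)
    (hf : AEMeasurable f)
    (hfin : ∫⁻ τ in Ioi 0, ephi n Φ τ * rearr volume (fun y => ‖f y‖ₑ) τ < ∞) (k : ℕ)
    (h x : EuclideanSpace ℝ (Fin n)) :
    Integrable fun y => (((fwdDiff h)^[k] (fun z => Φ ‖z‖) (x - y) : ℝ) : ℂ) * f y := by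
  simp_rw [fwdDiff_kernel_mul_eq_sum]
  exact integrable_finsetSum _ fun j _ =>
    (hΦ.integrable_kernel_mul hn hf hfin (x + j • h)).const_mul _

theorem IsStandard.fwdDiff_potential (hΦ : IsStandard n Φ) (hn : 1 ≤ n) (hf : AEMeasurable f)
    (hfin : ∫⁻ τ in Ioi 0, ephi n Φ τ * rearr volume (fun y => ‖f y‖ₑ) τ < ∞) (k : ℕ)
    (h x : EuclideanSpace ℝ (Fin n)) :
    (fwdDiff h)^[k] (potential Φ f) x =
      ∫ y, (((fwdDiff h)^[k] (fun z => Φ ‖z‖) (x - y) : ℝ) : ℂ) * f y := by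
  simp_rw [fwdDiff_kernel_mul_eq_sum]
  rw [fwdDiff_iter_eq_sum_shift, integral_finsetSum _ fun j _ =>
    (hΦ.integrable_kernel_mul hn hf hfin (x + j • h)).const_mul _]
  refine Finset.sum_congr rfl fun j _ => ?_
  rw [integral_const_mul, zsmul_eq_mul, potential]

theorem enorm_fwdDiff_iter_le {V : Type*} [AddCommGroup V] (G : V → ℝ) (k : ℕ) (h w : V) :
    ‖(fwdDiff h)^[k] G w‖ₑ ≤ ∑ j ∈ Finset.range (k + 1), (k.choose j : ℝ≥0∞) * ‖G (w + j • h)‖ₑ := by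
  rw [fwdDiff_iter_eq_sum_shift]
  refine (enorm_sum_le _ _).trans (Finset.sum_le_sum fun j _ => ?_)
  rw [zsmul_eq_mul, enorm_mul]
  gcongr
  rw [← ofReal_norm]
  simp

/-- A pointwise estimate of the differences of the kernel by radially nonincreasing functions. -/
theorem IsRegularKernel.exists_enorm_fwdDiff_le (h : IsRegularKernel n k Φ a₁ a₂ z₁ δ₁)
    {T : ℝ} (hT : 0 < T) : ∃ (C : ℝ) (τ₁ : ℝ), 0 ≤ C ∧ 0 < τ₁ ∧
      ∀ (r : ℝ) (v w : EuclideanSpace ℝ (Fin n)), 0 < r → ‖v‖ ≤ r →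
        (∀ j : ℕ, w + j • v ≠ 0) →
        ‖(fwdDiff v)^[k] (fun x => Φ ‖x‖) w‖ₑ ≤
          (∑ j ∈ Finset.range (k + 1), (k.choose j : ℝ≥0∞) *
            (Iio (ballVol n * (3 * k * r) ^ n)).indicator (ephi n Φ)
              (ballVol n * ‖w + j • v‖ ^ n)) +
          ENNReal.ofReal C * (Iio T).indicator (fun τ => ENNReal.ofReal (bigOmega n k Φ (r ^ n) τ))
            (ballVol n * ‖w‖ ^ n) +
          ENNReal.ofReal C * (ENNReal.ofReal (r ^ k) *
            ephi n Φ (max (ballVol n * ‖w‖ ^ n) τ₁ / 2 ^ n)) := by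
  have hn := h.one_le_n
  have hV := ballVol_pos n
  have hk1 : (1 : ℝ) ≤ k := by exact_mod_cast h.one_le_k
  -- The first bound keeps the segments below $z_1$; the second makes the ball of radius $r_1$ have
  -- volume less than $T$.
  set r₁ := min (2 / 3 * z₁) (volRadius n (T / 2)) with hr₁
  have hr₁0 : 0 < r₁ := lt_min (by linarith [h.z₁_pos]) (volRadius_pos (by linarith))
  have hr₁z : 3 / 2 * r₁ ≤ z₁ := by
    have := min_le_left (2 / 3 * z₁) (volRadius n (T / 2))
    linarith
  have hr₁T : ballVol n * r₁ ^ n < T := by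
    have h1 : r₁ ^ n ≤ (volRadius n (T / 2)) ^ n := by
      gcongr
      exact min_le_right _ _
    have h2 := volRadius_pow hn (τ := T / 2) (by linarith)
    nlinarith
  obtain ⟨C, hC, hmain⟩ := h.exists_abs_fwdDiff_le (V := EuclideanSpace ℝ (Fin n)) hr₁0 hr₁z
  refine ⟨C, ballVol n * r₁ ^ n, hC, by positivity, fun r v w hr hv hne => ?_⟩
  have hw0 : 0 < ‖w‖ := norm_pos_iff.2 (by simpa using hne 0)
  -- Near the origin the difference is estimated term by term; the nodes then have norm below
  -- $2kr+kr=3kr$.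
  rcases lt_or_ge ‖w‖ (2 * k * r) with hw | hw
  · rw [add_assoc]
    refine le_add_right ((enorm_fwdDiff_iter_le _ k v w).trans (Finset.sum_le_sum fun j hj => ?_))
    gcongr
    have hj' : (j : ℝ) ≤ k := by exact_mod_cast Nat.lt_succ_iff.1 (Finset.mem_range.1 hj)
    have hlt : ‖w + j • v‖ < 3 * k * r := by
      have h1 : ‖j • v‖ ≤ k * r := by
        rw [← Nat.cast_smul_eq_nsmul ℝ, norm_smul, Real.norm_natCast]
        gcongr
      linarith [norm_add_le w (j • v)]
    rw [indicator_of_mem]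
    · rw [ephi, phi_ballVol hn Φ (norm_nonneg _), Real.enorm_of_nonneg
        (h.nonneg _ (norm_pos_iff.2 (hne j)))]
    · rw [mem_Iio]
      gcongr
  · obtain ⟨hl, hu⟩ := hmain w v r hr hv hw
    rw [Real.enorm_eq_ofReal_abs]
    rcases le_or_gt ‖w‖ r₁ with hwr | hwr
    · refine le_add_right (le_add_left ?_)
      rw [indicator_of_mem, ← ENNReal.ofReal_mul hC]
      · exact ENNReal.ofReal_le_ofReal (hl hwr)
      · rw [mem_Iio]
        refine lt_of_le_of_lt ?_ hr₁T
        gcongr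
    -- The maximum with $\tau_1$ is inactive here. It makes the majorant bounded near the origin
    -- while keeping it nonincreasing.
    · refine le_add_left ?_
      rw [max_eq_left (by gcongr), mul_div_assoc, ← div_pow, ephi, phi_ballVol hn Φ (by positivity),
        ← ENNReal.ofReal_mul (by positivity), ← ENNReal.ofReal_mul hC]
      exact ENNReal.ofReal_le_ofReal (hu hwr)

theorem antitoneOn_indicator_Iio {α : ℝ → ℝ≥0∞} (hα : AntitoneOn α (Ioi 0)) (L : ℝ) :
    AntitoneOn ((Iio L).indicator α) (Ioi 0) := by
  intro a ha b hb hab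
  by_cases hbL : b < L
  · rw [indicator_of_mem (show b ∈ Iio L from hbL),
      indicator_of_mem (show a ∈ Iio L from hab.trans_lt hbL)]
    exact hα ha hb hab
  · rw [indicator_of_notMem (show b ∉ Iio L from hbL)]
    exact zero_le

theorem lintegral_Ioi_indicator_Iio (α g : ℝ → ℝ≥0∞) (L : ℝ) :
    ∫⁻ τ in Ioi 0, (Iio L).indicator α τ * g τ = ∫⁻ τ in Ioo 0 L, α τ * g τ := by
  have : ∀ τ, (Iio L).indicator α τ * g τ = (Iio L).indicator (fun τ => α τ * g τ) τ := fun τ => by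
    by_cases h : τ ∈ Iio L <;> simp [indicator, h]
  simp_rw [this]
  rw [lintegral_indicator measurableSet_Iio, Measure.restrict_restrict measurableSet_Iio,
    inter_comm, Ioi_inter_Iio]

theorem IsStandard.ephi_max_antitoneOn (hΦ : IsStandard n Φ) {τ₁ : ℝ} (hτ₁ : 0 < τ₁) :
    Antitone fun τ => ephi n Φ (max τ τ₁ / 2 ^ n) := by
  intro a b hab
  have h0 : 0 < max a τ₁ := lt_max_of_lt_right hτ₁
  have h1 : 0 < max b τ₁ := lt_max_of_lt_right hτ₁
  exact hΦ.ephi_antitoneOn (mem_Ioi.2 (by positivity)) (mem_Ioi.2 (by positivity)) (by gcongr)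

/-- The estimate of the modulus of smoothness of a potential. -/
theorem IsRegularKernel.exists_enorm_fwdDiff_potential_le
    (h : IsRegularKernel n k Φ a₁ a₂ z₁ δ₁) {T : ℝ} (hT : 0 < T) :
    ∃ (C C' : ℝ) (τ₁ : ℝ), 0 < τ₁ ∧ ∀ f : EuclideanSpace ℝ (Fin n) → ℂ, AEMeasurable f →
      ∫⁻ τ in Ioi 0, ephi n Φ τ * rearr volume (fun y => ‖f y‖ₑ) τ < ∞ →
      ∀ (r : ℝ) (v x : EuclideanSpace ℝ (Fin n)), 0 < r → ‖v‖ ≤ r →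
      ‖(fwdDiff v)^[k] (potential Φ f) x‖ₑ ≤
        ENNReal.ofReal C * (∫⁻ τ in Ioo 0 (ballVol n * (3 * k * r) ^ n),
          ephi n Φ τ * rearr volume (fun y => ‖f y‖ₑ) τ) +
        ENNReal.ofReal C' * (∫⁻ τ in Ioo 0 T, ENNReal.ofReal (bigOmega n k Φ (r ^ n) τ) *
          rearr volume (fun y => ‖f y‖ₑ) τ) +
        ENNReal.ofReal C' * (ENNReal.ofReal (r ^ k) * ∫⁻ τ in Ioi 0,
          ephi n Φ (max τ τ₁ / 2 ^ n) * rearr volume (fun y => ‖f y‖ₑ) τ) := by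
  obtain ⟨C, τ₁, hC, hτ₁, hpt⟩ := h.exists_enorm_fwdDiff_le hT
  have hn := h.one_le_n
  refine ⟨2 ^ k, C, τ₁, hτ₁, fun f hf hfin r v x hr hv => ?_⟩
  set F : EuclideanSpace ℝ (Fin n) → ℝ≥0∞ := fun y => ‖f y‖ₑ with hFdef
  have hF : AEMeasurable F := hf.enorm
  set α₁ : ℝ → ℝ≥0∞ := (Iio (ballVol n * (3 * k * r) ^ n)).indicator (ephi n Φ)
  set α₂ : ℝ → ℝ≥0∞ := (Iio T).indicator (fun τ => ENNReal.ofReal (bigOmega n k Φ (r ^ n) τ))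
  set α₃ : ℝ → ℝ≥0∞ := fun τ => ephi n Φ (max τ τ₁ / 2 ^ n)
  have hα₁ : AntitoneOn α₁ (Ioi 0) := antitoneOn_indicator_Iio h.ephi_antitoneOn _
  have hα₂ : AntitoneOn α₂ (Ioi 0) := antitoneOn_indicator_Iio
    (fun a ha b hb hab => ENNReal.ofReal_le_ofReal
      (h.bigOmega_antitoneOn (pow_pos hr n) ha hb hab)) _
  have hα₃ : AntitoneOn α₃ (Ioi 0) := (h.ephi_max_antitoneOn hτ₁).antitoneOn _
  have hI₁ : ∀ z, ∫⁻ y, α₁ (ballVol n * ‖z - y‖ ^ n) * F y ≤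
      ∫⁻ τ in Ioo 0 (ballVol n * (3 * k * r) ^ n), ephi n Φ τ * rearr volume F τ := fun z =>
    (lintegral_radial_mul_le hn hα₁ z hF).trans (lintegral_Ioi_indicator_Iio _ _ _).le
  have hI₂ : ∫⁻ y, α₂ (ballVol n * ‖x - y‖ ^ n) * F y ≤
      ∫⁻ τ in Ioo 0 T, ENNReal.ofReal (bigOmega n k Φ (r ^ n) τ) * rearr volume F τ :=
    (lintegral_radial_mul_le hn hα₂ x hF).trans (lintegral_Ioi_indicator_Iio _ _ _).le
  have hI₃ := lintegral_radial_mul_le hn hα₃ x hF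
  have hm₁ : ∀ z, AEMeasurable fun y => α₁ (ballVol n * ‖z - y‖ ^ n) * F y := fun z =>
    (aemeasurable_radial hn hα₁ z).mul hF
  have hm₂ : AEMeasurable fun y => α₂ (ballVol n * ‖x - y‖ ^ n) * F y :=
    (aemeasurable_radial hn hα₂ x).mul hF
  have hm₃ : AEMeasurable fun y => α₃ (ballVol n * ‖x - y‖ ^ n) * F y :=
    (aemeasurable_radial hn hα₃ x).mul hF
  rw [h.fwdDiff_potential hn hf hfin]
  refine (enorm_integral_le_lintegral_enorm _).trans ?_
  calc ∫⁻ y, ‖(((fwdDiff v)^[k] (fun z => Φ ‖z‖) (x - y) : ℝ) : ℂ) * f y‖ₑ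
      ≤ ∫⁻ y, ((∑ j ∈ Finset.range (k + 1), (k.choose j : ℝ≥0∞) *
            (α₁ (ballVol n * ‖x + j • v - y‖ ^ n) * F y)) +
          ENNReal.ofReal C * (α₂ (ballVol n * ‖x - y‖ ^ n) * F y) +
          ENNReal.ofReal C * (ENNReal.ofReal (r ^ k) *
            (α₃ (ballVol n * ‖x - y‖ ^ n) * F y))) := by
        refine lintegral_mono_ae ?_
        have hae : ∀ᵐ y, ∀ j : ℕ, x + j • v - y ≠ 0 :=
          ae_all_iff.2 fun j => ae_sub_ne_zero hn _
        filter_upwards [hae] with y hy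
        have := hpt r v (x - y) hr hv fun j => by
          rw [sub_add_eq_add_sub]
          exact hy j
        rw [enorm_mul, ← ofReal_norm ((_ : ℝ) : ℂ), Complex.norm_real,
          ofReal_norm]
        refine (mul_le_mul_left this (F y)).trans_eq ?_
        rw [add_mul, add_mul, Finset.sum_mul]
        simp only [sub_add_eq_add_sub, @mul_assoc ℝ≥0∞ _]
        rfl
    _ = (∑ j ∈ Finset.range (k + 1), (k.choose j : ℝ≥0∞) *
            ∫⁻ y, α₁ (ballVol n * ‖x + j • v - y‖ ^ n) * F y) +
          ENNReal.ofReal C * (∫⁻ y, α₂ (ballVol n * ‖x - y‖ ^ n) * F y) +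
          ENNReal.ofReal C * (ENNReal.ofReal (r ^ k) *
            ∫⁻ y, α₃ (ballVol n * ‖x - y‖ ^ n) * F y) := by
        rw [lintegral_add_right' _ ((hm₃.const_mul _).const_mul _),
          lintegral_add_right' _ (hm₂.const_mul _),
          lintegral_finsetSum' _ (fun j _ => (hm₁ (x + j • v)).const_mul _),
          lintegral_const_mul'' _ hm₂, lintegral_const_mul'' _ (hm₃.const_mul _),
          lintegral_const_mul'' _ hm₃]
        congr 2
        exact Finset.sum_congr rfl fun j _ => lintegral_const_mul'' _ (hm₁ _)
    _ ≤ _ := by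
        gcongr
        calc _ ≤ ∑ j ∈ Finset.range (k + 1), (k.choose j : ℝ≥0∞) *
              ∫⁻ τ in Ioo 0 (ballVol n * (3 * k * r) ^ n), ephi n Φ τ * rearr volume F τ := by
              gcongr
              exact hI₁ _
          _ = _ := by
              rw [← Finset.sum_mul]
              congr 1
              rw [← Nat.cast_sum, Nat.sum_range_choose, ENNReal.ofReal_pow (by norm_num)]
              simp

end Potentials

/-! ### Estimates of potentials -/

section PotentialEstimates

variable {n k : ℕ} {Φ : ℝ → ℝ} {a₁ a₂ z₁ δ₁ : ℝ}

theorem AntitoneOn.mul_ennreal {α g : ℝ → ℝ≥0∞} {s : Set ℝ} (hα : AntitoneOn α s)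
    (hg : Antitone g) : AntitoneOn (fun τ => α τ * g τ) s :=
  fun _ ha _ hb hab => mul_le_mul' (hα ha hb hab) (hg hab)

/-- `∫₀^∞ φ g` is controlled by integrals over `(0,T)`. -/
theorem IsStandard.lintegral_ephi_mul_le (hΦ : IsStandard n Φ) {g : ℝ → ℝ≥0∞}
    (hg : Antitone g) {T : ℝ} (hT : 0 < T) :
    ∫⁻ τ in Ioi 0, ephi n Φ τ * g τ ≤ (∫⁻ τ in Ioo 0 T, ephi n Φ τ * g τ) +
      (∫⁻ τ in Ioi 0, ephi n Φ τ) * ((ENNReal.ofReal T)⁻¹ * ∫⁻ τ in Ioo 0 T, g τ) := by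
  refine (lintegral_Ioi_mul_le (aemeasurable_restrict_of_antitoneOn measurableSet_Ioi
    hΦ.ephi_antitoneOn) hg T).trans ?_
  gcongr
  exact le_inv_mul_lintegral hg hT

/-- This absorbs the far-field term. As $\varphi$ may vanish on part of $(0,T)$, one works on
$(0,\tau_2)$ with $\varphi(\tau_2)>0$, where $t^{k/n}$ is bounded by a multiple of $\Omega_\varphi$,
and monotonicity of $g$ extends the integral to $(0,T)$. -/
theorem IsStandard.exists_rpow_mul_lintegral_le (hΦ : IsStandard n Φ) (hn : 1 ≤ n) (k : ℕ)
    {T : ℝ} (hT : 0 < T) :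
    ∃ C : ℝ, ∀ g : ℝ → ℝ≥0∞, Antitone g → ∀ t ∈ Ioo 0 T,
      ENNReal.ofReal (t ^ ((k : ℝ) / n)) * ∫⁻ τ in Ioo 0 T, g τ ≤
        ENNReal.ofReal C * ∫⁻ τ in Ioo 0 T, ENNReal.ofReal (bigOmega n k Φ t τ) * g τ := by
  obtain ⟨τ₂, hτ₂, hτ₂T, hφ⟩ := hΦ.exists_phi_pos hn hT
  have hTp : 0 < T ^ ((k : ℝ) / n) := Real.rpow_pos_of_pos hT _
  refine ⟨max 1 (T / τ₂) * (2 * T ^ ((k : ℝ) / n) / phi n Φ τ₂), fun g hg t ht => ?_⟩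
  have h1 := lintegral_Ioo_le_of_antitoneOn (L := T) hτ₂ (hg.antitoneOn _)
  have h2 : ∀ τ ∈ Ioo 0 τ₂, ENNReal.ofReal (t ^ ((k : ℝ) / n)) * g τ ≤
      ENNReal.ofReal (2 * T ^ ((k : ℝ) / n) / phi n Φ τ₂) *
        (ENNReal.ofReal (bigOmega n k Φ t τ) * g τ) := by
    intro τ hτ
    have hΩ := hΦ.phi_mul_rpow_le_bigOmega (k := k) ht.1 ht.2.le hτ.1 (hτ.2.trans hτ₂T).le
    have hφτ : phi n Φ τ₂ ≤ phi n Φ τ := hΦ.phi_antitoneOn hτ.1 hτ₂ hτ.2.le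
    have htp : 0 < t ^ ((k : ℝ) / n) := Real.rpow_pos_of_pos ht.1 _
    rw [← mul_assoc, ← ENNReal.ofReal_mul (by positivity)]
    gcongr
    rw [div_mul_eq_mul_div, le_div_iff₀ hφ]
    exact (by gcongr : _ ≤ t ^ ((k : ℝ) / n) * phi n Φ τ).trans hΩ
  calc ENNReal.ofReal (t ^ ((k : ℝ) / n)) * ∫⁻ τ in Ioo 0 T, g τ
      ≤ ENNReal.ofReal (t ^ ((k : ℝ) / n)) *
          (ENNReal.ofReal (max 1 (T / τ₂)) * ∫⁻ τ in Ioo 0 τ₂, g τ) := by gcongr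
    _ = ENNReal.ofReal (max 1 (T / τ₂)) *
          ∫⁻ τ in Ioo 0 τ₂, ENNReal.ofReal (t ^ ((k : ℝ) / n)) * g τ := by
        rw [lintegral_const_mul' _ _ ENNReal.ofReal_ne_top]
        ring
    _ ≤ ENNReal.ofReal (max 1 (T / τ₂)) * ∫⁻ τ in Ioo 0 τ₂,
          ENNReal.ofReal (2 * T ^ ((k : ℝ) / n) / phi n Φ τ₂) *
            (ENNReal.ofReal (bigOmega n k Φ t τ) * g τ) :=
        mul_le_mul_right (setLIntegral_mono' measurableSet_Ioo h2) _
    _ ≤ ENNReal.ofReal (max 1 (T / τ₂)) * (ENNReal.ofReal (2 * T ^ ((k : ℝ) / n) / phi n Φ τ₂) *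
          ∫⁻ τ in Ioo 0 T, (ENNReal.ofReal (bigOmega n k Φ t τ) * g τ)) := by
        rw [lintegral_const_mul' _ _ ENNReal.ofReal_ne_top]
        exact mul_le_mul_right (mul_le_mul_right
          (lintegral_mono_set (Ioo_subset_Ioo_right hτ₂T.le)) _) _
    _ = _ := by rw [← mul_assoc, ← ENNReal.ofReal_mul (by positivity)]

/-- Monotonicity of $\varphi g$ reduces $(0,At)$ to $(0,t)$, where
$\varphi\le2\,\Omega_\varphi(t,\cdot)$. -/
theorem IsStandard.lintegral_Ioo_ephi_mul_le (hΦ : IsStandard n Φ) {g : ℝ → ℝ≥0∞}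
    (hg : Antitone g) {t T : ℝ} (ht : t ∈ Ioo 0 T) (A : ℝ) :
    ∫⁻ τ in Ioo 0 (A * t), ephi n Φ τ * g τ ≤ ENNReal.ofReal (max 1 A * 2) *
      ∫⁻ τ in Ioo 0 T, ENNReal.ofReal (bigOmega n k Φ t τ) * g τ := by
  have h1 := lintegral_Ioo_le_of_antitoneOn (L := A * t) ht.1
    ((AntitoneOn.mul_ennreal hΦ.ephi_antitoneOn hg).mono Ioo_subset_Ioi_self)
  rw [mul_div_cancel_right₀ _ ht.1.ne'] at h1
  refine h1.trans ?_
  rw [ENNReal.ofReal_mul (by positivity), mul_assoc]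
  refine mul_le_mul_right ?_ _
  rw [← lintegral_const_mul' _ _ ENNReal.ofReal_ne_top]
  refine le_trans ?_ (lintegral_mono_set (Ioo_subset_Ioo_right ht.2.le))
  refine setLIntegral_mono' measurableSet_Ioo fun τ hτ => ?_
  rw [← mul_assoc, ← ENNReal.ofReal_mul (by norm_num)]
  exact mul_le_mul_left (ENNReal.ofReal_le_ofReal (hΦ.phi_le_bigOmega hτ.1 hτ.2.le)) _

theorem IsStandard.lintegral_ephi_max_lt_top (hΦ : IsStandard n Φ) (hn : 1 ≤ n) (τ₁ : ℝ) :
    ∫⁻ τ in Ioi 0, ephi n Φ (max τ τ₁ / 2 ^ n) < ∞ := by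
  have h2 : (0 : ℝ) < (2 ^ n)⁻¹ := by positivity
  have h1 : IntegrableOn (fun τ : ℝ => phi n Φ ((2 ^ n)⁻¹ * τ)) (Ioi 0) := by
    rw [integrableOn_Ioi_comp_mul_left_iff _ _ h2, mul_zero]
    exact hΦ.integrableOn_phi hn
  refine lt_of_le_of_lt ?_ h1.lintegral_lt_top
  refine setLIntegral_mono' measurableSet_Ioi fun τ (hτ : 0 < τ) => ?_
  refine hΦ.ephi_antitoneOn (mem_Ioi.2 (by positivity)) (mem_Ioi.2 (by positivity)) ?_
  rw [inv_mul_eq_div]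
  gcongr
  exact le_max_left _ _

/-- `ω_k(G ∗ f; t^{1/n}) ≤ C ∫₀ᵀ Ω_φ(t,τ) f*(τ) dτ`. -/
theorem IsRegularKernel.exists_scaledModulus_le (h : IsRegularKernel n k Φ a₁ a₂ z₁ δ₁)
    {T : ℝ} (hT : 0 < T) :
    ∃ C : ℝ≥0∞, C ≠ ⊤ ∧ ∀ f : EuclideanSpace ℝ (Fin n) → ℂ, AEMeasurable f →
      ∫⁻ τ in Ioi 0, ephi n Φ τ * rearr volume (fun y => ‖f y‖ₑ) τ < ∞ →
      ∀ t ∈ Ioo 0 T, scaledModulus k (potential Φ f) t ≤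
        C * ∫⁻ τ in Ioo 0 T, ENNReal.ofReal (bigOmega n k Φ t τ) *
          rearr volume (fun y => ‖f y‖ₑ) τ := by
  have hn := h.one_le_n
  have hn0 : (n : ℝ) ≠ 0 := by positivity
  obtain ⟨C₁, C₂, τ₁, hτ₁, hmain⟩ := h.exists_enorm_fwdDiff_potential_le hT
  obtain ⟨C₃, hC₃⟩ := h.exists_rpow_mul_lintegral_le hn k hT
  -- The ball of radius $3kt^{1/n}$ has volume $At$.
  set A := ballVol n * (3 * k) ^ n with hA
  set K := ephi n Φ (τ₁ / 2 ^ n) +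
    (∫⁻ τ in Ioi 0, ephi n Φ (max τ τ₁ / 2 ^ n)) * (ENNReal.ofReal T)⁻¹ with hK
  have hKtop : K ≠ ⊤ := by
    refine ENNReal.add_ne_top.2 ⟨ENNReal.ofReal_ne_top, ENNReal.mul_ne_top
      (h.lintegral_ephi_max_lt_top hn τ₁).ne (ENNReal.inv_ne_top.2 (by simpa using hT))⟩
  refine ⟨ENNReal.ofReal C₁ * ENNReal.ofReal (max 1 A * 2) + ENNReal.ofReal C₂ +
    ENNReal.ofReal C₂ * (K * ENNReal.ofReal C₃), by finiteness, fun f hf hfin t ht => ?_⟩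
  set g := rearr volume (fun y => ‖f y‖ₑ)
  have hg : Antitone g := rearr_antitone _
  set I := ∫⁻ τ in Ioo 0 T, ENNReal.ofReal (bigOmega n k Φ t τ) * g τ
  set r := t ^ (1 / (n : ℝ)) with hr
  have hr0 : 0 < r := Real.rpow_pos_of_pos ht.1 _
  have hrn : r ^ n = t := by
    rw [hr, one_div, Real.rpow_inv_natCast_pow ht.1.le (by omega)]
  have hrk : r ^ k = t ^ ((k : ℝ) / n) := by
    rw [hr, ← Real.rpow_natCast, ← Real.rpow_mul ht.1.le]
    congr 1
    ring
  -- On $(0,T)$ the weight is bounded; beyond $T$ it is integrable and $g\le g(T)\le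
  -- T^{-1}\int_0^Tg$. Thus only $t^{k/n}\int_0^Tg$ remains.
  have hb3 : ENNReal.ofReal (r ^ k) * ∫⁻ τ in Ioi 0, ephi n Φ (max τ τ₁ / 2 ^ n) * g τ ≤
      K * (ENNReal.ofReal C₃ * I) := by
    have hanti := h.ephi_max_antitoneOn hτ₁
    have e1 := lintegral_Ioi_mul_le hanti.measurable.aemeasurable hg T
    have e2 : ∫⁻ τ in Ioo 0 T, ephi n Φ (max τ τ₁ / 2 ^ n) * g τ ≤
        ephi n Φ (τ₁ / 2 ^ n) * ∫⁻ τ in Ioo 0 T, g τ := by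
      rw [← lintegral_const_mul' (ephi n Φ (τ₁ / 2 ^ n)) _ ENNReal.ofReal_ne_top]
      refine lintegral_mono fun τ => mul_le_mul_left ?_ _
      exact h.ephi_antitoneOn (mem_Ioi.2 (by positivity)) (mem_Ioi.2
        (div_pos (lt_max_of_lt_right hτ₁) (by positivity))) (by gcongr; exact le_max_right _ _)
    calc _ ≤ ENNReal.ofReal (r ^ k) * (K * ∫⁻ τ in Ioo 0 T, g τ) := by
          refine mul_le_mul_right (e1.trans ?_) _
          rw [hK, add_mul, mul_assoc]
          exact add_le_add e2 (mul_le_mul_right (le_inv_mul_lintegral hg hT) _)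
      _ = K * (ENNReal.ofReal (r ^ k) * ∫⁻ τ in Ioo 0 T, g τ) := by ring
      _ ≤ _ := by
          rw [hrk]
          exact mul_le_mul_right (hC₃ g hg t ht) _
  have hb1 : ∫⁻ τ in Ioo 0 (ballVol n * (3 * k * r) ^ n), ephi n Φ τ * g τ ≤
      ENNReal.ofReal (max 1 A * 2) * I := by
    rw [mul_pow, hrn, ← mul_assoc, ← hA]
    exact h.lintegral_Ioo_ephi_mul_le hg ht A
  refine iSup₂_le fun v hv => iSup_le fun x => ?_
  refine (hmain f hf hfin r v x hr0 hv).trans ?_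
  rw [hrn, add_mul, add_mul]
  refine add_le_add (add_le_add ?_ le_rfl) ?_
  · rw [@mul_assoc ℝ≥0∞ _]
    exact mul_le_mul_right hb1 _
  · rw [@mul_assoc ℝ≥0∞ _, @mul_assoc ℝ≥0∞ _]
    exact mul_le_mul_right hb3 _

/-- Bounds for the integrals controlling a potential of a function in `E`. -/
theorem IsStandard.exists_lintegral_ephi_rearr_le (hΦ : IsStandard n Φ) (hn : 1 ≤ n) (E : RIS n)
    {T : ℝ} (hT : 0 < T)
    (hφ : assocNormOn E T (fun τ => ENNReal.ofReal (phi n Φ τ)) < ∞) :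
    ∃ C : ℝ≥0∞, C ≠ ⊤ ∧ ∀ f : EuclideanSpace ℝ (Fin n) → ℂ, E.MemComplex f →
      ∫⁻ τ in Ioi 0, ephi n Φ τ * rearr volume (fun y => ‖f y‖ₑ) τ ≤
        C * E.toFun (fun y => ‖f y‖ₑ) := by
  obtain ⟨C, hC⟩ := E.exists_lintegral_rearr_le hn hT.le
  have hTi : (ENNReal.ofReal T)⁻¹ ≠ ⊤ := ENNReal.inv_ne_top.2 (by simpa using hT)
  have hφ1 := (hΦ.lintegral_ephi_lt_top hn).ne
  refine ⟨assocNormOn E T (ephi n Φ) +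
    (∫⁻ τ in Ioi 0, ephi n Φ τ) * ((ENNReal.ofReal T)⁻¹ * C), ?_, fun f hf => ?_⟩
  · exact ENNReal.add_ne_top.2 ⟨hφ.ne, by finiteness⟩
  -- On $(0,T)$ Hölder's inequality with $\varphi\in\widetilde E'(0,T)$ applies. The tail uses only
  -- $\int_0^\infty\varphi<\infty$ and (P4) for $E$.
  refine (hΦ.lintegral_ephi_mul_le (rearr_antitone _) hT).trans ?_
  rw [add_mul, mul_assoc, mul_assoc]
  refine add_le_add ?_ (mul_le_mul_right (mul_le_mul_right (hC _ hf.1.enorm) _) _)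
  refine lintegral_mul_rearr_le_assocNormOn hn E
    (hΦ.ephi_antitoneOn.mono Ioo_subset_Ioi_self) ?_ hf.1.enorm hf.2
  exact ENNReal.continuous_ofReal.comp_continuousOn (hΦ.phi_continuousOn.mono Ioo_subset_Ioi_self)

end PotentialEstimates

/-! ### Uniform continuity of potentials -/

section UniformContinuity

variable {n : ℕ} {Φ : ℝ → ℝ}

/-- A continuous truncation of `φ` with bounded support. -/
noncomputable def phiTrunc (n : ℕ) (Φ : ℝ → ℝ) (ε R τ : ℝ) : ℝ :=
  max (phi n Φ (max τ ε) - phi n Φ R) 0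

theorem IsStandard.phiTrunc_continuous (hΦ : IsStandard n Φ) {ε R : ℝ} (hε : 0 < ε) :
    Continuous (phiTrunc n Φ ε R) := by
  refine Continuous.max (Continuous.sub ?_ continuous_const) continuous_const
  exact hΦ.phi_continuousOn.comp_continuous (by fun_prop) fun τ => lt_max_of_lt_right hε

theorem IsStandard.phiTrunc_eq_zero (hΦ : IsStandard n Φ) {ε R τ : ℝ} (hR : 0 < R) (h : R ≤ τ) :
    phiTrunc n Φ ε R τ = 0 := by
  refine max_eq_right (sub_nonpos.2 ?_)
  have h1 : R ≤ max τ ε := h.trans (le_max_left _ _)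
  exact hΦ.phi_antitoneOn hR (hR.trans_le h1) h1

theorem IsStandard.phiTrunc_le (hΦ : IsStandard n Φ) {ε R τ : ℝ} (hR : 0 < R) (hτ : 0 < τ) :
    phiTrunc n Φ ε R τ ≤ phi n Φ τ := by
  refine max_le ?_ (hΦ.phi_nonneg hτ)
  have h1 := hΦ.phi_nonneg hR
  have h2 := hΦ.phi_antitoneOn hτ (mem_Ioi.2 (lt_max_of_lt_left hτ)) (le_max_left τ ε)
  linarith

/-- The truncation error must be nonincreasing for the Hardy-Littlewood inequality to apply to it.
The truncation decreases no faster than $\varphi(\max(\tau,\varepsilon))$, which decreases no faster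
than $\varphi$. -/
theorem IsStandard.phi_sub_phiTrunc_antitoneOn (hΦ : IsStandard n Φ) {ε R : ℝ} (hε : 0 < ε) :
    AntitoneOn (fun τ => phi n Φ τ - phiTrunc n Φ ε R τ) (Ioi 0) := by
  intro a ha b hb hab
  have h1 : phiTrunc n Φ ε R a - phiTrunc n Φ ε R b ≤
      phi n Φ (max a ε) - phi n Φ (max b ε) := by
    have h0 : phi n Φ (max b ε) ≤ phi n Φ (max a ε) :=
      hΦ.phi_antitoneOn (lt_max_of_lt_right hε) (mem_Ioi.2 (lt_max_of_lt_right hε)) (by gcongr)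
    unfold phiTrunc
    rcases max_cases (phi n Φ (max a ε) - phi n Φ R) 0 with h | h <;>
      rcases max_cases (phi n Φ (max b ε) - phi n Φ R) 0 with h' | h' <;> linarith
  have h2 : phi n Φ (max a ε) - phi n Φ (max b ε) ≤ phi n Φ a - phi n Φ b := by
    rcases le_total b ε with hbε | hbε
    · rw [max_eq_right hbε, max_eq_right (hab.trans hbε), sub_self]
      exact sub_nonneg.2 (hΦ.phi_antitoneOn ha hb hab)
    · rw [max_eq_left hbε]
      have := hΦ.phi_antitoneOn ha (mem_Ioi.2 (lt_max_of_lt_left ha)) (le_max_left a ε)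
      linarith
  simp only
  linarith

theorem phi_sub_phiTrunc_le (n : ℕ) (Φ : ℝ → ℝ) {ε R τ : ℝ} (h : ε ≤ τ) :
    phi n Φ τ - phiTrunc n Φ ε R τ ≤ phi n Φ R := by
  unfold phiTrunc
  rw [max_eq_left h]
  linarith [le_max_left (phi n Φ τ - phi n Φ R) 0]

/-- Monotonicity and integrability give $\tau\varphi(\tau)\le\int_0^\infty\varphi$. -/
theorem IsStandard.tendsto_ephi (hΦ : IsStandard n Φ) (hn : 1 ≤ n) :
    Filter.Tendsto (fun m : ℕ => ephi n Φ ((m : ℝ) + 1)) Filter.atTop (nhds 0) := by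
  have hI := (hΦ.lintegral_ephi_lt_top hn).ne
  have hle : ∀ m : ℕ, ephi n Φ ((m : ℝ) + 1) ≤
      (ENNReal.ofReal ((m : ℝ) + 1))⁻¹ * ∫⁻ τ in Ioi 0, ephi n Φ τ := by
    intro m
    have hm : (0 : ℝ) < (m : ℝ) + 1 := by positivity
    have h1 := le_inv_mul_lintegral (topExtend_antitone hΦ.ephi_antitoneOn) hm
    have h2 : ∫⁻ τ in Ioo 0 ((m : ℝ) + 1), topExtend (ephi n Φ) τ =
        ∫⁻ τ in Ioo 0 ((m : ℝ) + 1), ephi n Φ τ :=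
      setLIntegral_congr_fun measurableSet_Ioo fun τ hτ => by simp [topExtend, not_le.2 hτ.1]
    refine (le_topExtend _ _).trans (h1.trans ?_)
    rw [h2]
    exact mul_le_mul_right (lintegral_mono_set Ioo_subset_Ioi_self) _
  refine tendsto_of_tendsto_of_tendsto_of_le_of_le tendsto_const_nhds ?_ (fun _ => zero_le) hle
  have h3 : Filter.Tendsto (fun m : ℕ => (ENNReal.ofReal ((m : ℝ) + 1))⁻¹) Filter.atTop (nhds 0) := by
    refine tendsto_inv_iff.1 ?_
    simp only [inv_inv, ENNReal.inv_zero]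
    exact ENNReal.tendsto_ofReal_atTop.comp
      (Filter.tendsto_atTop_add_const_right _ _ tendsto_natCast_atTop_atTop)
  simpa using ENNReal.Tendsto.mul_const h3 (Or.inr hI)

/-- Dominated convergence with majorant $\varphi g$: once the cut-off $\varepsilon$ is below $\tau$,
the error at $\tau$ is at most $\varphi(R)$, which tends to $0$. -/
theorem IsStandard.tendsto_lintegral_phi_sub_phiTrunc (hΦ : IsStandard n Φ) (hn : 1 ≤ n)
    {g : ℝ → ℝ≥0∞} (hg : Antitone g) (hgfin : ∀ τ, 0 < τ → g τ < ∞)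
    (hfin : ∫⁻ τ in Ioi 0, ephi n Φ τ * g τ < ∞) :
    Filter.Tendsto (fun m : ℕ => ∫⁻ τ in Ioi 0, ENNReal.ofReal
      (phi n Φ τ - phiTrunc n Φ (1 / ((m : ℝ) + 1)) ((m : ℝ) + 1) τ) * g τ)
      Filter.atTop (nhds 0) := by
  have key := tendsto_lintegral_of_dominated_convergence' (μ := volume.restrict (Ioi (0 : ℝ)))
    (F := fun (m : ℕ) τ => ENNReal.ofReal
      (phi n Φ τ - phiTrunc n Φ (1 / ((m : ℝ) + 1)) ((m : ℝ) + 1) τ) * g τ)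
    (f := fun _ => 0) (fun τ => ephi n Φ τ * g τ) (fun m => ?_) (fun m => ?_) hfin.ne ?_
  · simpa using key
  · refine AEMeasurable.mul (aemeasurable_restrict_of_antitoneOn measurableSet_Ioi ?_)
      hg.measurable.aemeasurable
    exact fun a ha b hb hab => ENNReal.ofReal_le_ofReal
      (hΦ.phi_sub_phiTrunc_antitoneOn (by positivity) ha hb hab)
  · refine Filter.Eventually.of_forall fun τ => mul_le_mul_left (ENNReal.ofReal_le_ofReal ?_) _
    exact sub_le_self _ (le_max_right _ _)
  · filter_upwards [ae_restrict_mem measurableSet_Ioi] with τ (hτ : 0 < τ)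
    have h1 : Filter.Tendsto (fun m : ℕ => ephi n Φ ((m : ℝ) + 1) * g τ) Filter.atTop (nhds 0) := by
      simpa using ENNReal.Tendsto.mul_const (hΦ.tendsto_ephi hn) (Or.inr (hgfin τ hτ).ne)
    refine tendsto_of_tendsto_of_tendsto_of_le_of_le' tendsto_const_nhds h1
      (Filter.Eventually.of_forall fun _ => zero_le) ?_
    have h2 := tendsto_one_div_add_atTop_nhds_zero_nat (𝕜 := ℝ)
    filter_upwards [h2.eventually_lt_const hτ] with m hm
    exact mul_le_mul_left (ENNReal.ofReal_le_ofReal (phi_sub_phiTrunc_le n Φ hm.le)) _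

/-- Convolution with a compactly supported continuous kernel. -/
theorem uniformContinuous_integral_mul (hn : 1 ≤ n) {b : EuclideanSpace ℝ (Fin n) → ℂ}
    (hb : Continuous b) {R : ℝ} (hsupp : ∀ w, R ≤ ‖w‖ → b w = 0)
    {f : EuclideanSpace ℝ (Fin n) → ℂ} (hf : AEMeasurable f)
    (hint : ∀ x, Integrable fun y => b (x - y) * f y)
    (hfin : ∀ L : ℝ, ∫⁻ τ in Ioo 0 L, rearr volume (fun y => ‖f y‖ₑ) τ < ∞) :
    UniformContinuous fun x => ∫ y, b (x - y) * f y := by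
  have huc : UniformContinuous b := by
    refine hb.uniformContinuous_of_tendsto_cocompact (HasCompactSupport.is_zero_at_infty (.intro
      (isCompact_closedBall (0 : EuclideanSpace ℝ (Fin n)) R) fun w hw => hsupp w ?_))
    rw [mem_closedBall_zero_iff, not_le] at hw
    exact hw.le
  -- For $|x-x'|<1$ the ball of radius $R+1$ about $x$ contains the supports of both translated
  -- kernels, and `M` bounds the integral of $|f|$ over it.
  set L := ballVol n * (R + 1) ^ n
  set M := ∫⁻ τ in Ioo 0 L, rearr volume (fun y => ‖f y‖ₑ) τ with hM
  have hMtop : M ≠ ⊤ := (hfin L).ne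
  rw [EMetric.uniformContinuous_iff] at huc ⊢
  intro ε hε
  obtain ⟨η, hη, hηtop, hηε⟩ : ∃ η : ℝ≥0∞, 0 < η ∧ η ≠ ⊤ ∧ η * M < ε := by
    obtain ⟨η, hη, hlt⟩ := ENNReal.exists_nnreal_pos_mul_lt hMtop hε.ne'
    exact ⟨η, by exact_mod_cast hη, ENNReal.coe_ne_top, hlt⟩
  obtain ⟨δ, hδ, hδη⟩ := huc η hη
  refine ⟨min δ 1, lt_min hδ one_pos, fun {x x'} hxx => ?_⟩
  have hδ' : edist x x' < δ := hxx.trans_le (min_le_left _ _)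
  have h1' : ‖x - x'‖ < 1 := by
    have := hxx.trans_le (min_le_right _ _)
    rw [edist_eq_enorm_sub, ← ofReal_norm, ENNReal.ofReal_lt_one] at this
    exact this
  rw [edist_eq_enorm_sub, ← integral_sub (hint x) (hint x')]
  refine lt_of_le_of_lt ?_ hηε
  refine (enorm_integral_le_lintegral_enorm _).trans ?_
  have hrad := lintegral_radial_mul_le hn (α := (Iio L).indicator 1)
    (antitoneOn_indicator_Iio (fun _ _ _ _ _ => le_rfl) L) x hf.enorm
  rw [lintegral_Ioi_indicator_Iio] at hrad
  simp only [Pi.one_apply, one_mul] at hrad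
  rw [← hM] at hrad
  calc ∫⁻ y, ‖b (x - y) * f y - b (x' - y) * f y‖ₑ
      ≤ ∫⁻ y, η * ((Iio L).indicator 1 (ballVol n * ‖x - y‖ ^ n) * ‖f y‖ₑ) := by
        refine lintegral_mono fun y => ?_
        rw [← sub_mul, enorm_mul, ← mul_assoc]
        refine mul_le_mul_left ?_ _
        by_cases hy : ‖x - y‖ < R + 1
        · rw [indicator_of_mem]
          · have := hδη (a := x - y) (b := x' - y) (by rwa [edist_sub_right])
            rw [edist_eq_enorm_sub] at this
            simpa using this.le
          · rw [mem_Iio]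
            exact mul_lt_mul_of_pos_left (pow_lt_pow_left₀ hy (norm_nonneg _) (by omega))
              (ballVol_pos n)
        · rw [not_lt] at hy
          have h2 : R ≤ ‖x' - y‖ := by
            have h3 : x - y = (x - x') + (x' - y) := by abel
            have h4 := norm_add_le (x - x') (x' - y)
            rw [← h3] at h4
            linarith
          rw [hsupp _ (by linarith), hsupp _ h2]
          simp
    _ ≤ η * M := by
        rw [lintegral_const_mul' _ _ hηtop]
        exact mul_le_mul_right hrad _

/-- The potential is a uniform limit of convolutions with continuous compactly supported kernels;
the error is uniform in $x$ since its Hardy-Littlewood bound involves only $f^*$. -/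
theorem IsStandard.uniformContinuous_potential (hΦ : IsStandard n Φ) (hn : 1 ≤ n)
    {f : EuclideanSpace ℝ (Fin n) → ℂ} (hf : AEMeasurable f)
    (hfin : ∫⁻ τ in Ioi 0, ephi n Φ τ * rearr volume (fun y => ‖f y‖ₑ) τ < ∞)
    {T : ℝ} (hT : 0 < T) (hfinT : ∫⁻ τ in Ioo 0 T, rearr volume (fun y => ‖f y‖ₑ) τ < ∞) :
    UniformContinuous (potential Φ f) := by
  set g := rearr volume (fun y => ‖f y‖ₑ) with hgdef
  have hg : Antitone g := rearr_antitone _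
  have hgL : ∀ L : ℝ, ∫⁻ τ in Ioo 0 L, g τ < ∞ := fun L =>
    (lintegral_Ioo_le_of_antitoneOn hT (hg.antitoneOn _)).trans_lt
      (ENNReal.mul_lt_top ENNReal.ofReal_lt_top hfinT)
  have hlim := hΦ.tendsto_lintegral_phi_sub_phiTrunc hn hg
    (fun τ hτ => lt_top_of_lintegral_lt_top hg hT hfinT hτ) hfin
  rw [EMetric.uniformContinuous_iff]
  intro ε hε
  have hε3 : 0 < ε / 3 := ENNReal.div_pos hε.ne' (by simp)
  obtain ⟨m, hm⟩ := (hlim.eventually_lt_const hε3).exists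
  set ρ : ℝ := 1 / ((m : ℝ) + 1)
  set R : ℝ := (m : ℝ) + 1
  have hρ : 0 < ρ := by positivity
  have hR : 0 < R := by positivity
  set b : EuclideanSpace ℝ (Fin n) → ℂ := fun w => (phiTrunc n Φ ρ R (ballVol n * ‖w‖ ^ n) : ℂ)
  have hbc : Continuous b :=
    Complex.continuous_ofReal.comp ((hΦ.phiTrunc_continuous hρ).comp (by fun_prop))
  have hb0 : ∀ τ, 0 ≤ phiTrunc n Φ ρ R τ := fun τ => le_max_right _ _
  have hint : ∀ x, Integrable fun y => b (x - y) * f y := by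
    intro x
    refine ⟨AEMeasurable.aestronglyMeasurable (AEMeasurable.mul
      (hbc.measurable.comp (by fun_prop)).aemeasurable hf), ?_⟩
    refine (lintegral_kernel_mul_le hn hΦ.ephi_antitoneOn (fun w hw => ?_) hf x).trans_lt hfin
    rw [← ofReal_norm, Complex.norm_real, Real.norm_of_nonneg (hb0 _)]
    exact ENNReal.ofReal_le_ofReal (hΦ.phiTrunc_le hR (volVar_pos hw))
  have huc := uniformContinuous_integral_mul hn hbc (R := volRadius n R) (fun w hw => by
    have h1 : R ≤ ballVol n * ‖w‖ ^ n :=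
      not_lt.1 fun hlt => not_lt.2 hw ((ballVol_mul_pow_lt_iff hn (norm_nonneg w) hR.le).1 hlt)
    simp [b, hΦ.phiTrunc_eq_zero hR h1]) hf hint hgL
  have happrox : ∀ x, edist (potential Φ f x) (∫ y, b (x - y) * f y) < ε / 3 := by
    intro x
    rw [edist_eq_enorm_sub, potential, ← integral_sub (hΦ.integrable_kernel_mul hn hf hfin x)
      (hint x)]
    refine lt_of_le_of_lt ((enorm_integral_le_lintegral_enorm _).trans ?_) hm
    simp_rw [← sub_mul]
    refine lintegral_kernel_mul_le hn (b := fun w => (Φ ‖w‖ : ℂ) - b w)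
      (fun a ha c hc hac => ENNReal.ofReal_le_ofReal
        (hΦ.phi_sub_phiTrunc_antitoneOn hρ ha hc hac)) (fun w hw => ?_) hf x
    rw [← Complex.ofReal_sub, ← ofReal_norm, Complex.norm_real, Real.norm_of_nonneg,
      ← phi_ballVol hn Φ (norm_nonneg w)]
    rw [← phi_ballVol hn Φ (norm_nonneg w)]
    exact sub_nonneg.2 (hΦ.phiTrunc_le hR (volVar_pos hw))
  rw [EMetric.uniformContinuous_iff] at huc
  obtain ⟨δ, hδ, hδε⟩ := huc (ε / 3) hε3
  refine ⟨δ, hδ, fun {x x'} hxx => ?_⟩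
  have h1 := hδε hxx
  have h2 := happrox x
  have h3 := happrox x'
  rw [edist_comm] at h3
  calc edist (potential Φ f x) (potential Φ f x')
      ≤ edist (potential Φ f x) (∫ y, b (x - y) * f y) +
          edist (∫ y, b (x - y) * f y) (∫ y, b (x' - y) * f y) +
          edist (∫ y, b (x' - y) * f y) (potential Φ f x') := edist_triangle4 _ _ _ _
    _ < ε / 3 + ε / 3 + ε / 3 := ENNReal.add_lt_add (ENNReal.add_lt_add h2 h1) h3
    _ = ε := ENNReal.add_thirds ε

end UniformContinuity

/-! ### Potentials with large moduli of smoothness -/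

section LowerEstimate

variable {n k : ℕ} {Φ : ℝ → ℝ} {a₁ a₂ z₁ δ₁ : ℝ}

open scoped RealInnerProductSpace

theorem antitoneOn_indicator_Ioo {σ : ℝ → ℝ≥0∞} {T : ℝ} (hσ : AntitoneOn σ (Ioo 0 T)) :
    AntitoneOn ((Ioo 0 T).indicator σ) (Ioi 0) := by
  intro a ha b hb hab
  by_cases hbT : b < T
  · rw [indicator_of_mem (show b ∈ Ioo 0 T from ⟨hb, hbT⟩),
      indicator_of_mem (show a ∈ Ioo 0 T from ⟨ha, hab.trans_lt hbT⟩)]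
    exact hσ ⟨ha, hab.trans_lt hbT⟩ ⟨hb, hbT⟩ hab
  · rw [indicator_of_notMem (show b ∉ Ioo 0 T from fun h => hbT h.2)]
    exact zero_le

/-- Functions of `Ẽ₀(0,T)` are finite. -/
theorem topExtend_lt_top_of_luxNormOn_lt_top (hn : 1 ≤ n) (E : RIS n) {T : ℝ} (hT : 0 < T)
    {σ : ℝ → ℝ≥0∞} (hσ : AntitoneOn σ (Ioo 0 T)) (hσE : luxNormOn E T σ < ∞) {τ : ℝ}
    (hτ : 0 < τ) : topExtend ((Ioo 0 T).indicator σ) τ < ∞ := by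
  have hanti := topExtend_antitone (antitoneOn_indicator_Ioo hσ)
  have hmeas : AEMeasurable fun x : EuclideanSpace ℝ (Fin n) =>
      topExtend ((Ioo 0 T).indicator σ) (ballVol n * ‖x‖ ^ n) :=
    (hanti.measurable.comp (by fun_prop)).aemeasurable
  have h1 := E.toFun_le_luxNorm hn (antitoneOn_indicator_Ioo hσ) hmeas (by
    filter_upwards [ae_sub_ne_zero hn 0] with x hx
    simp only [zero_sub, ne_eq, neg_eq_zero] at hx
    simp [topExtend, not_le.2 (volVar_pos hx)])
  obtain ⟨C, hC⟩ := E.lintegral_le' (Metric.ball 0 (volRadius n T)) measurableSet_ball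
    measure_ball_lt_top
  refine lt_top_of_lintegral_lt_top hanti hT ?_ hτ
  rw [← lintegral_comp_volVar hn hanti.measurable hT.le]
  exact (hC _ hmeas).trans_lt (ENNReal.mul_lt_top ENNReal.coe_lt_top (h1.trans_lt hσE))

/-- For `σ ∈ Ẽ₀(0,T)`, the function `σ(V_n |x|^n)` restricted to a subset of a ball. -/
noncomputable def coneProfile (T : ℝ) (σ : ℝ → ℝ≥0∞) (S : Set (EuclideanSpace ℝ (Fin n))) :
    EuclideanSpace ℝ (Fin n) → ℝ :=
  S.indicator fun y => (topExtend ((Ioo 0 T).indicator σ) (ballVol n * ‖y‖ ^ n)).toReal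

theorem coneProfile_nonneg (T : ℝ) (σ : ℝ → ℝ≥0∞) (S : Set (EuclideanSpace ℝ (Fin n)))
    (y : EuclideanSpace ℝ (Fin n)) : 0 ≤ coneProfile T σ S y :=
  indicator_nonneg (fun _ _ => ENNReal.toReal_nonneg) y

theorem measurable_coneProfile {T : ℝ} {σ : ℝ → ℝ≥0∞} (hσ : AntitoneOn σ (Ioo 0 T))
    {S : Set (EuclideanSpace ℝ (Fin n))} (hS : MeasurableSet S) :
    Measurable (coneProfile T σ S) :=
  (((topExtend_antitone (antitoneOn_indicator_Ioo hσ)).measurable.comp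
    (by fun_prop)).ennreal_toReal).indicator hS

theorem toFun_coneProfile_le (hn : 1 ≤ n) (E : RIS n) {T : ℝ} {σ : ℝ → ℝ≥0∞}
    (hσ : AntitoneOn σ (Ioo 0 T)) {S : Set (EuclideanSpace ℝ (Fin n))} (hS : MeasurableSet S) :
    E.toFun (fun y => ‖(coneProfile T σ S y : ℂ)‖ₑ) ≤ luxNormOn E T σ := by
  refine E.toFun_le_luxNorm hn (antitoneOn_indicator_Ioo hσ)
    (Complex.measurable_ofReal.comp (measurable_coneProfile hσ hS)).enorm.aemeasurable ?_
  filter_upwards [ae_sub_ne_zero hn 0] with x hx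
  simp only [zero_sub, ne_eq, neg_eq_zero] at hx
  rw [← ofReal_norm, Complex.norm_real, Real.norm_of_nonneg (coneProfile_nonneg _ _ _ _),
    coneProfile]
  by_cases h : x ∈ S
  · rw [indicator_of_mem h]
    refine ENNReal.ofReal_toReal_le.trans_eq ?_
    simp [topExtend, not_le.2 (volVar_pos hx)]
  · simp [indicator_of_notMem h]

theorem exists_unit_vector (hn : 1 ≤ n) : ∃ e : EuclideanSpace ℝ (Fin n), ‖e‖ = 1 :=
  ⟨EuclideanSpace.single ⟨0, by omega⟩ 1, by simp⟩

/-- The intersection of the cone `{y : c|y| < ⟨-y,e⟩}` with a ball. -/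
def coneBall (c : ℝ) (e : EuclideanSpace ℝ (Fin n)) (r : ℝ) : Set (EuclideanSpace ℝ (Fin n)) :=
  {y | c * ‖y‖ < ⟪-y, e⟫} ∩ Metric.ball 0 r

theorem isOpen_cone (c : ℝ) (e : EuclideanSpace ℝ (Fin n)) : IsOpen {y | c * ‖y‖ < ⟪-y, e⟫} :=
  isOpen_lt (by fun_prop) (by fun_prop)

theorem measurableSet_coneBall (c : ℝ) (e : EuclideanSpace ℝ (Fin n)) (r : ℝ) :
    MeasurableSet (coneBall c e r) :=
  (isOpen_cone c e).measurableSet.inter measurableSet_ball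

/-- Polar coordinates in the cone. -/
theorem exists_setLIntegral_coneBall (hn : 1 ≤ n) {c : ℝ} (hc : c < 1)
    {e : EuclideanSpace ℝ (Fin n)} (he : ‖e‖ = 1) :
    ∃ κ : ℝ≥0∞, κ ≠ 0 ∧ κ ≠ ⊤ ∧ ∀ (ψ : ℝ → ℝ≥0∞) (τ₀ : ℝ), Measurable ψ → 0 ≤ τ₀ →
      ∫⁻ y in coneBall c e (volRadius n τ₀), ψ (ballVol n * ‖y‖ ^ n) =
        κ * ∫⁻ τ in Ioo 0 τ₀, ψ τ := by
  have hb0 : volume (Metric.ball (0 : EuclideanSpace ℝ (Fin n)) 1) ≠ 0 :=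
    (Metric.measure_ball_pos _ _ one_pos).ne'
  have hbt : volume (Metric.ball (0 : EuclideanSpace ℝ (Fin n)) 1) ≠ ⊤ := measure_ball_lt_top.ne
  set S : Set (EuclideanSpace ℝ (Fin n)) := {y | c * ‖y‖ < ⟪-y, e⟫} with hS
  have hcone : ∀ r : ℝ, 0 < r → ∀ x, r • x ∈ S ↔ x ∈ S := by
    intro r hr x
    simp only [hS, mem_ofPred_eq]
    rw [norm_smul, Real.norm_of_nonneg hr.le, ← smul_neg, real_inner_smul_left, mul_left_comm,
      mul_lt_mul_iff_right₀ hr]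
  have hmap := map_volume_restrict_cone hn hcone
  refine ⟨volume (Metric.ball 0 1 ∩ S) / volume (Metric.ball (0 : EuclideanSpace ℝ (Fin n)) 1),
    ?_, (ENNReal.div_lt_top (measure_inter_lt_top_of_left_ne_top hbt).ne hb0).ne, ?_⟩
  · refine (ENNReal.div_pos (ne_of_gt ?_) hbt).ne'
    -- The slice is open and, as $c<1$, contains $-e/2$; this makes the constant $\kappa$ nonzero.
    refine (Metric.isOpen_ball.inter (isOpen_cone c e)).measure_pos _ ⟨-((1 / 2 : ℝ) • e), ?_, ?_⟩
    · rw [mem_ball_zero_iff, norm_neg, norm_smul, he]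
      norm_num
    · simp only [mem_ofPred_eq]
      rw [neg_neg, real_inner_smul_left, real_inner_self_eq_norm_sq, norm_neg, norm_smul, he]
      norm_num
      linarith
  · intro ψ τ₀ hψ hτ₀
    have hmv : Measurable fun x : EuclideanSpace ℝ (Fin n) => ballVol n * ‖x‖ ^ n := by fun_prop
    have h2 : ∫⁻ τ in Ioo 0 τ₀, ψ τ = ∫⁻ τ in Ioi 0, (Iio τ₀).indicator ψ τ := by
      rw [lintegral_indicator measurableSet_Iio, Measure.restrict_restrict measurableSet_Iio,
        inter_comm, Ioi_inter_Iio]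
    rw [h2, ← smul_eq_mul, ← lintegral_smul_measure, ← hmap,
      lintegral_map (hψ.indicator measurableSet_Iio) hmv, coneBall, inter_comm,
      ← Measure.restrict_restrict measurableSet_ball, ← lintegral_indicator measurableSet_ball]
    refine lintegral_congr fun x => ?_
    simp only [indicator, mem_ball_zero_iff, mem_Iio,
      ballVol_mul_pow_lt_iff hn (norm_nonneg x) hτ₀]

/-- With an integrand of constant sign the modulus of the integral loses nothing; the difference is
evaluated at the vertex $0$ of the cone. -/
theorem IsStandard.enorm_fwdDiff_potential_ge (hΦ : IsStandard n Φ) (hn : 1 ≤ n)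
    {F : EuclideanSpace ℝ (Fin n) → ℝ} (hF : Measurable F)
    (hfin : ∫⁻ τ in Ioi 0, ephi n Φ τ * rearr volume (fun y => ‖(F y : ℂ)‖ₑ) τ < ∞)
    (h : EuclideanSpace ℝ (Fin n))
    (hpos : ∀ y, 0 ≤ (-1) ^ k * (fwdDiff h)^[k] (fun z => Φ ‖z‖) (-y) * F y) :
    ∫⁻ y, ENNReal.ofReal ((-1) ^ k * (fwdDiff h)^[k] (fun z => Φ ‖z‖) (-y) * F y) ≤
      ‖(fwdDiff h)^[k] (potential Φ fun y => (F y : ℂ)) 0‖ₑ := by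
  have hFm : AEMeasurable fun y => (F y : ℂ) := (Complex.measurable_ofReal.comp hF).aemeasurable
  have hint := (hΦ.integrable_fwdDiff_kernel_mul hn hFm hfin k h 0).re.const_mul ((-1 : ℝ) ^ k)
  have he : (fun y => (-1 : ℝ) ^ k * RCLike.re
      ((((fwdDiff h)^[k] (fun z => Φ ‖z‖) (0 - y) : ℝ) : ℂ) * (F y : ℂ))) =
      fun y => (-1) ^ k * (fwdDiff h)^[k] (fun z => Φ ‖z‖) (-y) * F y := by
    funext y
    rw [← Complex.ofReal_mul, zero_sub, mul_assoc]
    simp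
  rw [he] at hint
  rw [← ofReal_integral_eq_lintegral_ofReal hint (Filter.Eventually.of_forall hpos),
    hΦ.fwdDiff_potential hn hFm hfin, ← ofReal_norm]
  refine ENNReal.ofReal_le_ofReal ?_
  simp_rw [zero_sub, ← Complex.ofReal_mul]
  rw [integral_complex_ofReal, Complex.norm_real]
  simp_rw [mul_assoc]
  rw [integral_const_mul]
  refine (le_abs_self _).trans ?_
  rw [abs_mul, abs_pow, abs_neg, abs_one, one_pow, one_mul, Real.norm_eq_abs]

/-- On the cone the signed difference of the kernel is at least $c'\Omega_\varphi$. Integrating it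
against $\sigma(V_n|y|^n)$ in polar coordinates gives the integral over $(0,\tau_0)$, and
monotonicity in $\tau$ extends this to $(0,T)$. The set and constants do not depend on $\sigma$ or
$\delta$. -/
theorem IsRegularKernel.exists_setLIntegral_coneBall_le (h : IsRegularKernel n k Φ a₁ a₂ z₁ δ₁)
    {T : ℝ} (hT : 0 < T) :
    ∃ (S : Set (EuclideanSpace ℝ (Fin n))) (C : ℝ≥0∞) (h₀ : ℝ), MeasurableSet S ∧ C ≠ ⊤ ∧
      0 < h₀ ∧ ∀ σ : ℝ → ℝ≥0∞, AntitoneOn σ (Ioo 0 T) →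
        (∀ τ, 0 < τ → topExtend ((Ioo 0 T).indicator σ) τ < ∞) →
        ∫⁻ τ in Ioi 0, ephi n Φ τ * rearr volume (fun y => ‖(coneProfile T σ S y : ℂ)‖ₑ) τ < ∞ →
        ∀ δ : ℝ, 0 < δ → δ ≤ h₀ →
          ∫⁻ τ in Ioo 0 T, ENNReal.ofReal (bigOmega n k Φ (δ ^ n) τ) * σ τ ≤
            C * modulus k (potential Φ fun y => (coneProfile T σ S y : ℂ)) δ := by
  have hn := h.one_le_n
  have hk1 : (1 : ℝ) ≤ k := by exact_mod_cast h.one_le_k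
  have hz₁ := h.z₁_pos
  obtain ⟨e, he⟩ := exists_unit_vector hn
  obtain ⟨c, c', hc0, hc1, hc', hlow⟩ := h.exists_le_fwdDiff (V := EuclideanSpace ℝ (Fin n))
  obtain ⟨κ, hκ0, hκt, hpolar⟩ := exists_setLIntegral_coneBall hn hc1 he
  -- Half of $z_1$ is reserved for $(k+1)|y|$ and half for the displacement $k\delta$, hence the
  -- bound $\delta\le z_1/(2k)$ below. The second entry ensures $\tau_0<T$.
  set r₀ := min (z₁ / (2 * (k + 1))) (volRadius n (T / 2)) with hr₀
  have hr₀pos : 0 < r₀ := lt_min (by positivity) (volRadius_pos (by linarith))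
  have hr₀z : (k + 1) * r₀ ≤ z₁ / 2 := by
    have := min_le_left (z₁ / (2 * (k + 1))) (volRadius n (T / 2))
    calc (k + 1) * r₀ ≤ (k + 1) * (z₁ / (2 * (k + 1))) := by gcongr
      _ = z₁ / 2 := by field_simp
  set τ₀ := ballVol n * r₀ ^ n with hτ₀
  have hτ₀pos : 0 < τ₀ := mul_pos (ballVol_pos n) (pow_pos hr₀pos n)
  have hτ₀T : τ₀ < T := by
    have h1 : r₀ ^ n ≤ (volRadius n (T / 2)) ^ n := by
      gcongr
      exact min_le_right _ _
    have h2 := volRadius_pow hn (τ := T / 2) (by linarith)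
    nlinarith [ballVol_pos n]
  have hrad : volRadius n τ₀ = r₀ := volRadius_ballVol hn hr₀pos.le
  have hκc0 : κ * ENNReal.ofReal c' ≠ 0 := mul_ne_zero hκ0 (by simpa using hc')
  have hκct : κ * ENNReal.ofReal c' ≠ ⊤ := ENNReal.mul_ne_top hκt ENNReal.ofReal_ne_top
  refine ⟨coneBall c e r₀, ENNReal.ofReal (max 1 (T / τ₀)) * (κ * ENNReal.ofReal c')⁻¹,
    z₁ / (2 * k), measurableSet_coneBall _ _ _,
    ENNReal.mul_ne_top ENNReal.ofReal_ne_top (ENNReal.inv_ne_top.2 hκc0), by positivity,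
    fun σ hσ hσfin hfin δ hδ hδh => ?_⟩
  have hkδ : k * δ ≤ z₁ / 2 := by
    calc k * δ ≤ k * (z₁ / (2 * k)) := by gcongr
      _ = z₁ / 2 := by field_simp
  set S := coneBall c e r₀ with hS
  set F := coneProfile T σ S with hFdef
  have hF : Measurable F := measurable_coneProfile hσ (measurableSet_coneBall _ _ _)
  have hΩanti : AntitoneOn (fun τ => ENNReal.ofReal (bigOmega n k Φ (δ ^ n) τ)) (Ioi 0) :=
    fun a ha b hb hab => ENNReal.ofReal_le_ofReal (h.bigOmega_antitoneOn (pow_pos hδ n) ha hb hab)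
  set s := topExtend ((Ioo 0 T).indicator σ) with hsdef
  have hsanti : Antitone s := topExtend_antitone (antitoneOn_indicator_Ioo hσ)
  set ω := topExtend fun τ => ENNReal.ofReal (bigOmega n k Φ (δ ^ n) τ) with hωdef
  have hωanti : Antitone ω := topExtend_antitone hΩanti
  have hpt : ∀ y ∈ S, y ≠ 0 ∧ c' * bigOmega n k Φ (δ ^ n) (ballVol n * ‖y‖ ^ n) ≤
      (-1) ^ k * (fwdDiff (δ • e))^[k] (fun x => Φ ‖x‖) (-y) := by
    intro y hy
    have hy1 : c * ‖-y‖ < ⟪-y, e⟫ := by rw [norm_neg]; exact hy.1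
    have hy2 : ‖y‖ < r₀ := mem_ball_zero_iff.1 hy.2
    have h1 := hlow e (-y) δ he hy1
    rw [norm_neg] at h1
    refine ⟨fun h0 => ?_, h1 ?_ ?_ hδ⟩
    · simp [h0] at hy1
    · have : (k + 1) * ‖y‖ ≤ (k + 1) * r₀ := by gcongr
      linarith
    · nlinarith
  have hFval : ∀ y ∈ S, ENNReal.ofReal (F y) = s (ballVol n * ‖y‖ ^ n) := by
    intro y hy
    rw [hFdef, coneProfile, indicator_of_mem hy,
      ENNReal.ofReal_toReal (hσfin _ (volVar_pos (hpt y hy).1)).ne]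
  have hge := h.enorm_fwdDiff_potential_ge (k := k) hn hF hfin (δ • e) (fun y => by
    by_cases hy : y ∈ S
    · refine mul_nonneg (le_trans ?_ (hpt y hy).2) (coneProfile_nonneg _ _ _ _)
      exact mul_nonneg hc'.le (h.bigOmega_nonneg (pow_pos hδ n) (volVar_pos (hpt y hy).1))
    · rw [hFdef, coneProfile, indicator_of_notMem hy, mul_zero])
  have hmod : ‖(fwdDiff (δ • e))^[k] (potential Φ fun y => (F y : ℂ)) 0‖ₑ ≤
      modulus k (potential Φ fun y => (F y : ℂ)) δ := by
    refine le_trans ?_ (le_iSup₂ (f := fun (v : EuclideanSpace ℝ (Fin n)) (_ : ‖v‖ ≤ δ) =>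
      supNorm ((fwdDiff v)^[k] (potential Φ fun y => (F y : ℂ)))) (δ • e)
      (by rw [norm_smul, he, Real.norm_of_nonneg hδ.le, mul_one]))
    exact le_iSup (fun x => ‖(fwdDiff (δ • e))^[k] (potential Φ fun y => (F y : ℂ)) x‖ₑ) 0
  have hcore : κ * ENNReal.ofReal c' *
      ∫⁻ τ in Ioo 0 τ₀, ENNReal.ofReal (bigOmega n k Φ (δ ^ n) τ) * σ τ ≤
        modulus k (potential Φ fun y => (F y : ℂ)) δ := by
    refine le_trans ?_ (hge.trans hmod)
    have hp := hpolar (fun τ => ENNReal.ofReal c' * (ω τ * s τ)) τ₀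
      ((hωanti.measurable.mul hsanti.measurable).const_mul _) hτ₀pos.le
    rw [hrad, lintegral_const_mul' _ (fun τ => ω τ * s τ) ENNReal.ofReal_ne_top, ← mul_assoc] at hp
    have hsub : ∫⁻ τ in Ioo 0 τ₀, ENNReal.ofReal (bigOmega n k Φ (δ ^ n) τ) * σ τ =
        ∫⁻ τ in Ioo 0 τ₀, ω τ * s τ := by
      refine setLIntegral_congr_fun measurableSet_Ioo fun τ hτ => ?_
      have hτT : τ ∈ Ioo 0 T := ⟨hτ.1, hτ.2.trans hτ₀T⟩
      simp [hωdef, hsdef, topExtend, not_le.2 hτ.1, hτT.2, hτ.1]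
    rw [hsub, ← hp]
    refine (setLIntegral_mono' (measurableSet_coneBall _ _ _) fun y hy => ?_).trans
      (setLIntegral_le_lintegral S _)
    obtain ⟨hy0, hyle⟩ := hpt y hy
    have hv := volVar_pos hy0
    have hω : ω (ballVol n * ‖y‖ ^ n) =
        ENNReal.ofReal (bigOmega n k Φ (δ ^ n) (ballVol n * ‖y‖ ^ n)) := by
      simp [hωdef, topExtend, not_le.2 hv]
    rw [hω, ← hFval y hy, ← mul_assoc, ← ENNReal.ofReal_mul hc'.le, ← ENNReal.ofReal_mul
      (mul_nonneg hc'.le (h.bigOmega_nonneg (pow_pos hδ n) hv))]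
    exact ENNReal.ofReal_le_ofReal (mul_le_mul_of_nonneg_right hyle (coneProfile_nonneg _ _ _ _))
  have hext := lintegral_Ioo_le_of_antitoneOn (L := T)
    (g := fun τ => ENNReal.ofReal (bigOmega n k Φ (δ ^ n) τ) * σ τ) hτ₀pos (by
      rw [max_eq_right hτ₀T.le]
      exact fun a ha b hb hab => mul_le_mul' (hΩanti ha.1 hb.1 hab) (hσ ha hb hab))
  refine hext.trans ?_
  rw [mul_assoc]
  refine mul_le_mul_right ?_ _
  rw [← ENNReal.div_eq_inv_mul, ENNReal.le_div_iff_mul_le (Or.inl hκc0) (Or.inl hκct), mul_comm]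
  exact hcore

theorem modulus_mono (k : ℕ) (u : EuclideanSpace ℝ (Fin n) → ℂ) : Monotone (modulus k u) :=
  fun _ _ hst => iSup₂_le fun v hv => le_iSup₂ (f := fun (v : EuclideanSpace ℝ (Fin n)) _ =>
    supNorm ((fwdDiff v)^[k] u)) v (hv.trans hst)

/-- Every element of the cone `K` is dominated by the modulus of smoothness of a potential. -/
theorem IsRegularKernel.exists_lintegral_le_scaledModulus
    (h : IsRegularKernel n k Φ a₁ a₂ z₁ δ₁) (E : RIS n) {T : ℝ} (hT : 0 < T)
    (hφ : assocNormOn E T (fun τ => ENNReal.ofReal (phi n Φ τ)) < ∞) :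
    ∃ C : ℝ≥0∞, C ≠ ⊤ ∧ ∀ σ : ℝ → ℝ≥0∞, AntitoneOn σ (Ioo 0 T) → luxNormOn E T σ < ∞ →
      ∃ f, E.MemComplex f ∧ E.toFun (fun y => ‖f y‖ₑ) ≤ luxNormOn E T σ ∧ ∀ t ∈ Ioo 0 T,
        ∫⁻ τ in Ioo 0 T, ENNReal.ofReal (bigOmega n k Φ t τ) * σ τ ≤
          C * scaledModulus k (potential Φ f) t := by
  have hn := h.one_le_n
  have hn0 : n ≠ 0 := by omega
  obtain ⟨S, C, h₀, hS, hC, hh₀, hmain⟩ := h.exists_setLIntegral_coneBall_le hT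
  obtain ⟨C', hC', hpot⟩ := h.exists_lintegral_ephi_rearr_le hn E hT hφ
  -- For $t>h_0^n$ the lower estimate is used at $h_0^n$ instead of $t$; `M` is the resulting loss
  -- in $\Omega_\varphi$.
  set M := (max 1 (T / h₀ ^ n)) ^ ((k : ℝ) / n) with hM
  refine ⟨ENNReal.ofReal M * C, ENNReal.mul_ne_top ENNReal.ofReal_ne_top hC,
    fun σ hσ hσE => ?_⟩
  have hle := toFun_coneProfile_le hn E hσ hS
  have hmem : E.MemComplex fun y => (coneProfile T σ S y : ℂ) :=
    ⟨(Complex.measurable_ofReal.comp (measurable_coneProfile hσ hS)).aemeasurable,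
      hle.trans_lt hσE⟩
  have hfin := (hpot _ hmem).trans_lt (ENNReal.mul_lt_top hC'.lt_top hmem.2)
  refine ⟨fun y => (coneProfile T σ S y : ℂ), hmem, hle, fun t ht => ?_⟩
  have hr0 : 0 < t ^ (1 / (n : ℝ)) := Real.rpow_pos_of_pos ht.1 _
  have hrn : (t ^ (1 / (n : ℝ))) ^ n = t := by
    rw [one_div, Real.rpow_inv_natCast_pow ht.1.le hn0]
  set δ := min (t ^ (1 / (n : ℝ))) h₀ with hδ
  have hδ0 : 0 < δ := lt_min hr0 hh₀
  have hδt : δ ^ n ≤ t := by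
    rw [← hrn]
    exact pow_le_pow_left₀ hδ0.le (min_le_left _ _) n
  have hratio : t / δ ^ n ≤ max 1 (T / h₀ ^ n) := by
    rcases le_total (t ^ (1 / (n : ℝ))) h₀ with hle' | hle'
    · rw [hδ, min_eq_left hle', hrn, div_self ht.1.ne']
      exact le_max_left _ _
    · rw [hδ, min_eq_right hle']
      refine le_trans ?_ (le_max_right _ _)
      have := ht.2
      gcongr
  have hcore := hmain σ hσ (fun τ hτ => topExtend_lt_top_of_luxNormOn_lt_top hn E hT hσ hσE hτ)
    hfin δ hδ0 (min_le_right _ _)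
  calc ∫⁻ τ in Ioo 0 T, ENNReal.ofReal (bigOmega n k Φ t τ) * σ τ
      ≤ ∫⁻ τ in Ioo 0 T, ENNReal.ofReal M *
          (ENNReal.ofReal (bigOmega n k Φ (δ ^ n) τ) * σ τ) := by
        refine setLIntegral_mono' measurableSet_Ioo fun τ hτ => ?_
        rw [← mul_assoc, ← ENNReal.ofReal_mul (by positivity)]
        refine mul_le_mul_left (ENNReal.ofReal_le_ofReal ?_) _
        refine (h.bigOmega_le (pow_pos hδ0 n) hδt hτ.1).trans ?_
        refine mul_le_mul_of_nonneg_right ?_ (h.bigOmega_nonneg (pow_pos hδ0 n) hτ.1)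
        have := ht.1
        exact Real.rpow_le_rpow (by positivity) hratio (by positivity)
    _ = ENNReal.ofReal M * ∫⁻ τ in Ioo 0 T, ENNReal.ofReal (bigOmega n k Φ (δ ^ n) τ) * σ τ :=
        lintegral_const_mul' _ _ ENNReal.ofReal_ne_top
    _ ≤ ENNReal.ofReal M * (C * modulus k
          (potential Φ fun y => (coneProfile T σ S y : ℂ)) δ) := mul_le_mul_right hcore _
    _ ≤ _ := by
        rw [mul_assoc]
        exact mul_le_mul_right (mul_le_mul_right (modulus_mono k _ (min_le_left _ _)) _) _

end LowerEstimate

/-! ### Inclusions of generalized Banach function spaces -/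

section Inclusions

theorem FunctionNorm.toFun_zero {α : Type} [MeasurableSpace α] {μ : Measure α}
    (ρ : FunctionNorm μ) : ρ.toFun (fun _ => 0) = 0 :=
  (ρ.eq_zero_iff' _ aemeasurable_const).2 (Filter.EventuallyEq.refl _ _)

theorem FunctionNorm.toFun_sum_le {α : Type} [MeasurableSpace α] {μ : Measure α}
    (ρ : FunctionNorm μ) {g : ℕ → α → ℝ≥0∞} (hg : ∀ j, AEMeasurable (g j) μ) (m : ℕ) :
    ρ.toFun (fun x => ∑ j ∈ Finset.range m, g j x) ≤ ∑ j ∈ Finset.range m, ρ.toFun (g j) := by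
  induction m with
  | zero => simp [ρ.toFun_zero]
  | succ m ih =>
    simp only [Finset.sum_range_succ]
    exact (ρ.add_le' _ _ (Finset.aemeasurable_fun_sum _ fun j _ => hg j) (hg m)).trans
      (add_le_add ih le_rfl)

/-- An inclusion between spaces with the Fatou property is bounded. -/
theorem FunctionNorm.exists_toFun_le_of_subset {α : Type} [MeasurableSpace α] {μ : Measure α}
    (ρ ρ' : FunctionNorm μ) (hsub : ∀ f, ρ.Mem f → ρ'.Mem f) :
    ∃ C : ℝ≥0, ∀ f, ρ.Mem f → ρ'.toFun f ≤ C * ρ.toFun f := by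
  by_contra! hcon
  -- Gliding hump: normalised to $\rho(g_j)=2^{-j}$, these functions have $\rho'(g_j)\ge2^j$. By the
  -- Fatou property their sum has finite $\rho$, yet it dominates every $g_j$.
  choose f hf hlt using fun j : ℕ => hcon (4 ^ j)
  have hne : ∀ j, ρ.toFun (f j) ≠ 0 := fun j h0 => by
    have h1 := (ρ.eq_zero_iff' _ (hf j).1).1 h0
    have h2 := (ρ'.eq_zero_iff' _ (hf j).1).2 h1
    exact absurd (hlt j) (by simp [h2])
  have hlift : ∀ j, ((ρ.toFun (f j)).toNNReal : ℝ≥0∞) = ρ.toFun (f j) := fun j =>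
    ENNReal.coe_toNNReal (hf j).2.ne
  set a : ℕ → ℝ≥0 := fun j => (ρ.toFun (f j)).toNNReal
  have ha0 : ∀ j, a j ≠ 0 := fun j h0 => hne j (by
    rw [← hlift, show (ρ.toFun (f j)).toNNReal = 0 from h0]; rfl)
  set c : ℕ → ℝ≥0 := fun j => (2 ^ j * a j)⁻¹ with hc
  set g : ℕ → α → ℝ≥0∞ := fun j x => c j * f j x with hg
  have hgm : ∀ j, AEMeasurable (g j) μ := fun j => (hf j).1.const_mul _
  have hca : ∀ j, c j * a j = (2 ^ j)⁻¹ := fun j => by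
    have := ha0 j
    simp only [hc]
    field_simp
  have hρ : ∀ j, ρ.toFun (g j) = (((2 ^ j)⁻¹ : ℝ≥0) : ℝ≥0∞) := fun j => by
    rw [hg, ρ.smul' _ _ (hf j).1, ← hlift, ← hca j, ENNReal.coe_mul]
  have hρ' : ∀ j, ((2 ^ j : ℝ≥0) : ℝ≥0∞) ≤ ρ'.toFun (g j) := fun j => by
    rw [hg, ρ'.smul' _ _ (hf j).1]
    refine le_trans ?_ (mul_le_mul_right (hlt j).le _)
    rw [← hlift, ← ENNReal.coe_mul, ← ENNReal.coe_mul, ENNReal.coe_le_coe]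
    change (2 : ℝ≥0) ^ j ≤ c j * (4 ^ j * a j)
    rw [mul_left_comm, hca, show (4 : ℝ≥0) = 2 * 2 by norm_num, mul_pow,
      mul_inv_cancel_right₀ (by positivity)]
  set S : ℕ → α → ℝ≥0∞ := fun m x => ∑ j ∈ Finset.range m, g j x with hS
  have hSm : ∀ m, AEMeasurable (S m) μ := fun m => Finset.aemeasurable_fun_sum _ fun j _ => hgm j
  have hSmono : Monotone S := fun m m' hmm x =>
    Finset.sum_le_sum_of_subset (Finset.range_mono hmm)
  have hsup : ρ.Mem fun x => ⨆ m, S m x := by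
    refine ⟨AEMeasurable.iSup hSm, ?_⟩
    rw [ρ.fatou' S hSm hSmono]
    refine lt_of_le_of_lt (iSup_le fun m => ?_) (ENNReal.coe_lt_top (r := 2))
    refine (ρ.toFun_sum_le hgm m).trans ?_
    simp_rw [hρ]
    rw [← ENNReal.ofNNReal_finsetSum, ENNReal.coe_le_coe, ← NNReal.coe_le_coe]
    push_cast
    simp_rw [← inv_pow]
    have := sum_geometric_two_le m
    simpa [one_div] using this
  refine absurd (hsub _ hsup).2 (not_lt.2 (top_le_iff.2 ?_))
  refine ENNReal.eq_top_of_forall_nnreal_le fun r => ?_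
  obtain ⟨j, hj⟩ := pow_unbounded_of_one_lt r (one_lt_two (α := ℝ≥0))
  calc (r : ℝ≥0∞) ≤ ((2 ^ j : ℝ≥0) : ℝ≥0∞) := ENNReal.coe_le_coe.2 hj.le
    _ ≤ ρ'.toFun (g j) := hρ' j
    _ ≤ _ := by
      refine ρ'.mono' _ _ (hgm j) (AEMeasurable.iSup hSm) (Filter.Eventually.of_forall fun x => ?_)
      exact (Finset.single_le_sum_of_canonicallyOrdered (f := fun j => g j x)
        (Finset.self_mem_range_succ j)).trans (le_iSup (fun m => S m x) (j + 1))

/-- The constant $C+1$ replaces $C$ because it is nonzero: for $C=0$ and an empty index family the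
product $0\cdot\infty=0$ would give a false bound. -/
theorem le_mul_iInf₂ {ι : Type*} {p : ι → Prop} {F : ι → ℝ≥0∞} {N : ℝ≥0∞} {C : ℝ≥0}
    (h : ∀ i, p i → N ≤ C * F i) : N ≤ (C + 1 : ℝ≥0) * ⨅ (i) (_ : p i), F i := by
  have h0 : ((C + 1 : ℝ≥0) : ℝ≥0∞) ≠ 0 := by simp
  rw [mul_comm, ← ENNReal.div_le_iff h0 ENNReal.coe_ne_top]
  refine le_iInf₂ fun i hi => ?_
  rw [ENNReal.div_le_iff h0 ENNReal.coe_ne_top, mul_comm]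
  exact (h i hi).trans (mul_le_mul_left (ENNReal.coe_le_coe.2 (by simp)) _)

end Inclusions

/-! ### Embeddings of spaces of potentials and of cones -/

section Embeddings

variable {n k : ℕ} {Φ : ℝ → ℝ} {a₁ a₂ z₁ δ₁ : ℝ}

theorem aemeasurable_scaledModulus (k : ℕ) (u : EuclideanSpace ℝ (Fin n) → ℂ) (T : ℝ) :
    AEMeasurable (scaledModulus k u) (volume.restrict (Ioo 0 T)) :=
  aemeasurable_restrict_of_monotoneOn measurableSet_Ioo fun _ ha _ _ hab =>
    modulus_mono k u (Real.rpow_le_rpow ha.1.le hab (by positivity))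

/-- The rearrangement $f^*$ is an admissible $\sigma$. It represents an element $w$ of $K$ with
$\varrho_K(w)\le\|f\|_E$, and the modulus of $G*f$ is at most a multiple of $w$. The infimum over
all $f$ representing the potential is taken at the end. -/
theorem IsRegularKernel.embeds_of_coneEmbeds (h : IsRegularKernel n k Φ a₁ a₂ z₁ δ₁) (E : RIS n)
    {T : ℝ} (hT : 0 < T) (hφ : assocNormOn E T (fun τ => ENNReal.ofReal (phi n Φ τ)) < ∞)
    {X : GBFS T} (hX : ConeEmbeds (coneK k E Φ T) (rhoK k E Φ T) X) :
    Embeds (potentialSpace E Φ) (potentialNorm E Φ) (calderonSpace n k X)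
      (calderonNorm n k X) := by
  have hn := h.one_le_n
  obtain ⟨C₁, hC₁, hmod⟩ := h.exists_scaledModulus_le hT
  obtain ⟨C₂, hC₂, hpot⟩ := h.exists_lintegral_ephi_rearr_le hn E hT hφ
  obtain ⟨C₃, hC₃⟩ := E.exists_lintegral_rearr_le hn hT.le
  obtain ⟨hK, c, hc⟩ := hX
  lift C₁ to ℝ≥0 using hC₁
  lift C₂ to ℝ≥0 using hC₂
  have hfin : ∀ f, E.MemComplex f →
      ∫⁻ τ in Ioi 0, ephi n Φ τ * rearr volume (fun y => ‖f y‖ₑ) τ < ∞ := fun f hf =>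
    (hpot f hf).trans_lt (ENNReal.mul_lt_top ENNReal.coe_lt_top hf.2)
  have hsup : ∀ f, E.MemComplex f →
      supNorm (potential Φ f) ≤ C₂ * E.toFun (fun y => ‖f y‖ₑ) := fun f hf =>
    iSup_le fun x => (h.enorm_potential_le hn hf.1 x).trans (hpot f hf)
  have hXle : ∀ f, E.MemComplex f → X.toFun (scaledModulus k (potential Φ f)) ≤
      (C₁ * c : ℝ≥0) * E.toFun (fun y => ‖f y‖ₑ) := by
    intro f hf
    set w : ℝ → ℝ≥0∞ := fun t => ∫⁻ τ in Ioo 0 T, ENNReal.ofReal (bigOmega n k Φ t τ) *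
      rearr volume (fun y => ‖f y‖ₑ) τ
    have hlux := luxNormOn_rearr_le hn E T hf.1.enorm
    have hrep : Represents k E Φ T (rearr volume fun y => ‖f y‖ₑ) w :=
      ⟨(rearr_antitone _).antitoneOn _, hlux.trans_lt hf.2, fun t _ => rfl⟩
    have hwK : w ∈ coneK k E Φ T := ⟨_, hrep⟩
    have hrho : rhoK k E Φ T w ≤ E.toFun (fun y => ‖f y‖ₑ) := 
      (iInf₂_le (f := fun σ (_ : Represents k E Φ T σ w) => luxNormOn E T σ) _ hrep).trans hlux
    calc X.toFun (scaledModulus k (potential Φ f)) ≤ X.toFun (fun t => C₁ * w t) := by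
          refine X.mono' _ _ (aemeasurable_scaledModulus k _ T) ((hK w hwK).1.const_mul _) ?_
          filter_upwards [ae_restrict_mem measurableSet_Ioo] with t ht
          exact hmod f hf.1 (hfin f hf) t ht
      _ = C₁ * X.toFun w := X.smul' _ _ (hK w hwK).1
      _ ≤ C₁ * (c * E.toFun (fun y => ‖f y‖ₑ)) :=
          mul_le_mul_right ((hc w hwK).trans (mul_le_mul_right hrho _)) _
      _ = _ := by rw [ENNReal.coe_mul, mul_assoc]
  refine ⟨?_, C₂ + C₁ * c + 1, fun u _ => le_mul_iInf₂ ?_⟩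
  · rintro u ⟨f, hf, rfl⟩
    refine ⟨⟨h.uniformContinuous_potential hn hf.1 (hfin f hf) hT
      ((hC₃ _ hf.1.enorm).trans_lt (ENNReal.mul_lt_top ENNReal.coe_lt_top hf.2)), ?_⟩,
      aemeasurable_scaledModulus k _ T, ?_⟩
    · exact (hsup f hf).trans_lt (ENNReal.mul_lt_top ENNReal.coe_lt_top hf.2)
    · exact (hXle f hf).trans_lt (ENNReal.mul_lt_top ENNReal.coe_lt_top hf.2)
  · rintro f ⟨hf, rfl⟩
    rw [calderonNorm, ENNReal.coe_add, add_mul]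
    exact add_le_add (hsup f hf) (hXle f hf)

/-- Each $\sigma$ yields a function $f$ with $\|f\|_E\le\|\sigma\|$ whose potential has a modulus
dominating the element represented by $\sigma$, so the bound on potentials transfers to the cone. -/
theorem IsRegularKernel.coneEmbeds_of_embeds (h : IsRegularKernel n k Φ a₁ a₂ z₁ δ₁) (E : RIS n)
    {T : ℝ} (hT : 0 < T) (hφ : assocNormOn E T (fun τ => ENNReal.ofReal (phi n Φ τ)) < ∞)
    {X : GBFS T} (hX : Embeds (potentialSpace E Φ) (potentialNorm E Φ) (calderonSpace n k X)
      (calderonNorm n k X)) :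
    ConeEmbeds (coneK k E Φ T) (rhoK k E Φ T) X := by
  obtain ⟨C, hC, hlow⟩ := h.exists_lintegral_le_scaledModulus E hT hφ
  obtain ⟨hsub, c, hc⟩ := hX
  lift C to ℝ≥0 using hC
  -- Elements of the cone are nondecreasing on $(0,T)$, as $\Omega_\varphi$ is in its first
  -- variable.
  have hmeas : ∀ w σ, Represents k E Φ T σ w →
      AEMeasurable w (volume.restrict (Ioo 0 T)) := by
    intro w σ hσ
    refine aemeasurable_restrict_of_monotoneOn measurableSet_Ioo fun a ha b hb hab => ?_
    rw [hσ.2.2 a ha, hσ.2.2 b hb]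
    exact setLIntegral_mono' measurableSet_Ioo fun τ hτ =>
      mul_le_mul_left (ENNReal.ofReal_le_ofReal (h.bigOmega_mono ha.1 hab hτ.1)) _
  have hle : ∀ w σ, Represents k E Φ T σ w →
      X.toFun w ≤ (C * c : ℝ≥0) * luxNormOn E T σ := by
    intro w σ hσ
    obtain ⟨f, hf, hfσ, hft⟩ := hlow σ hσ.1 hσ.2.1
    have hu : potential Φ f ∈ potentialSpace E Φ := ⟨f, hf, rfl⟩
    have hnorm : potentialNorm E Φ (potential Φ f) ≤ luxNormOn E T σ :=
      (iInf₂_le (f := fun (g : EuclideanSpace ℝ (Fin n) → ℂ)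
        (_ : E.MemComplex g ∧ potential Φ g = potential Φ f) => E.toFun (fun x => ‖g x‖ₑ))
        f ⟨hf, rfl⟩).trans hfσ
    calc X.toFun w ≤ X.toFun (fun t => C * scaledModulus k (potential Φ f) t) := by
          refine X.mono' _ _ (hmeas w σ hσ)
            ((aemeasurable_scaledModulus k _ T).const_mul _) ?_
          filter_upwards [ae_restrict_mem measurableSet_Ioo] with t ht
          rw [hσ.2.2 t ht]
          exact hft t ht
      _ = C * X.toFun (scaledModulus k (potential Φ f)) :=
          X.smul' _ _ (aemeasurable_scaledModulus k _ T)
      _ ≤ C * calderonNorm n k X (potential Φ f) := mul_le_mul_right le_add_self _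
      _ ≤ C * (c * luxNormOn E T σ) :=
          mul_le_mul_right ((hc _ hu).trans (mul_le_mul_right hnorm _)) _
      _ = _ := by rw [ENNReal.coe_mul, mul_assoc]
  refine ⟨?_, C * c + 1, fun w _ => le_mul_iInf₂ fun σ hσ => hle w σ hσ⟩
  rintro w ⟨σ, hσ⟩
  exact ⟨hmeas w σ hσ, (hle w σ hσ).trans_lt (ENNReal.mul_lt_top ENNReal.coe_lt_top hσ.2.1)⟩

/-- Optimality provides only a set inclusion of the GBFS; its norm bound comes from
`FunctionNorm.exists_toFun_le_of_subset`. -/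
theorem calderonSpace_embeds_of_subset (n k : ℕ) {T : ℝ} {X Y : GBFS T}
    (hsub : ∀ f, X.Mem f → Y.Mem f) :
    Embeds (calderonSpace n k X) (calderonNorm n k X) (calderonSpace n k Y)
      (calderonNorm n k Y) := by
  obtain ⟨C, hC⟩ := X.exists_toFun_le_of_subset Y.toFunctionNorm hsub
  refine ⟨fun u hu => ⟨hu.1, hsub _ hu.2⟩, C + 1, fun u hu => ?_⟩
  rw [calderonNorm, calderonNorm, mul_add]
  refine add_le_add ?_ ((hC _ hu.2).trans (mul_le_mul_left (ENNReal.coe_le_coe.2 (by simp)) _))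
  calc supNorm u = 1 * supNorm u := (one_mul _).symm
    _ ≤ _ := mul_le_mul_left (by simp) _

end Embeddings

end CalderonEmb

/-! ### Optimality of the Calderón space -/

theorem corollary3p1 (n k : ℕ) (hn : 1 ≤ n) (hk : 1 ≤ k) (T : ℝ) (hT : 0 < T)
    (E : RIS n) (Φ : ℝ → ℝ) (hΦ : IsStandard n Φ)
    (hφ : assocNormOn E T (fun τ => ENNReal.ofReal (phi n Φ τ)) < ∞)
    (hΦk : ContDiffOn ℝ (k : ℕ∞) Φ (Ioi 0))
    (a₁ a₂ z₁ δ₁ : ℝ) (ha₁ : 0 < a₁) (ha₂ : 0 < a₂) (hz₁ : 0 < z₁) (hδ₁ : 0 < δ₁)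
    (hnear : ∀ j : ℕ, 1 ≤ j → j ≤ k → ∀ z : ℝ, 0 < z → z ≤ z₁ →
      z ^ (2 * j) * |radialDeriv j Φ z| ≤ a₁ * Φ z)
    (hfar : ∀ j : ℕ, 1 ≤ j → j ≤ k → ∀ z : ℝ, z₁ < z →
      z ^ (2 * j) * |radialDeriv j Φ z| ≤ a₂ * z ^ k * Φ z)
    (hlower : ∀ z : ℝ, 0 < z → z ≤ z₁ →
      δ₁ * Φ z ≤ (-1) ^ k * z ^ k * iteratedDeriv k Φ z)
    (X₀ : GBFS T) (hX₀ : IsOptimal (coneK k E Φ T) (rhoK k E Φ T) X₀) :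
    Embeds (potentialSpace E Φ) (potentialNorm E Φ)
        (calderonSpace n k X₀) (calderonNorm n k X₀) ∧
      ∀ X : GBFS T,
        Embeds (potentialSpace E Φ) (potentialNorm E Φ)
            (calderonSpace n k X) (calderonNorm n k X) →
          Embeds (calderonSpace n k X₀) (calderonNorm n k X₀)
            (calderonSpace n k X) (calderonNorm n k X) := by
  have h : IsRegularKernel n k Φ a₁ a₂ z₁ δ₁ :=
    { hΦ with
      one_le_n := hn, one_le_k := hk, contDiffOn := hΦk, a₁_pos := ha₁, a₂_pos := ha₂,
      z₁_pos := hz₁, δ₁_pos := hδ₁, near := hnear, far := hfar, lower := hlower }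
  exact ⟨h.embeds_of_coneEmbeds E hT hφ hX₀.1, fun X hX =>
    calderonSpace_embeds_of_subset n k (hX₀.2 X (h.coneEmbeds_of_embeds E hT hφ hX))⟩
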